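/- **Theorem 1.** Let $R\in\mathbb{R}$ and let $H:(R,\infty)\to(0,\infty)$ be smooth and monotone decreasing, with $H'(y)\to0$ as $y\to+\infty$, $H''$ bounded, and $H(y)\to 0$ as $y\to+\infty$. Let $\Omega\subset\mathbb{R}^2$ be a domain with $C^\infty$ boundary $\partial\Omega$ which coincides with the infinite peak $\Pi_R=\{x: x_1>R,\ -H(x_1)<x_2<H(x_1)\}$ inside the half-plane $\{x_1>R\}$ and is bounded outside this half-plane. Let $\Gamma_D,\Gamma_N,\Gamma_M$ be pairwise disjoint unions of finite families of open curves in $\partial\Omega$ (any of them may be empty) with $\partial\Omega=\overline{\Gamma_D}\cup\overline{\Gamma_N}\cup\overline{\Gamma_M}$ (clamped, traction-free and hinged part of the boundary), and let $\nu\in[0,1/2)$. Let $\mathbb{H}$ be the space of all $u\in H^2(\Omega)$ such that, in the sense of traces, $u=\partial_n u=0$ on $\Gamma_D$ and $u=0$ on $\Gamma_M$, and let $$a(u,v)=\int_\Omega\Big(\partial_1^2u\,\overline{\partial_1^2v}+\partial_2^2u\,\overline{\partial_2^2v}+2(1-\nu)\,\partial_1\partial_2u\,\overline{\partial_1\partial_2v}+\nu\big(\partial_1^2u\,\overline{\partial_2^2v}+\partial_2^2u\,\overline{\partial_1^2v}\big)\Big)dx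 .$$ The Kirchhoff plate operator $A$ is the unbounded operator in $L^2(\Omega)$ associated with this form: $u\in D(A)$ and $Au=f$ if and only if $u\in\mathbb{H}$, $f\in L^2(\Omega)$ and $a(u,v)=(f,v)_{L^2(\Omega)}$ for all $v\in\mathbb{H}$. Denote by $\Sigma_R^{\pm}=\{x: x_1>R,\ x_2=\pm H(x_1)\}$ the sides of the peak, and suppose that, up to sets of zero length, the boundary conditions contain one of the following: i) $u=0$ on both sides of the peak, i.e. $\Sigma_R^+\cup\Sigma_R^-\subset\Gamma_D\cup\Gamma_M$; or ii) $u=\partial_nu=0$ on one of the sides, i.e. $\Sigma_R^+\subset\Gamma_D$ or $\Sigma_R^-\subset\Gamma_D$. (This covers the cases D–D, D–M, D–N and M–M.) Then $A$ is self-adjoint and its spectrum is discrete: it consists of eigenvalues of finite multiplicity without a finite accumulation point. -/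

import Mathlib

open MeasureTheory Set Filter Topology
open scoped ContDiff ENNReal Gradient

noncomputable section

namespace KirchhoffPlate

/-- The Euclidean plane. -/
abbrev Plane : Type := EuclideanSpace ℝ (Fin 2)

/-- The complex Hilbert space `L²(Ω)`. -/
abbrev L2 (Ω : TopologicalSpace.Opens Plane) : Type :=
  Lp ℂ 2 (volume.restrict (Ω : Set Plane))

/-! ### Domains with smooth boundary and an infinite peak -/

/-- `ρ` is a smooth function which defines `Ω` as `{ρ < 0}` near the boundary point `p`, with
non-vanishing gradient at `p`. -/
structure IsDefiningAt (Ω : TopologicalSpace.Opens Plane) (p : Plane) (ρ : Plane → ℝ) : Prop where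
  mem_frontier : p ∈ frontier (Ω : Set Plane)
  contDiff : ContDiff ℝ ∞ ρ
  gradient_ne_zero : ∇ ρ p ≠ 0
  mem_iff : ∀ᶠ x in 𝓝 p, (x ∈ Ω ↔ ρ x < 0)

/-- The boundary of `Ω` is of class `C^∞` (and `Ω` lies locally on one side of it). -/
def HasSmoothBoundary (Ω : TopologicalSpace.Opens Plane) : Prop :=
  ∀ p ∈ frontier (Ω : Set Plane), ∃ ρ : Plane → ℝ, IsDefiningAt Ω p ρ

open Classical in
/-- The outward unit normal to `∂Ω`: the normalized gradient of a local defining function. It does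
not depend on the choice of the latter; the value is `0` where there is no such function. -/
def outwardNormal (Ω : TopologicalSpace.Opens Plane) (p : Plane) : Plane :=
  if h : ∃ ρ : Plane → ℝ, IsDefiningAt Ω p ρ then
    ‖∇ h.choose p‖⁻¹ • ∇ h.choose p
  else 0

/-- The standing assumptions on the profile `H` of the peak, on the half-line `(R, ∞)`: `H` is
positive, smooth, decreasing, its derivative tends to zero and its second derivative is bounded. -/
structure IsPeakProfile (H : ℝ → ℝ) (R : ℝ) : Prop where
  contDiffOn : ContDiffOn ℝ ∞ H (Ioi R)
  pos : ∀ y ∈ Ioi R, 0 < H y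
  antitoneOn : AntitoneOn H (Ioi R)
  tendsto_deriv : Tendsto (deriv H) atTop (𝓝 0)
  deriv2_bounded : ∃ C : ℝ, ∀ y ∈ Ioi R, |deriv (deriv H) y| ≤ C

/-- The infinite peak `{x₁ > R, -H(x₁) < x₂ < H(x₁)}`. -/
def peak (H : ℝ → ℝ) (R : ℝ) : Set Plane :=
  {x | R < x 0 ∧ -H (x 0) < x 1 ∧ x 1 < H (x 0)}

/-- The upper side of the peak. -/
def upperSide (H : ℝ → ℝ) (R : ℝ) : Set Plane := {x | R < x 0 ∧ x 1 = H (x 0)}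

/-- The lower side of the peak. -/
def lowerSide (H : ℝ → ℝ) (R : ℝ) : Set Plane := {x | R < x 0 ∧ x 1 = -H (x 0)}

/-- `Ω` is a domain with smooth boundary which coincides with the peak in the half-plane
`{x₁ > R}` and is bounded outside this half-plane. -/
structure IsPeakDomain (Ω : TopologicalSpace.Opens Plane) (H : ℝ → ℝ) (R : ℝ) : Prop where
  isConnected : IsConnected (Ω : Set Plane)
  smoothBoundary : HasSmoothBoundary Ω
  inter_halfPlane : (Ω : Set Plane) ∩ {x | R < x 0} = peak H R
  isBounded : Bornology.IsBounded ((Ω : Set Plane) ∩ {x | x 0 ≤ R})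

/-- `Γ` is the union of a finite family of open curves in `∂Ω`, i.e. of non-empty, connected,
relatively open subsets of `∂Ω` (a whole component of `∂Ω` is allowed too). -/
def IsFiniteUnionOfCurves (Ω : TopologicalSpace.Opens Plane) (Γ : Set Plane) : Prop :=
  ∃ S : Set (Set Plane), S.Finite ∧ Γ = ⋃₀ S ∧
    ∀ γ ∈ S, IsConnected γ ∧ ∃ U : Set Plane, IsOpen U ∧ γ = U ∩ frontier (Ω : Set Plane)

/-- The decomposition of `∂Ω` into the clamped, the traction-free and the hinged part. Any of the
three may be empty. -/
structure IsBoundaryDecomposition (Ω : TopologicalSpace.Opens Plane) (ΓD ΓN ΓM : Set Plane) :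
    Prop where
  curvesD : IsFiniteUnionOfCurves Ω ΓD
  curvesN : IsFiniteUnionOfCurves Ω ΓN
  curvesM : IsFiniteUnionOfCurves Ω ΓM
  disjointDN : Disjoint ΓD ΓN
  disjointDM : Disjoint ΓD ΓM
  disjointNM : Disjoint ΓN ΓM
  closure_union : closure ΓD ∪ closure ΓN ∪ closure ΓM = frontier (Ω : Set Plane)

/-! ### The Sobolev space `H²(Ω)` -/

/-- The classical partial derivative `∂ᵢφ`. -/
def pderiv {F : Type*} [NormedAddCommGroup F] [NormedSpace ℝ F] (i : Fin 2) (φ : Plane → F)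
    (x : Plane) : F :=
  fderiv ℝ φ x (EuclideanSpace.single i 1)

/-- `w ∈ L²(Ω)` is the weak derivative `∂ᵢu` of `u ∈ L²(Ω)` in `Ω`. -/
def HasWeakDeriv {Ω : TopologicalSpace.Opens Plane} (i : Fin 2) (u w : L2 Ω) : Prop :=
  ∀ φ : Plane → ℝ, ContDiff ℝ ∞ φ → HasCompactSupport φ → tsupport φ ⊆ (Ω : Set Plane) →
    ∫ x in (Ω : Set Plane), pderiv i φ x • u x = -∫ x in (Ω : Set Plane), φ x • w x

open Classical in
/-- The weak derivative `∂ᵢu` (`0` if it does not exist in `L²(Ω)`). -/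
def weakDeriv {Ω : TopologicalSpace.Opens Plane} (i : Fin 2) (u : L2 Ω) : L2 Ω :=
  if h : ∃ w : L2 Ω, HasWeakDeriv i u w then h.choose else 0

/-- `u ∈ H²(Ω)`: the weak derivatives of `u` up to the second order exist in `L²(Ω)`. -/
def MemH2 {Ω : TopologicalSpace.Opens Plane} (u : L2 Ω) : Prop :=
  ∀ i : Fin 2, (∃ w : L2 Ω, HasWeakDeriv i u w) ∧
    ∀ j : Fin 2, ∃ w : L2 Ω, HasWeakDeriv j (weakDeriv i u) w

/-- The distance in `H²(Ω)` between a smooth function `φ` and `u ∈ H²(Ω)`. -/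
def distH2 {Ω : TopologicalSpace.Opens Plane} (φ : Plane → ℂ) (u : L2 Ω) : ℝ≥0∞ :=
  eLpNorm (fun x => φ x - u x) 2 (volume.restrict (Ω : Set Plane)) +
    ∑ i : Fin 2, eLpNorm (fun x => pderiv i φ x - weakDeriv i u x) 2
      (volume.restrict (Ω : Set Plane)) +
    ∑ i : Fin 2, ∑ j : Fin 2,
      eLpNorm (fun x => pderiv j (pderiv i φ) x - weakDeriv j (weakDeriv i u) x) 2
        (volume.restrict (Ω : Set Plane))

/-! ### Boundary conditions in the sense of traces -/

/-- `B u = 0` on `Γ ⊆ ∂Ω` in the sense of traces. Here `B` is a boundary operator which is bounded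
from `H²(Ω)` to `L²` of every bounded part of `∂Ω` (with respect to arc length, i.e. the
one-dimensional Hausdorff measure), namely the restriction to the boundary or the normal
derivative. For `u ∈ H²(Ω)`, `B u` is given by extension by continuity from the dense subspace of
restrictions to `Ω` of functions in `C_c^∞(ℝ²)`; so `B u = 0` on `Γ` if and only if `u` can be
approximated in `H²(Ω)` by such functions `φ` with `B φ` small in `L²` of bounded parts of `Γ`. -/
def TraceEqZero {Ω : TopologicalSpace.Opens Plane} (B : (Plane → ℂ) → Plane → ℂ) (Γ : Set Plane)
    (u : L2 Ω) : Prop :=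
  ∀ ε : ℝ≥0∞, 0 < ε → ∀ r : ℝ, ∃ φ : Plane → ℂ, ContDiff ℝ ∞ φ ∧ HasCompactSupport φ ∧
    distH2 φ u < ε ∧ eLpNorm (B φ) 2 (μH[1].restrict (Γ ∩ Metric.ball 0 r)) < ε

/-- The normal derivative `∂ₙφ` on the boundary of `Ω`. -/
def normalDeriv (Ω : TopologicalSpace.Opens Plane) (φ : Plane → ℂ) (x : Plane) : ℂ :=
  fderiv ℝ φ x (outwardNormal Ω x)

/-- `u ∈ H²(Ω)` satisfies the stable boundary conditions `u = ∂ₙu = 0` on `ΓD` and `u = 0` on `ΓM`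
in the sense of traces. -/
structure MemEnergySpace {Ω : TopologicalSpace.Opens Plane} (ΓD ΓM : Set Plane) (u : L2 Ω) :
    Prop where
  memH2 : MemH2 u
  trace_eq_zero : TraceEqZero id (ΓD ∪ ΓM) u
  normal_eq_zero : TraceEqZero (normalDeriv Ω) ΓD u

/-! ### Helper facts: the energy space is a linear space -/

section Helpers

variable {Ω : TopologicalSpace.Opens Plane}

lemma locallyIntegrableOn_L2 (w : L2 Ω) : LocallyIntegrableOn w (Ω : Set Plane) volume := by
  intro x hx
  obtain ⟨K, hK, hxK, hKΩ⟩ := exists_compact_subset Ω.isOpen hx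
  refine ⟨K, mem_nhdsWithin_of_mem_nhds (mem_interior_iff_mem_nhds.1 hxK), ?_⟩
  have h : MemLp w 2 (volume.restrict K) :=
    (Lp.memLp w).mono_measure (Measure.restrict_mono hKΩ le_rfl)
  have : IsFiniteMeasure (volume.restrict K) := ⟨by
    rw [Measure.restrict_apply_univ]; exact hK.measure_lt_top⟩
  exact h.integrable (by norm_num)

lemma integrable_smul_L2 (w : L2 Ω) {φ : Plane → ℝ} (hφ : Continuous φ)
    (hc : HasCompactSupport φ) :
    Integrable (fun x => φ x • w x) (volume.restrict (Ω : Set Plane)) := by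
  have h1 : MemLp φ 2 (volume.restrict (Ω : Set Plane)) :=
    (hφ.memLp_of_hasCompactSupport hc).restrict _
  exact memLp_one_iff_integrable.1 ((Lp.memLp w).smul h1)

lemma continuous_pderiv {F : Type*} [NormedAddCommGroup F] [NormedSpace ℝ F] (i : Fin 2)
    {φ : Plane → F} (hφ : ContDiff ℝ ∞ φ) : Continuous (pderiv i φ) :=
  (hφ.continuous_fderiv (by simp)).clm_apply continuous_const

lemma contDiff_pderiv {F : Type*} [NormedAddCommGroup F] [NormedSpace ℝ F] (i : Fin 2)
    {φ : Plane → F} (hφ : ContDiff ℝ ∞ φ) : ContDiff ℝ ∞ (pderiv i φ) :=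
  (hφ.fderiv_right (m := ∞) (by simp)).clm_apply contDiff_const

lemma hasCompactSupport_pderiv {F : Type*} [NormedAddCommGroup F] [NormedSpace ℝ F] (i : Fin 2)
    {φ : Plane → F} (hc : HasCompactSupport φ) : HasCompactSupport (pderiv i φ) :=
  hc.fderiv_apply (𝕜 := ℝ) _

/-- Weak derivatives are unique. -/
lemma HasWeakDeriv.unique {i : Fin 2} {u w w' : L2 Ω} (h : HasWeakDeriv i u w)
    (h' : HasWeakDeriv i u w') : w = w' := by
  rw [← sub_eq_zero]
  have key : ∀ᵐ x ∂(volume : Measure Plane), x ∈ (Ω : Set Plane) → (w - w' : L2 Ω) x = 0 := by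
    refine Ω.isOpen.ae_eq_zero_of_integral_contDiff_smul_eq_zero (locallyIntegrableOn_L2 _) ?_
    intro g hg hgc hgs
    have e1 : ∫ x, g x • (w - w' : L2 Ω) x = ∫ x in (Ω : Set Plane), g x • (w - w' : L2 Ω) x := by
      refine (setIntegral_eq_integral_of_forall_compl_eq_zero fun x hx => ?_).symm
      rw [image_eq_zero_of_notMem_tsupport fun hx' => hx (hgs hx'), zero_smul]
    have e2 : ∫ x in (Ω : Set Plane), g x • (w - w' : L2 Ω) x =
        ∫ x in (Ω : Set Plane), (g x • w x - g x • w' x) := by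
      refine integral_congr_ae ?_
      filter_upwards [Lp.coeFn_sub w w'] with x hx
      rw [hx, Pi.sub_apply, smul_sub]
    rw [e1, e2, integral_sub (integrable_smul_L2 w hg.continuous hgc)
      (integrable_smul_L2 w' hg.continuous hgc)]
    have a1 := h g hg hgc hgs
    have a2 := h' g hg hgc hgs
    rw [a1] at a2
    rw [neg_injective a2, sub_self]
  rw [Lp.ext_iff]
  refine EventuallyEq.trans ?_ (Lp.coeFn_zero ℂ 2 _).symm
  exact (ae_restrict_iff' Ω.isOpen.measurableSet).2 key

lemma HasWeakDeriv.weakDeriv_eq {i : Fin 2} {u w : L2 Ω} (h : HasWeakDeriv i u w) :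
    weakDeriv i u = w := by
  have hex : ∃ w : L2 Ω, HasWeakDeriv i u w := ⟨w, h⟩
  rw [weakDeriv, dif_pos hex]
  exact hex.choose_spec.unique h

lemma hasWeakDeriv_weakDeriv {i : Fin 2} {u : L2 Ω} (h : ∃ w : L2 Ω, HasWeakDeriv i u w) :
    HasWeakDeriv i u (weakDeriv i u) := by
  rw [weakDeriv, dif_pos h]
  exact h.choose_spec

lemma HasWeakDeriv.add {i : Fin 2} {u u' w w' : L2 Ω} (h : HasWeakDeriv i u w)
    (h' : HasWeakDeriv i u' w') : HasWeakDeriv i (u + u') (w + w') := by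
  intro φ hφ hc hs
  have key : ∀ (a b : L2 Ω) {ψ : Plane → ℝ}, Continuous ψ → HasCompactSupport ψ →
      ∫ x in (Ω : Set Plane), ψ x • (a + b : L2 Ω) x =
        (∫ x in (Ω : Set Plane), ψ x • a x) + ∫ x in (Ω : Set Plane), ψ x • b x := by
    intro a b ψ hψ hψc
    rw [← integral_add (integrable_smul_L2 a hψ hψc) (integrable_smul_L2 b hψ hψc)]
    refine integral_congr_ae ?_
    filter_upwards [Lp.coeFn_add a b] with x hx
    rw [hx, Pi.add_apply, smul_add]
  rw [key u u' (continuous_pderiv i hφ) (hasCompactSupport_pderiv i hc),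
    key w w' hφ.continuous hc, h φ hφ hc hs, h' φ hφ hc hs, neg_add]

lemma HasWeakDeriv.smul {i : Fin 2} {u w : L2 Ω} (c : ℂ) (h : HasWeakDeriv i u w) :
    HasWeakDeriv i (c • u) (c • w) := by
  intro φ hφ hc hs
  have key : ∀ (a : L2 Ω) (ψ : Plane → ℝ),
      ∫ x in (Ω : Set Plane), ψ x • (c • a : L2 Ω) x =
        c • ∫ x in (Ω : Set Plane), ψ x • a x := by
    intro a ψ
    rw [← integral_smul]
    refine integral_congr_ae ?_
    filter_upwards [Lp.coeFn_smul c a] with x hx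
    rw [hx, Pi.smul_apply, smul_comm]
  rw [key u, key w, h φ hφ hc hs, smul_neg]

lemma MemH2.weakDeriv_add {u v : L2 Ω} (hu : MemH2 u) (hv : MemH2 v) (i : Fin 2) :
    weakDeriv i (u + v) = weakDeriv i u + weakDeriv i v :=
  ((hasWeakDeriv_weakDeriv (hu i).1).add (hasWeakDeriv_weakDeriv (hv i).1)).weakDeriv_eq

lemma MemH2.weakDeriv_smul {u : L2 Ω} (hu : MemH2 u) (c : ℂ) (i : Fin 2) :
    weakDeriv i (c • u) = c • weakDeriv i u :=
  ((hasWeakDeriv_weakDeriv (hu i).1).smul c).weakDeriv_eq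

lemma MemH2.weakDeriv2_add {u v : L2 Ω} (hu : MemH2 u) (hv : MemH2 v) (i j : Fin 2) :
    weakDeriv j (weakDeriv i (u + v)) =
      weakDeriv j (weakDeriv i u) + weakDeriv j (weakDeriv i v) := by
  rw [hu.weakDeriv_add hv]
  exact ((hasWeakDeriv_weakDeriv ((hu i).2 j)).add
    (hasWeakDeriv_weakDeriv ((hv i).2 j))).weakDeriv_eq

lemma MemH2.weakDeriv2_smul {u : L2 Ω} (hu : MemH2 u) (c : ℂ) (i j : Fin 2) :
    weakDeriv j (weakDeriv i (c • u)) = c • weakDeriv j (weakDeriv i u) := by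
  rw [hu.weakDeriv_smul]
  exact ((hasWeakDeriv_weakDeriv ((hu i).2 j)).smul c).weakDeriv_eq

lemma MemH2.add {u v : L2 Ω} (hu : MemH2 u) (hv : MemH2 v) : MemH2 (u + v) := by
  intro i
  refine ⟨⟨_, (hasWeakDeriv_weakDeriv (hu i).1).add (hasWeakDeriv_weakDeriv (hv i).1)⟩,
    fun j => ?_⟩
  rw [hu.weakDeriv_add hv]
  exact ⟨_, (hasWeakDeriv_weakDeriv ((hu i).2 j)).add (hasWeakDeriv_weakDeriv ((hv i).2 j))⟩

lemma MemH2.smul {u : L2 Ω} (hu : MemH2 u) (c : ℂ) : MemH2 (c • u) := by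
  intro i
  refine ⟨⟨_, (hasWeakDeriv_weakDeriv (hu i).1).smul c⟩, fun j => ?_⟩
  rw [hu.weakDeriv_smul]
  exact ⟨_, (hasWeakDeriv_weakDeriv ((hu i).2 j)).smul c⟩

lemma hasWeakDeriv_zero (i : Fin 2) : HasWeakDeriv i (0 : L2 Ω) 0 := by
  intro φ _ _ _
  have key : ∀ ψ : Plane → ℝ, ∫ x in (Ω : Set Plane), ψ x • (0 : L2 Ω) x = 0 := by
    intro ψ
    rw [← integral_zero Plane ℂ (μ := volume.restrict (Ω : Set Plane))]
    refine integral_congr_ae ?_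
    filter_upwards [Lp.coeFn_zero ℂ 2 (volume.restrict (Ω : Set Plane))] with x hx
    rw [hx, Pi.zero_apply, smul_zero]
  rw [key, key, neg_zero]

lemma memH2_zero : MemH2 (0 : L2 Ω) := by
  intro i
  refine ⟨⟨0, hasWeakDeriv_zero i⟩, fun j => ?_⟩
  rw [(hasWeakDeriv_zero i).weakDeriv_eq]
  exact ⟨0, hasWeakDeriv_zero j⟩

lemma pderiv_add {i : Fin 2} {φ ψ : Plane → ℂ} (hφ : ContDiff ℝ ∞ φ) (hψ : ContDiff ℝ ∞ ψ) :
    pderiv i (φ + ψ) = pderiv i φ + pderiv i ψ := by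
  ext x
  simp only [pderiv, Pi.add_apply]
  rw [fderiv_add (hφ.differentiable (by simp) x) (hψ.differentiable (by simp) x)]
  rfl

lemma pderiv_const_smul {i : Fin 2} {φ : Plane → ℂ} (hφ : ContDiff ℝ ∞ φ) (c : ℂ) :
    pderiv i (c • φ) = c • pderiv i φ := by
  ext x
  simp only [pderiv, Pi.smul_apply]
  rw [fderiv_const_smul (hφ.differentiable (by simp) x)]
  rfl

lemma eLpNorm_sub_add_le {φ ψ : Plane → ℂ} (hφ : Continuous φ) (hψ : Continuous ψ) (u v : L2 Ω) :
    eLpNorm (fun x => (φ + ψ) x - (u + v : L2 Ω) x) 2 (volume.restrict (Ω : Set Plane)) ≤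
      eLpNorm (fun x => φ x - u x) 2 (volume.restrict (Ω : Set Plane)) +
        eLpNorm (fun x => ψ x - v x) 2 (volume.restrict (Ω : Set Plane)) := by
  refine le_trans (le_of_eq (eLpNorm_congr_ae ?_)) (eLpNorm_add_le
    (hφ.aestronglyMeasurable.sub (Lp.aestronglyMeasurable u))
    (hψ.aestronglyMeasurable.sub (Lp.aestronglyMeasurable v)) (by norm_num))
  filter_upwards [Lp.coeFn_add u v] with x hx
  rw [hx]
  simp only [Pi.add_apply]
  ring

lemma eLpNorm_sub_smul (φ : Plane → ℂ) (u : L2 Ω) (c : ℂ) :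
    eLpNorm (fun x => (c • φ) x - (c • u : L2 Ω) x) 2 (volume.restrict (Ω : Set Plane)) =
      ‖c‖ₑ * eLpNorm (fun x => φ x - u x) 2 (volume.restrict (Ω : Set Plane)) := by
  rw [← eLpNorm_const_smul]
  refine eLpNorm_congr_ae ?_
  filter_upwards [Lp.coeFn_smul c u] with x hx
  rw [hx]
  simp only [Pi.smul_apply, smul_eq_mul]
  ring

lemma distH2_add_le {φ ψ : Plane → ℂ} (hφ : ContDiff ℝ ∞ φ) (hψ : ContDiff ℝ ∞ ψ) {u v : L2 Ω}
    (hu : MemH2 u) (hv : MemH2 v) : distH2 (φ + ψ) (u + v) ≤ distH2 φ u + distH2 ψ v := by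
  have e : ∀ i j : Fin 2, pderiv j (pderiv i (φ + ψ)) =
      pderiv j (pderiv i φ) + pderiv j (pderiv i ψ) := fun i j => by
    rw [pderiv_add hφ hψ, pderiv_add (contDiff_pderiv i hφ) (contDiff_pderiv i hψ)]
  have h0 := eLpNorm_sub_add_le hφ.continuous hψ.continuous u v
  have h1 : ∀ i : Fin 2, eLpNorm (fun x => pderiv i (φ + ψ) x - weakDeriv i (u + v) x) 2
      (volume.restrict (Ω : Set Plane)) ≤
      eLpNorm (fun x => pderiv i φ x - weakDeriv i u x) 2 (volume.restrict (Ω : Set Plane)) +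
      eLpNorm (fun x => pderiv i ψ x - weakDeriv i v x) 2 (volume.restrict (Ω : Set Plane)) := by
    intro i
    rw [pderiv_add hφ hψ, hu.weakDeriv_add hv]
    exact eLpNorm_sub_add_le (continuous_pderiv i hφ) (continuous_pderiv i hψ) _ _
  have h2 : ∀ i j : Fin 2, eLpNorm (fun x => pderiv j (pderiv i (φ + ψ)) x -
        weakDeriv j (weakDeriv i (u + v)) x) 2 (volume.restrict (Ω : Set Plane)) ≤
      eLpNorm (fun x => pderiv j (pderiv i φ) x - weakDeriv j (weakDeriv i u) x) 2
        (volume.restrict (Ω : Set Plane)) +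
      eLpNorm (fun x => pderiv j (pderiv i ψ) x - weakDeriv j (weakDeriv i v) x) 2
        (volume.restrict (Ω : Set Plane)) := by
    intro i j
    rw [e, hu.weakDeriv2_add hv]
    exact eLpNorm_sub_add_le (continuous_pderiv j (contDiff_pderiv i hφ))
      (continuous_pderiv j (contDiff_pderiv i hψ)) _ _
  unfold distH2
  refine (add_le_add (add_le_add h0 (Finset.sum_le_sum fun i _ => h1 i))
    (Finset.sum_le_sum fun i _ => Finset.sum_le_sum fun j _ => h2 i j)).trans (le_of_eq ?_)
  simp only [Finset.sum_add_distrib]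
  abel

lemma distH2_smul {φ : Plane → ℂ} (hφ : ContDiff ℝ ∞ φ) {u : L2 Ω} (hu : MemH2 u) (c : ℂ) :
    distH2 (c • φ) (c • u) = ‖c‖ₑ * distH2 φ u := by
  have e : ∀ i j : Fin 2, pderiv j (c • pderiv i φ) = c • pderiv j (pderiv i φ) :=
    fun i j => pderiv_const_smul (contDiff_pderiv i hφ) c
  have e' : ∀ i j : Fin 2, weakDeriv j (c • weakDeriv i u) = c • weakDeriv j (weakDeriv i u) :=
    fun i j => by rw [← hu.weakDeriv_smul, hu.weakDeriv2_smul]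
  unfold distH2
  simp only [hu.weakDeriv_smul, pderiv_const_smul hφ, e, e', eLpNorm_sub_smul,
    ← Finset.mul_sum, mul_add]

lemma IsDefiningAt.val_eq_zero {p : Plane} {τ : Plane → ℝ} (hτ : IsDefiningAt Ω p τ) : τ p = 0 := by
  have hp := hτ.mem_frontier
  rw [Ω.isOpen.frontier_eq] at hp
  refine le_antisymm ?_ (not_lt.1 fun h => hp.2 (hτ.mem_iff.self_of_nhds.2 h))
  have : (𝓝[(Ω : Set Plane)] p).NeBot := mem_closure_iff_nhdsWithin_neBot.1 hp.1
  have ht : Tendsto τ (𝓝[(Ω : Set Plane)] p) (𝓝 (τ p)) :=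
    hτ.contDiff.continuous.continuousAt.tendsto.mono_left nhdsWithin_le_nhds
  refine le_of_tendsto ht ?_
  filter_upwards [nhdsWithin_le_nhds hτ.mem_iff, self_mem_nhdsWithin] with x hx hxΩ
  exact (hx.1 hxΩ).le

/-- If the directional derivative of a defining function is negative, the direction points inside,
so that the directional derivative of another defining function is not positive. -/
lemma IsDefiningAt.inner_nonpos {p : Plane} {ρ σ : Plane → ℝ} (hρ : IsDefiningAt Ω p ρ)
    (hσ : IsDefiningAt Ω p σ) {v : Plane} (hv : inner ℝ (∇ ρ p) v < 0) :
    inner ℝ (∇ σ p) v ≤ 0 := by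
  have der : ∀ {τ : Plane → ℝ}, IsDefiningAt Ω p τ →
      HasDerivAt (fun t : ℝ => τ (p + t • v)) (inner ℝ (∇ τ p) v) 0 := by
    intro τ hτ
    have h1 : HasGradientAt τ (∇ τ p) (p + (0 : ℝ) • v) := by
      rw [zero_smul, add_zero]
      exact (hτ.contDiff.differentiable (by simp) p).hasGradientAt
    have h2 : HasDerivAt (fun t : ℝ => p + t • v) v 0 := by
      simpa using ((hasDerivAt_id (0 : ℝ)).smul_const v).const_add p
    have h3 := h1.hasFDerivAt.comp_hasDerivAt 0 h2
    rwa [InnerProductSpace.toDual_apply_apply] at h3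
  by_contra! hcon
  have lim : Tendsto (fun t : ℝ => p + t • v) (𝓝[>] 0) (𝓝 p) := by
    have : ContinuousAt (fun t : ℝ => p + t • v) 0 := by fun_prop
    simpa using this.tendsto.mono_left (nhdsWithin_le_nhds (s := Ioi (0 : ℝ)))
  have s1 := (hasDerivAt_iff_tendsto_slope.1 (der hρ)).mono_left
    (nhdsWithin_mono (0 : ℝ) (fun t (ht : t ∈ Ioi (0 : ℝ)) => ne_of_gt ht))
  have s2 := (hasDerivAt_iff_tendsto_slope.1 (der hσ)).mono_left
    (nhdsWithin_mono (0 : ℝ) (fun t (ht : t ∈ Ioi (0 : ℝ)) => ne_of_gt ht))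
  have ev := ((s1.eventually (gt_mem_nhds hv)).and (s2.eventually (lt_mem_nhds hcon))).and
    (((lim.eventually hρ.mem_iff).and (lim.eventually hσ.mem_iff)).and self_mem_nhdsWithin)
  obtain ⟨t, ⟨h1, h2⟩, ⟨h3, h4⟩, ht⟩ := ev.exists
  have ht : 0 < t := ht
  simp only [slope_def_field, zero_smul, add_zero, hρ.val_eq_zero, hσ.val_eq_zero, sub_zero]
    at h1 h2
  have h1' : ρ (p + t • v) < 0 := by
    have := mul_neg_of_neg_of_pos h1 ht
    rwa [div_mul_cancel₀ _ ht.ne'] at this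
  have h2' : 0 < σ (p + t • v) := by
    have := mul_pos h2 ht
    rwa [div_mul_cancel₀ _ ht.ne'] at this
  exact absurd (h4.1 (h3.2 h1')) (not_lt.2 h2'.le)

/-- Two defining functions at the same boundary point have the same normalized gradient. -/
lemma IsDefiningAt.normal_unique {p : Plane} {ρ σ : Plane → ℝ} (hρ : IsDefiningAt Ω p ρ)
    (hσ : IsDefiningAt Ω p σ) : ‖∇ ρ p‖⁻¹ • ∇ ρ p = ‖∇ σ p‖⁻¹ • ∇ σ p := by
  by_contra hne
  have na : ‖∇ ρ p‖ ≠ 0 := norm_ne_zero_iff.2 hρ.gradient_ne_zero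
  have nb : ‖∇ σ p‖ ≠ 0 := norm_ne_zero_iff.2 hσ.gradient_ne_zero
  set a := ‖∇ ρ p‖⁻¹ • ∇ ρ p with ha
  set b := ‖∇ σ p‖⁻¹ • ∇ σ p with hb
  have ha1 : ‖a‖ = 1 := by rw [ha, norm_smul, norm_inv, norm_norm, inv_mul_cancel₀ na]
  have hb1 : ‖b‖ = 1 := by rw [hb, norm_smul, norm_inv, norm_norm, inv_mul_cancel₀ nb]
  have hab : inner ℝ a b < 1 := (inner_lt_one_iff_real_of_norm_eq_one ha1 hb1).2 hne
  have ra : ∇ ρ p = ‖∇ ρ p‖ • a := by rw [ha, smul_smul, mul_inv_cancel₀ na, one_smul]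
  have rb : ∇ σ p = ‖∇ σ p‖ • b := by rw [hb, smul_smul, mul_inv_cancel₀ nb, one_smul]
  have h1 : inner ℝ (∇ ρ p) (b - a) < 0 := by
    rw [ra, inner_smul_left, inner_sub_right, real_inner_self_eq_norm_sq, ha1]
    refine mul_neg_of_pos_of_neg (norm_pos_iff.2 hρ.gradient_ne_zero) (by linarith)
  have h2 := hρ.inner_nonpos hσ h1
  rw [rb, inner_smul_left, inner_sub_right, real_inner_self_eq_norm_sq, hb1,
    real_inner_comm] at h2
  have h3 : 0 < ‖∇ σ p‖ * (1 ^ 2 - inner ℝ a b) :=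
    mul_pos (norm_pos_iff.2 hσ.gradient_ne_zero) (by linarith)
  exact absurd h2 (not_le.2 h3)

lemma IsDefiningAt.outwardNormal_eq {p : Plane} {ρ : Plane → ℝ} (hρ : IsDefiningAt Ω p ρ) :
    outwardNormal Ω p = ‖∇ ρ p‖⁻¹ • ∇ ρ p := by
  have hex : ∃ ρ : Plane → ℝ, IsDefiningAt Ω p ρ := ⟨ρ, hρ⟩
  rw [outwardNormal, dif_pos hex]
  exact hex.choose_spec.normal_unique hρ

lemma continuous_gradient {ρ : Plane → ℝ} (hρ : ContDiff ℝ ∞ ρ) : Continuous (∇ ρ) :=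
  (InnerProductSpace.toDual ℝ Plane).symm.continuous.comp (hρ.continuous_fderiv (by simp))

/-- A defining function at `p` is also one at all boundary points near `p`. -/
lemma IsDefiningAt.eventually {p : Plane} {ρ : Plane → ℝ} (hρ : IsDefiningAt Ω p ρ) :
    ∀ᶠ x in 𝓝 p, x ∈ frontier (Ω : Set Plane) → IsDefiningAt Ω x ρ := by
  filter_upwards [eventually_eventually_nhds.2 hρ.mem_iff,
    (continuous_gradient hρ.contDiff).continuousAt.eventually_ne hρ.gradient_ne_zero] with x h1 h2 h3
  exact ⟨h3, hρ.contDiff, h2, h1⟩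

lemma measurable_outwardNormal (Ω : TopologicalSpace.Opens Plane) :
    Measurable (outwardNormal Ω) := by
  classical
  set S : Set Plane := {p | ∃ ρ : Plane → ℝ, IsDefiningAt Ω p ρ} with hS
  have hSm : MeasurableSet S := by
    have : S = frontier (Ω : Set Plane) ∩ interior {x | x ∈ frontier (Ω : Set Plane) → x ∈ S} := by
      ext p
      constructor
      · rintro ⟨ρ, hρ⟩
        refine ⟨hρ.mem_frontier, mem_interior_iff_mem_nhds.2 ?_⟩
        filter_upwards [hρ.eventually] with x hx hxf
        exact ⟨ρ, hx hxf⟩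
      · rintro ⟨h1, h2⟩
        exact interior_subset h2 h1
    rw [this]
    exact isClosed_frontier.measurableSet.inter isOpen_interior.measurableSet
  have hcont : ContinuousOn (outwardNormal Ω) S := by
    rintro p ⟨ρ, hρ⟩
    have hc : ContinuousWithinAt (fun x => ‖∇ ρ x‖⁻¹ • ∇ ρ x) S p := by
      have hg : ContinuousAt (∇ ρ) p := (continuous_gradient hρ.contDiff).continuousAt
      exact ((hg.norm.inv₀ (norm_ne_zero_iff.2 hρ.gradient_ne_zero)).smul hg).continuousWithinAt
    refine hc.congr_of_eventuallyEq ?_ hρ.outwardNormal_eq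
    filter_upwards [nhdsWithin_le_nhds hρ.eventually, self_mem_nhdsWithin] with x hx hxS
    obtain ⟨σ, hσ⟩ := hxS
    exact (hx hσ.mem_frontier).outwardNormal_eq
  have hpw : outwardNormal Ω = S.piecewise (outwardNormal Ω) (fun _ => 0) := by
    ext1 p
    by_cases hp : p ∈ S
    · rw [piecewise_eq_of_mem _ _ _ hp]
    · rw [piecewise_eq_of_notMem _ _ _ hp, outwardNormal]
      exact dif_neg hp
  rw [hpw]
  exact hcont.measurable_piecewise continuousOn_const hSm

lemma measurable_normalDeriv {φ : Plane → ℂ} (hφ : ContDiff ℝ ∞ φ) :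
    Measurable (normalDeriv Ω φ) := by
  have h : Continuous fun q : Plane × Plane => fderiv ℝ φ q.1 q.2 :=
    ((hφ.continuous_fderiv (by simp)).comp continuous_fst).clm_apply continuous_snd
  exact h.measurable.comp (measurable_id.prodMk (measurable_outwardNormal Ω))

lemma normalDeriv_add {φ ψ : Plane → ℂ} (hφ : ContDiff ℝ ∞ φ) (hψ : ContDiff ℝ ∞ ψ) :
    normalDeriv Ω (φ + ψ) = normalDeriv Ω φ + normalDeriv Ω ψ := by
  ext x
  simp only [normalDeriv, Pi.add_apply]
  rw [fderiv_add (hφ.differentiable (by simp) x) (hψ.differentiable (by simp) x)]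
  rfl

lemma normalDeriv_const_smul {φ : Plane → ℂ} (hφ : ContDiff ℝ ∞ φ) (c : ℂ) :
    normalDeriv Ω (c • φ) = c • normalDeriv Ω φ := by
  ext x
  simp only [normalDeriv, Pi.smul_apply]
  rw [fderiv_const_smul (hφ.differentiable (by simp) x)]
  rfl

lemma TraceEqZero.add {B : (Plane → ℂ) → Plane → ℂ} {Γ : Set Plane}
    (hB : ∀ φ ψ : Plane → ℂ, ContDiff ℝ ∞ φ → ContDiff ℝ ∞ ψ → B (φ + ψ) = B φ + B ψ)
    (hm : ∀ φ : Plane → ℂ, ContDiff ℝ ∞ φ → Measurable (B φ)) {u v : L2 Ω}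
    (hu : MemH2 u) (hv : MemH2 v) (h : TraceEqZero B Γ u) (h' : TraceEqZero B Γ v) :
    TraceEqZero B Γ (u + v) := by
  intro ε hε r
  have hε2 : 0 < ε / 2 := ENNReal.half_pos hε.ne'
  obtain ⟨φ, h1, h2, h3, h4⟩ := h (ε / 2) hε2 r
  obtain ⟨ψ, k1, k2, k3, k4⟩ := h' (ε / 2) hε2 r
  refine ⟨φ + ψ, h1.add k1, h2.add k2, ?_, ?_⟩
  · calc _ ≤ _ := distH2_add_le h1 k1 hu hv
      _ < ε / 2 + ε / 2 := ENNReal.add_lt_add h3 k3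
      _ = ε := ENNReal.add_halves ε
  · rw [hB φ ψ h1 k1]
    calc _ ≤ _ := eLpNorm_add_le (hm φ h1).aestronglyMeasurable (hm ψ k1).aestronglyMeasurable
          (by norm_num)
      _ < ε / 2 + ε / 2 := ENNReal.add_lt_add h4 k4
      _ = ε := ENNReal.add_halves ε

lemma TraceEqZero.zero {B : (Plane → ℂ) → Plane → ℂ} {Γ : Set Plane} (hB : B 0 = 0) :
    TraceEqZero B Γ (0 : L2 Ω) := by
  intro ε hε r
  refine ⟨0, contDiff_const, HasCompactSupport.zero, ?_, ?_⟩
  · have := distH2_smul (Ω := Ω) (φ := 0) contDiff_const memH2_zero 0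
    rw [zero_smul, zero_smul, enorm_zero, zero_mul] at this
    rwa [this]
  · rwa [hB, eLpNorm_zero]

lemma TraceEqZero.smul {B : (Plane → ℂ) → Plane → ℂ} {Γ : Set Plane}
    (hB : ∀ (c : ℂ) (φ : Plane → ℂ), ContDiff ℝ ∞ φ → B (c • φ) = c • B φ) {u : L2 Ω}
    (hu : MemH2 u) (h : TraceEqZero B Γ u) (c : ℂ) : TraceEqZero B Γ (c • u) := by
  by_cases hc : c = 0
  · subst hc
    rw [zero_smul]
    refine TraceEqZero.zero ?_
    simpa using hB 0 0 contDiff_const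
  intro ε hε r
  have hc0 : ‖c‖ₑ ≠ 0 := enorm_ne_zero.2 hc
  have hct : ‖c‖ₑ ≠ ⊤ := enorm_ne_top
  obtain ⟨φ, h1, h2, h3, h4⟩ := h (ε / ‖c‖ₑ) (ENNReal.div_pos hε.ne' hct) r
  have hlt : ∀ {a : ℝ≥0∞}, a < ε / ‖c‖ₑ → ‖c‖ₑ * a < ε := by
    intro a ha
    rw [mul_comm]
    exact (ENNReal.lt_div_iff_mul_lt (Or.inl hc0) (Or.inl hct)).1 ha
  refine ⟨c • φ, contDiff_const.smul h1, h2.smul_left (f := fun _ => c), ?_, ?_⟩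
  · rw [distH2_smul h1 hu]
    exact hlt h3
  · rw [hB c φ h1, eLpNorm_const_smul]
    exact hlt h4

lemma memEnergySpace_add {ΓD ΓM : Set Plane} {u v : L2 Ω} (hu : MemEnergySpace ΓD ΓM u)
    (hv : MemEnergySpace ΓD ΓM v) : MemEnergySpace ΓD ΓM (u + v) where
  memH2 := hu.memH2.add hv.memH2
  trace_eq_zero := TraceEqZero.add (fun _ _ _ _ => rfl) (fun _ h => h.continuous.measurable)
    hu.memH2 hv.memH2 hu.trace_eq_zero hv.trace_eq_zero
  normal_eq_zero := TraceEqZero.add (fun _ _ h h' => normalDeriv_add h h')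
    (fun _ h => measurable_normalDeriv h) hu.memH2 hv.memH2 hu.normal_eq_zero hv.normal_eq_zero

lemma memEnergySpace_smul {ΓD ΓM : Set Plane} {u : L2 Ω} (c : ℂ) (hu : MemEnergySpace ΓD ΓM u) :
    MemEnergySpace ΓD ΓM (c • u) where
  memH2 := hu.memH2.smul c
  trace_eq_zero := TraceEqZero.smul (fun _ _ _ => rfl) hu.memH2 hu.trace_eq_zero c
  normal_eq_zero := TraceEqZero.smul (fun c _ h => normalDeriv_const_smul h c) hu.memH2
    hu.normal_eq_zero c

lemma memEnergySpace_zero {ΓD ΓM : Set Plane} : MemEnergySpace ΓD ΓM (0 : L2 Ω) where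
  memH2 := memH2_zero
  trace_eq_zero := TraceEqZero.zero rfl
  normal_eq_zero := TraceEqZero.zero (by
    have := normalDeriv_const_smul (Ω := Ω) (φ := 0) contDiff_const 0
    rwa [zero_smul, zero_smul] at this)

end Helpers

/-! ### The plate operator and its spectrum -/

/-- The space `ℍ`: the functions in `H²(Ω)` with `u = ∂ₙu = 0` on `ΓD` and `u = 0` on `ΓM`. -/
def energySpace (Ω : TopologicalSpace.Opens Plane) (ΓD ΓM : Set Plane) : Submodule ℂ (L2 Ω) where
  carrier := {u | MemEnergySpace ΓD ΓM u}
  add_mem' := memEnergySpace_add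
  zero_mem' := memEnergySpace_zero
  smul_mem' := fun c _ h => memEnergySpace_smul c h

/-- The sesquilinear form `a(u, v)` of the plate with Poisson ratio `ν` (linear in `u`, antilinear
in `v`), i.e. the integral over `Ω` of
`∂₁²u ∂₁²v̄ + ∂₂²u ∂₂²v̄ + 2 (1 - ν) ∂₁∂₂u ∂₁∂₂v̄ + ν (∂₁²u ∂₂²v̄ + ∂₂²u ∂₁²v̄)`.
Mathlib's inner product `inner ℂ g f` of `L²(Ω)` is the integral of `f ḡ`. -/
def plateForm {Ω : TopologicalSpace.Opens Plane} (ν : ℝ) (u v : L2 Ω) : ℂ :=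
  inner ℂ (weakDeriv 0 (weakDeriv 0 v)) (weakDeriv 0 (weakDeriv 0 u)) +
    inner ℂ (weakDeriv 1 (weakDeriv 1 v)) (weakDeriv 1 (weakDeriv 1 u)) +
    2 * (1 - (ν : ℂ)) * inner ℂ (weakDeriv 1 (weakDeriv 0 v)) (weakDeriv 1 (weakDeriv 0 u)) +
    (ν : ℂ) * (inner ℂ (weakDeriv 1 (weakDeriv 1 v)) (weakDeriv 0 (weakDeriv 0 u)) +
      inner ℂ (weakDeriv 0 (weakDeriv 0 v)) (weakDeriv 1 (weakDeriv 1 u)))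

lemma plateForm_add {Ω : TopologicalSpace.Opens Plane} (ν : ℝ) {u u' : L2 Ω} (hu : MemH2 u)
    (hu' : MemH2 u') (v : L2 Ω) :
    plateForm ν (u + u') v = plateForm ν u v + plateForm ν u' v := by
  simp only [plateForm]
  simp only [hu.weakDeriv2_add hu', inner_add_right]
  ring

lemma plateForm_smul {Ω : TopologicalSpace.Opens Plane} (ν : ℝ) {u : L2 Ω} (hu : MemH2 u)
    (c : ℂ) (v : L2 Ω) : plateForm ν (c • u) v = c * plateForm ν u v := by
  simp only [plateForm]
  simp only [hu.weakDeriv2_smul, inner_smul_right]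
  ring

/-- The graph of the operator associated with the form `a` on `ℍ`: the pairs `(u, f)` with `u ∈ ℍ`,
`f ∈ L²(Ω)` and `a(u, v) = (f, v)` for all `v ∈ ℍ`. -/
def plateGraph (Ω : TopologicalSpace.Opens Plane) (ν : ℝ) (ΓD ΓM : Set Plane) :
    Submodule ℂ (L2 Ω × L2 Ω) where
  carrier := {p | p.1 ∈ energySpace Ω ΓD ΓM ∧
    ∀ v ∈ energySpace Ω ΓD ΓM, plateForm ν p.1 v = inner ℂ v p.2}
  add_mem' := by
    rintro p q ⟨hp, hp'⟩ ⟨hq, hq'⟩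
    refine ⟨add_mem hp hq, fun v hv => ?_⟩
    rw [Prod.fst_add, Prod.snd_add, plateForm_add ν hp.memH2 hq.memH2, hp' v hv, hq' v hv,
      inner_add_right]
  zero_mem' := by
    refine ⟨zero_mem _, fun v _ => ?_⟩
    have := plateForm_smul ν (memH2_zero (Ω := Ω)) 0 v
    rw [zero_smul, zero_mul] at this
    rw [Prod.fst_zero, Prod.snd_zero, this, inner_zero_right]
  smul_mem' := by
    rintro c p ⟨hp, hp'⟩
    refine ⟨Submodule.smul_mem _ c hp, fun v hv => ?_⟩
    rw [Prod.smul_fst, Prod.smul_snd, plateForm_smul ν hp.memH2, hp' v hv, inner_smul_right]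

/-- The Kirchhoff plate operator `A`: the unbounded operator in `L²(Ω)` associated with the form
`a` on `ℍ`. -/
def plateOperator (Ω : TopologicalSpace.Opens Plane) (ν : ℝ) (ΓD ΓM : Set Plane) :
    L2 Ω →ₗ.[ℂ] L2 Ω :=
  (plateGraph Ω ν ΓD ΓM).toLinearPMap

section Spectrum

variable {E : Type*} [NormedAddCommGroup E] [InnerProductSpace ℂ E]

/-- `z` belongs to the resolvent set of the unbounded operator `A`: the operator
`A - z : D(A) → E` is a bijection with bounded inverse `S`. -/
def IsResolventPoint (A : E →ₗ.[ℂ] E) (z : ℂ) : Prop :=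
  ∃ S : E →L[ℂ] E, (∀ f : E, ∃ h : S f ∈ A.domain, A ⟨S f, h⟩ - z • S f = f) ∧
    ∀ u : A.domain, S (A u - z • (u : E)) = u

/-- The spectrum of an unbounded operator. -/
def spectrumOf (A : E →ₗ.[ℂ] E) : Set ℂ := {z | ¬ IsResolventPoint A z}

/-- The eigenspace of an unbounded operator, as a subspace of its domain. -/
def eigenspaceOf (A : E →ₗ.[ℂ] E) (z : ℂ) : Submodule ℂ A.domain :=
  LinearMap.ker (A.toFun - z • A.domain.subtype)

/-- The spectrum of `A` is discrete: it consists of eigenvalues of finite multiplicity which have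
no finite point of accumulation. -/
structure HasDiscreteSpectrum (A : E →ₗ.[ℂ] E) : Prop where
  finite_inter_closedBall : ∀ r : ℝ, (spectrumOf A ∩ Metric.closedBall 0 r).Finite
  eigenspace_ne_bot : ∀ z ∈ spectrumOf A, eigenspaceOf A z ≠ ⊥
  finiteDimensional_eigenspace : ∀ z ∈ spectrumOf A, FiniteDimensional ℂ (eigenspaceOf A z)

end Spectrum

end KirchhoffPlate

end

open KirchhoffPlate

/-!
The proof is the form method. On the energy space `ℍ`, with `0 ≤ ν < 1/2`, the form
`a(u, v) + (u, v)` is the inner product of the vectors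
`(u, √(1-ν) ∂₁²u, √(1-ν) ∂₂²u, √ν Δu, √(2(1-ν)) ∂₁∂₂u)` in `L²(Ω)⁵` (`inner_energyMap`), so `ℍ` is
identified with the range `W` of the linear map `energyMap`. Let `J : W → L²(Ω)` be the embedding.
If `W` is complete and `J` is compact with dense range, `S = J J†` is compact, symmetric and
injective, the plate operator is `A = S⁻¹ - 1`, and the spectral theory of `S` (the Fredholm
alternative, finiteness of the set of eigenvalues away from zero) gives the theorem:
`isSelfAdjoint_and_discrete_of_form`. Density is clear as test functions belong to `ℍ`
(`eq_zero_of_inner_energySpace`).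

*Completeness* (`isClosed_range_energyMap`). Weak derivatives are closed, and the vanishing of traces
is preserved by limits in `H²(Ω)`. Hence it suffices to bound the gradient by the function and its
Hessian, although `Ω` is not a Lipschitz domain at infinity (`exists_sqNorm_weakDeriv_le`). If `Ω`
contains the segments from the points of `S` in the direction `w`, Taylor's formula along the segments
gives `‖∂_w u‖² ≤ 8 ‖u‖² + 2 ‖∂_w² u‖²` on `S` (`sqNorm_dirDeriv_le`). On the bounded part of `Ω` this
is applied to an open cone of directions (`exists_cone`). In the peak, which grows towards smaller
`x₁`, it applies to `w = -e₁` and gives `∂₁u`. For `∂₂u` the boundary conditions are used on the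
vertical slices: if `u = 0` at both ends of a slice, `∂₂u` has mean value zero
(`sqNorm_pderiv_peak_le_of_ends`); if `∂ₙu = 0` at one end, `∂₂u = ± H' ∂₁u` there, and `∂₁u` is already
controlled (`sqNorm_pderiv_peak_le_of_normal`).

*Compactness* (`exists_ehrling`, `isCompactOperator_of_ehrling`). It suffices that for each `ε` the
square of the norm of `u` in `L²(Ω)` is at most `ε` times the square of the energy norm plus squares
of finitely many functionals. In the tail of the peak `u` vanishes on one of the sides, and the
Friedrichs inequality `‖u‖ ≤ C H(N) ‖∂₂u‖` on `{x₁ > N}` has a small constant for large `N`, as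
`H → 0` (`sqNorm_tail_le`). The rest of `Ω` is bounded, as a bound on `H''` prevents `H` from blowing up
at `R` (`IsPeakProfile.exists_bound`). There the functionals are the mean values on the squares of a
fine grid, by the Poincaré inequality (`ehrlingOn_of_interior`), after small translations which move
neighbourhoods of boundary points into the interior (`exists_ehrlingOn_near`).

All estimates are proved for smooth functions, with the traces as additional terms on the right, and
carry over to `ℍ` by approximation: `L²`-norms on a side with respect to `x₁` are at most those with
respect to arc length (`exists_lintegral_sideCurve_le`).
-/

namespace KirchhoffPlate

/-! ### Forms with compact domain and the spectrum of the associated operator -/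

section Abstract

variable {E W : Type*} [NormedAddCommGroup E] [InnerProductSpace ℂ E]
  [NormedAddCommGroup W] [InnerProductSpace ℂ W]

/-- An Ehrling-type inequality, i.e. the norm of `J w` is small compared with the norm of `w` up to
finitely many continuous functionals, makes `J` compact. -/
theorem isCompactOperator_of_ehrling [CompleteSpace E] (J : W →L[ℂ] E)
    (h : ∀ ε : ℝ, 0 < ε → ∃ (n : ℕ) (l : Fin n → W →L[ℂ] ℂ),
      ∀ w, ‖J w‖ ^ 2 ≤ ε * ‖w‖ ^ 2 + ∑ k, ‖l k w‖ ^ 2) : IsCompactOperator J := by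
  refine (isCompactOperator_iff_isCompact_closure_image_ball (J : W →ₗ[ℂ] E) one_pos).2 ?_
  refine TotallyBounded.isCompact_of_isClosed (TotallyBounded.closure ?_) isClosed_closure
  rw [Metric.totallyBounded_iff]
  intro ε hε
  obtain ⟨n, l, hl⟩ := h (ε ^ 2 / 8) (by positivity)
  -- the functionals map the ball to a bounded, hence totally bounded, subset of `ℂⁿ`
  set L : W →L[ℂ] (Fin n → ℂ) := ContinuousLinearMap.pi l with hL
  have hb : TotallyBounded (L '' Metric.ball 0 1) :=
    (L.lipschitz.isBounded_image Metric.isBounded_ball).isCompact_closure.totallyBounded.subset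
      subset_closure
  set η : ℝ := ε / (2 * (n + 1)) with hη
  have hη0 : 0 < η := by positivity
  obtain ⟨t, hts, htf, ht⟩ := Metric.finite_approx_of_totallyBounded hb η hη0
  have hts' : ∀ y ∈ t, ∃ x, x ∈ Metric.ball (0 : W) 1 ∧ L x = y := fun y hy => hts hy
  choose! g hg1 hg2 using hts'
  refine ⟨(fun y => J (g y)) '' t, htf.image _, ?_⟩
  rintro _ ⟨w, hw, rfl⟩
  have := ht ⟨w, hw, rfl⟩
  simp only [mem_iUnion] at this
  obtain ⟨y, hy, hwy⟩ := this
  simp only [mem_iUnion]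
  refine ⟨J (g y), mem_image_of_mem _ hy, ?_⟩
  rw [Metric.mem_ball, dist_eq_norm]
  change ‖J w - J (g y)‖ < ε
  rw [← map_sub]
  have h1 : ‖w - g y‖ ≤ 2 := by
    have a := mem_ball_zero_iff.1 hw
    have b := mem_ball_zero_iff.1 (hg1 y hy)
    linarith [norm_sub_le w (g y)]
  have h2 : ∀ k, ‖l k (w - g y)‖ ≤ η := by
    intro k
    have a : ‖(L w - y) k‖ ≤ ‖L w - y‖ := norm_le_pi_norm _ k
    rw [Metric.mem_ball, dist_eq_norm] at hwy
    have e : l k (w - g y) = (L w - y) k := by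
      rw [map_sub, Pi.sub_apply]
      conv_rhs => rw [← hg2 y hy]
      rfl
    rw [e]; exact a.trans hwy.le
  have h3 := hl (w - g y)
  have h4 : ∑ k, ‖l k (w - g y)‖ ^ 2 ≤ n * η ^ 2 := by
    calc _ ≤ ∑ _k : Fin n, η ^ 2 := Finset.sum_le_sum fun k _ => by gcongr; exact h2 k
      _ = _ := by simp
  have h5 : (n : ℝ) * η ^ 2 ≤ ε ^ 2 / 4 := by
    have : η * (n + 1) = ε / 2 := by rw [hη]; field_simp
    have hn : (0 : ℝ) ≤ n := Nat.cast_nonneg n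
    nlinarith [sq_nonneg (η * n), mul_nonneg hn (sq_nonneg η)]
  have h6 : ‖w - g y‖ ^ 2 ≤ 4 := by nlinarith [norm_nonneg (w - g y)]
  have h7 : ‖J (w - g y)‖ ^ 2 < ε ^ 2 := by nlinarith [sq_nonneg ε, pow_pos hε 2]
  exact lt_of_pow_lt_pow_left₀ 2 hε.le h7

/-- A compact symmetric operator has only finitely many eigenvalues outside a neighbourhood of
zero: normalized eigenvectors to different eigenvalues have images at a distance bounded below. -/
theorem finite_eigenvalues_norm_ge {S : E →L[ℂ] E} (hS : IsCompactOperator S)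
    (hsym : (S : E →ₗ[ℂ] E).IsSymmetric) {c : ℝ} (hc : 0 < c) :
    {μ : ℂ | Module.End.HasEigenvalue (S : E →ₗ[ℂ] E) μ ∧ c ≤ ‖μ‖}.Finite := by
  by_contra hinf
  set f := (Set.infinite_coe_iff.2 hinf).natEmbedding with hf
  have hv : ∀ n, ∃ v : E, S v = (f n : ℂ) • v ∧ ‖v‖ = 1 := by
    intro n
    obtain ⟨v, hv⟩ := (f n).2.1.exists_hasEigenvector
    refine ⟨((‖v‖⁻¹ : ℝ) : ℂ) • v, ?_, ?_⟩
    · have := hv.apply_eq_smul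
      rw [map_smul]
      change _ • (S : E →ₗ[ℂ] E) v = _
      rw [this, smul_comm]
    · rw [norm_smul, Complex.norm_real, norm_inv, norm_norm,
        inv_mul_cancel₀ (norm_ne_zero_iff.2 hv.2)]
  choose v hv1 hv2 using hv
  obtain ⟨K, hK, hK'⟩ := hS.image_closedBall_subset_compact 1
  obtain ⟨y, -, ψ, hψ, hψy⟩ := hK.tendsto_subseq (x := fun n => S (v n))
    (fun n => hK' ⟨v n, by simp [hv2], rfl⟩)
  replace hψy := hψy.cauchySeq
  rw [Metric.cauchySeq_iff'] at hψy
  obtain ⟨N, hN⟩ := hψy c hc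
  have h1 := hN (N + 1) (Nat.le_succ N)
  simp only [Function.comp, dist_eq_norm] at h1
  set a := ψ (N + 1)
  set b := ψ N
  have hab : a ≠ b := hψ.injective.ne (Nat.succ_ne_self N)
  have hne : (f a : ℂ) ≠ f b := fun h => hab (f.injective (Subtype.ext h))
  have horth : inner ℂ (v a) (v b) = 0 := by
    refine hsym.orthogonalFamily_eigenspaces hne (⟨v a, ?_⟩ : Module.End.eigenspace _ (f a : ℂ))
      (⟨v b, ?_⟩ : Module.End.eigenspace _ (f b : ℂ))
    · exact Module.End.mem_eigenspace_iff.2 (hv1 a)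
    · exact Module.End.mem_eigenspace_iff.2 (hv1 b)
  rw [hv1, hv1] at h1
  have h2 : ‖(f a : ℂ) • v a - (f b : ℂ) • v b‖ ^ 2 = ‖(f a : ℂ)‖ ^ 2 + ‖(f b : ℂ)‖ ^ 2 := by
    rw [@norm_sub_sq ℂ, inner_smul_left, inner_smul_right, horth, norm_smul, norm_smul, hv2, hv2]
    simp
  have h3 := (f a).2.2
  have h4 : ‖(f a : ℂ) • v a - (f b : ℂ) • v b‖ ^ 2 < c ^ 2 := by gcongr
  nlinarith [sq_nonneg ‖(f b : ℂ)‖]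

variable [CompleteSpace E]

/-- The relation `{(u, f) : u = S (f + u)}`, i.e. the graph of `S⁻¹ - 1`, is the graph of a
self-adjoint operator with discrete spectrum if `S` is compact, symmetric and injective. -/
theorem isSelfAdjoint_and_discrete_of_graph {S : E →L[ℂ] E} (hS : IsCompactOperator S)
    (hsym : (S : E →ₗ[ℂ] E).IsSymmetric) (hinj : Function.Injective S)
    {G : Submodule ℂ (E × E)} (hG : ∀ p : E × E, p ∈ G ↔ p.1 = S (p.2 + p.1)) :
    IsSelfAdjoint G.toLinearPMap ∧ HasDiscreteSpectrum G.toLinearPMap := by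
  have hsym' : ∀ x y, inner ℂ (S x) y = inner ℂ x (S y) := hsym
  have hgr : G.toLinearPMap.graph = G := by
    refine Submodule.toLinearPMap_graph_eq G fun x hx h0 => ?_
    rw [hG, h0, add_zero] at hx
    exact hinj (by rw [← hx, map_zero])
  have hdom : ∀ u, u ∈ G.toLinearPMap.domain ↔ ∃ f, u = S (f + u) := by
    intro u
    rw [LinearPMap.mem_domain_iff, hgr]
    exact exists_congr fun f => hG (u, f)
  have happ : ∀ (u : G.toLinearPMap.domain) (f : E), G.toLinearPMap u = f ↔
      (u : E) = S (f + u) := by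
    intro u f
    refine Iff.trans ?_ (hG ((u : E), f))
    constructor
    · rintro rfl
      exact hgr.le (G.toLinearPMap.mem_graph u)
    · intro h
      replace h := hgr.ge h
      obtain ⟨y, hy1, hy2⟩ := (LinearPMap.mem_graph_iff _).1 h
      have e : y = u := Subtype.ext hy1
      rw [← e]; exact hy2
  have hSdom : ∀ g, S g ∈ G.toLinearPMap.domain := fun g =>
    (hdom _).2 ⟨g - S g, by rw [sub_add_cancel]⟩
  have hdense : Dense (G.toLinearPMap.domain : Set E) := by
    rw [Submodule.dense_iff_topologicalClosure_eq_top, Submodule.topologicalClosure_eq_top_iff,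
      Submodule.eq_bot_iff]
    intro x hx
    refine hinj ?_
    rw [map_zero, ← inner_self_eq_zero (𝕜 := ℂ), ← hsym']
    exact (Submodule.mem_orthogonal _ _).1 hx _ (hSdom _)
  refine ⟨?_, ?_⟩
  · rw [LinearPMap.isSelfAdjoint_def]
    refine LinearPMap.eq_of_eq_graph ?_
    rw [LinearPMap.adjoint_graph_eq_graph_adjoint hdense, hgr]
    ext ⟨x, y⟩
    rw [Submodule.mem_adjoint_iff, hG]
    have key : ∀ g, (inner ℂ (g - S g) x - inner ℂ (S g) y = 0 ↔
        inner ℂ g (x - S (y + x)) = 0) := by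
      intro g
      rw [inner_sub_left, inner_sub_right, map_add, inner_add_right, hsym', hsym']
      constructor <;> intro h <;> linear_combination h
    constructor
    · intro h
      have : x - S (y + x) = 0 := ext_inner_left ℂ fun g => by
        rw [inner_zero_right, ← key]
        exact h _ _ ((hG (S g, g - S g)).2 (by rw [sub_add_cancel]))
      exact sub_eq_zero.1 this
    · intro h a b hab
      rw [hG] at hab
      have := (key (b + a)).2 (by rw [sub_eq_zero.2 h, inner_zero_right])
      simp only at hab
      rwa [← hab, add_sub_cancel_right] at this
  -- the eigenvalue `z` of the operator corresponds to the eigenvalue `(1 + z)⁻¹` of `S`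
  have heig : ∀ (z : ℂ), 1 + z ≠ 0 → ∀ u : E, S u = (1 + z)⁻¹ • u ↔ u = S (z • u + u) := by
    intro z hz u
    have : z • u + u = (1 + z) • u := by rw [add_smul, one_smul, add_comm]
    rw [this, map_smul]
    constructor
    · intro h; rw [h, smul_smul, mul_inv_cancel₀ hz, one_smul]
    · intro h; rw [eq_inv_smul_iff₀ hz, ← h]
  have hspec : ∀ z ∈ spectrumOf G.toLinearPMap, 1 + z ≠ 0 ∧
      Module.End.HasEigenvalue (S : E →ₗ[ℂ] E) (1 + z)⁻¹ := by
    intro z hz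
    have hz0 : 1 + z ≠ 0 := by
      intro h0
      have hz1 : z = -1 := by linear_combination h0
      refine hz ⟨S, fun f => ⟨hSdom f, ?_⟩, fun u => ?_⟩
      · have := (happ ⟨S f, hSdom f⟩ (f - S f)).2 (by simp)
        rw [this, hz1]; simp
      · rw [hz1, neg_smul, one_smul, sub_neg_eq_add]
        exact ((happ u _).1 rfl).symm
    refine ⟨hz0, ?_⟩
    have hμ : (1 + z)⁻¹ ≠ 0 := inv_ne_zero hz0
    refine (hS.hasEigenvalue_or_mem_resolventSet hμ).resolve_right fun hres => hz ?_
    rw [spectrum.mem_resolventSet_iff] at hres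
    obtain ⟨T, hT⟩ := hres
    set Q : E →L[ℂ] E := ↑T⁻¹ with hQ
    have hTv : ∀ x, (T : E →L[ℂ] E) x = (1 + z)⁻¹ • x - S x := by
      intro x; rw [hT]; simp [Algebra.algebraMap_eq_smul_one]
    have hTQ : ∀ x, (1 + z)⁻¹ • Q x - S (Q x) = x := by
      intro x; rw [← hTv]
      exact congrArg (fun A : E →L[ℂ] E => A x) T.mul_inv
    have hQT : ∀ x, Q ((1 + z)⁻¹ • x - S x) = x := by
      intro x; rw [← hTv]
      exact congrArg (fun A : E →L[ℂ] E => A x) T.inv_mul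
    refine ⟨(1 + z)⁻¹ • Q ∘L S, fun f => ?_, fun u => ?_⟩
    · set u : E := ((1 + z)⁻¹ • Q ∘L S) f with hu
      have hu' : u = (1 + z)⁻¹ • Q (S f) := rfl
      have e := hTQ (S f)
      have e1 : S u = (1 + z)⁻¹ • (u - S f) := by
        rw [← hu'] at e
        have e' : S (Q (S f)) = u - S f := eq_sub_of_add_eq (by
          rw [← eq_sub_iff_add_eq']; exact e.symm)
        conv_lhs => rw [hu', map_smul, e']
      have e2 : u = S ((f + z • u) + u) := by
        rw [map_add, map_add, map_smul, e1]
        have : (z • ((1 + z)⁻¹ • (u - S f)) + (1 + z)⁻¹ • (u - S f)) = u - S f := by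
          rw [smul_smul, ← add_smul]
          have : z * (1 + z)⁻¹ + (1 + z)⁻¹ = 1 := by field_simp; ring
          rw [this, one_smul]
        rw [add_assoc, this]; abel
      have hd : u ∈ G.toLinearPMap.domain := (hdom u).2 ⟨_, e2⟩
      refine ⟨hd, ?_⟩
      rw [(happ ⟨u, hd⟩ (f + z • u)).2 e2, add_sub_cancel_right]
    · have h1 := (happ u _).1 rfl
      change (1 + z)⁻¹ • Q (S (G.toLinearPMap u - z • (u : E))) = u
      have : S (G.toLinearPMap u - z • (u : E)) =
          (1 + z) • ((1 + z)⁻¹ • (u : E) - S u) := by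
        rw [map_add] at h1
        rw [map_sub, map_smul, smul_sub, smul_smul, mul_inv_cancel₀ hz0, one_smul, add_smul,
          one_smul, ← sub_sub]
        congr 1
        exact eq_sub_of_add_eq h1.symm
      rw [this, map_smul, smul_smul, inv_mul_cancel₀ hz0, one_smul, hQT]
  refine ⟨fun r => ?_, fun z hz => ?_, fun z hz => ?_⟩
  · by_cases hr : 0 ≤ r
    · have hfin := finite_eigenvalues_norm_ge hS hsym (c := (1 + r)⁻¹) (by positivity)
      refine Set.Finite.of_finite_image (f := fun z => (1 + z)⁻¹) (hfin.subset ?_) ?_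
      · rintro _ ⟨z, ⟨hz, hzr⟩, rfl⟩
        refine ⟨(hspec z hz).2, ?_⟩
        rw [norm_inv]
        have : ‖1 + z‖ ≤ 1 + r := by
          have := mem_closedBall_zero_iff.1 hzr
          calc ‖1 + z‖ ≤ ‖(1 : ℂ)‖ + ‖z‖ := norm_add_le _ _
            _ ≤ 1 + r := by rw [norm_one]; linarith
        exact inv_anti₀ (norm_pos_iff.2 (hspec z hz).1) this
      · intro a _ b _ hab
        exact add_left_cancel (inv_injective hab)
    · rw [Metric.closedBall_eq_empty.2 (not_le.1 hr), inter_empty]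
      exact finite_empty
  · obtain ⟨hz0, hev⟩ := hspec z hz
    obtain ⟨u, hu⟩ := hev.exists_hasEigenvector
    have h1 := (heig z hz0 u).1 hu.apply_eq_smul
    have hd : u ∈ G.toLinearPMap.domain := (hdom u).2 ⟨_, h1⟩
    rw [Submodule.ne_bot_iff]
    refine ⟨⟨u, hd⟩, ?_, fun h => hu.2 (congrArg Subtype.val h)⟩
    rw [eigenspaceOf, LinearMap.mem_ker]
    change G.toLinearPMap ⟨u, hd⟩ - z • u = 0
    rw [sub_eq_zero]
    exact (happ _ _).2 h1
  · obtain ⟨hz0, hev⟩ := hspec z hz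
    have := ContinuousLinearMap.finite_dimensional_eigenspace hS (1 + z)⁻¹ (inv_ne_zero hz0)
    let i : eigenspaceOf G.toLinearPMap z →ₗ[ℂ]
        Module.End.eigenspace (S : E →ₗ[ℂ] E) (1 + z)⁻¹ :=
      LinearMap.codRestrict _ (G.toLinearPMap.domain.subtype ∘ₗ Submodule.subtype _) (by
        rintro ⟨u, hu⟩
        rw [eigenspaceOf, LinearMap.mem_ker] at hu
        rw [Module.End.mem_eigenspace_iff]
        refine (heig z hz0 u).2 ((happ u _).1 ?_)
        exact sub_eq_zero.1 hu)
    refine FiniteDimensional.of_injective i fun a b hab => ?_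
    have := congrArg Subtype.val hab
    exact Subtype.ext (Subtype.ext this)

/-- The operator associated with a form: if the form domain `W`, with the inner product `form + 1`,
is complete and embeds compactly and densely into `E`, the operator is self-adjoint with discrete
spectrum. -/
theorem isSelfAdjoint_and_discrete_of_form [CompleteSpace W] (J : W →L[ℂ] E)
    (hJ : IsCompactOperator J) (hdense : ∀ f : E, (∀ w, inner ℂ (J w) f = 0) → f = 0)
    {G : Submodule ℂ (E × E)}
    (hG : ∀ p : E × E, p ∈ G ↔ ∃ w, J w = p.1 ∧ ∀ v, inner ℂ v w = inner ℂ (J v) (p.2 + p.1)) :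
    IsSelfAdjoint G.toLinearPMap ∧ HasDiscreteSpectrum G.toLinearPMap := by
  have hadj : ∀ f g, inner ℂ (J (J.adjoint f)) g = inner ℂ f (J (J.adjoint g)) := fun f g => by
    rw [← ContinuousLinearMap.adjoint_inner_right, ContinuousLinearMap.adjoint_inner_left]
  refine isSelfAdjoint_and_discrete_of_graph (S := J ∘L J.adjoint) (hJ.comp_clm _) hadj ?_ ?_
  · refine (injective_iff_map_eq_zero _).2 fun f hf => hdense f fun w => ?_
    have h0 : J.adjoint f = 0 := by
      rw [← inner_self_eq_zero (𝕜 := ℂ), ContinuousLinearMap.adjoint_inner_right]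
      change inner ℂ ((J ∘L J.adjoint) f) f = 0
      rw [hf, inner_zero_left]
    rw [← ContinuousLinearMap.adjoint_inner_right, h0, inner_zero_right]
  · intro p
    rw [hG]
    constructor
    · rintro ⟨w, hw, h⟩
      have : w = J.adjoint (p.2 + p.1) := ext_inner_left ℂ fun v => by
        rw [h v, ContinuousLinearMap.adjoint_inner_right]
      rw [ContinuousLinearMap.comp_apply, ← this, hw]
    · intro h
      refine ⟨J.adjoint (p.2 + p.1), h.symm, fun v => ?_⟩
      rw [ContinuousLinearMap.adjoint_inner_right]

end Abstract

/-! ### Square integrals with values in the extended non-negative numbers -/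

section Squares

/-- The square of the norm of `f` in `L²(S)`, as an extended non-negative number. -/
noncomputable def sqNorm (S : Set Plane) (f : Plane → ℂ) : ℝ≥0∞ := ∫⁻ x in S, ‖f x‖ₑ ^ 2

lemma ennreal_add_sq_le (a b : ℝ≥0∞) : (a + b) ^ 2 ≤ 2 * a ^ 2 + 2 * b ^ 2 := by
  rcases eq_or_ne a ⊤ with rfl | ha
  · simp
  rcases eq_or_ne b ⊤ with rfl | hb
  · simp
  lift a to NNReal using ha
  lift b to NNReal using hb
  norm_cast
  rw [← NNReal.coe_le_coe]
  push_cast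
  nlinarith [sq_nonneg ((a : ℝ) - b)]

lemma enorm_add_sq_le (a b : ℂ) : ‖a + b‖ₑ ^ 2 ≤ 2 * ‖a‖ₑ ^ 2 + 2 * ‖b‖ₑ ^ 2 :=
  (pow_le_pow_left' (enorm_add_le a b) 2).trans (ennreal_add_sq_le _ _)

lemma enorm_sub_sq_le (a b : ℂ) : ‖a - b‖ₑ ^ 2 ≤ 2 * ‖a‖ₑ ^ 2 + 2 * ‖b‖ₑ ^ 2 := by
  rw [sub_eq_add_neg, ← enorm_neg b]
  exact enorm_add_sq_le a (-b)

lemma lintegral_enorm_add_sq_le {α : Type*} [MeasurableSpace α] {μ : Measure α} {f g : α → ℂ}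
    (hf : AEStronglyMeasurable f μ) :
    ∫⁻ x, ‖f x + g x‖ₑ ^ 2 ∂μ ≤ 2 * (∫⁻ x, ‖f x‖ₑ ^ 2 ∂μ) + 2 * ∫⁻ x, ‖g x‖ₑ ^ 2 ∂μ := by
  calc _ ≤ ∫⁻ x, (2 * ‖f x‖ₑ ^ 2 + 2 * ‖g x‖ₑ ^ 2) ∂μ :=
        lintegral_mono fun x => enorm_add_sq_le _ _
    _ = _ := by
      rw [lintegral_add_left' ((hf.enorm.pow_const 2).const_mul 2),
        lintegral_const_mul' _ _ (by simp), lintegral_const_mul' _ _ (by simp)]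

lemma sqNorm_add_le {S : Set Plane} {f : Plane → ℂ} (g : Plane → ℂ)
    (hf : AEStronglyMeasurable f (volume.restrict S)) :
    sqNorm S (fun x => f x + g x) ≤ 2 * sqNorm S f + 2 * sqNorm S g :=
  lintegral_enorm_add_sq_le hf

lemma sqNorm_mono {S T : Set Plane} (h : S ⊆ T) (f : Plane → ℂ) : sqNorm S f ≤ sqNorm T f :=
  lintegral_mono_set h

lemma sqNorm_union_le (S T : Set Plane) (f : Plane → ℂ) :
    sqNorm (S ∪ T) f ≤ sqNorm S f + sqNorm T f :=
  lintegral_union_le _ _ _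

lemma sqNorm_const_mul (S : Set Plane) (c : ℂ) (f : Plane → ℂ) :
    sqNorm S (fun x => c * f x) = ‖c‖ₑ ^ 2 * sqNorm S f := by
  simp only [sqNorm, enorm_mul, mul_pow]
  rw [lintegral_const_mul' _ _ (by simp)]

/-- The Cauchy–Schwarz inequality against the constant function. -/
lemma sq_lintegral_le {α : Type*} [MeasurableSpace α] {μ : Measure α} {f : α → ℝ≥0∞}
    (hf : AEMeasurable f μ) : (∫⁻ x, f x ∂μ) ^ 2 ≤ μ univ * ∫⁻ x, f x ^ 2 ∂μ := by
  have h := ENNReal.lintegral_mul_le_Lp_mul_Lq μ Real.HolderConjugate.two_two hf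
    (aemeasurable_const (b := (1 : ℝ≥0∞)))
  simp only [Pi.mul_apply, mul_one, ENNReal.one_rpow, lintegral_one] at h
  have e : ∀ a : ℝ≥0∞, (a ^ (1 / (2 : ℝ))) ^ 2 = a := fun a => by
    rw [← ENNReal.rpow_natCast, ← ENNReal.rpow_mul]; norm_num
  calc _ ≤ _ := pow_le_pow_left' h 2
    _ = _ := by
      rw [mul_pow, e, e, mul_comm]
      simp

end Squares

/-! ### Integration along segments -/

section Segments

/-- The derivative of `φ` in the direction `w`. -/
noncomputable def dirDeriv (w : Plane) (φ : Plane → ℂ) (x : Plane) : ℂ := fderiv ℝ φ x w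

lemma contDiff_dirDeriv (w : Plane) {φ : Plane → ℂ} (hφ : ContDiff ℝ ∞ φ) :
    ContDiff ℝ ∞ (dirDeriv w φ) :=
  (hφ.fderiv_right (m := ∞) (by simp)).clm_apply contDiff_const

lemma hasDerivAt_line {φ : Plane → ℂ} (hφ : ContDiff ℝ ∞ φ) (x w : Plane) (t : ℝ) :
    HasDerivAt (fun t : ℝ => φ (x + t • w)) (dirDeriv w φ (x + t • w)) t := by
  have h2 : HasDerivAt (fun t : ℝ => x + t • w) w t := by
    simpa using ((hasDerivAt_id t).smul_const w).const_add x
  exact (hφ.differentiable (by simp) _).hasFDerivAt.comp_hasDerivAt t h2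

lemma enorm_sub_le_lintegral_deriv {g g' : ℝ → ℂ} (hg : ∀ t, HasDerivAt g (g' t) t)
    (hc : Continuous g') {a b : ℝ} (hab : a ≤ b) :
    ‖g b - g a‖ₑ ≤ ∫⁻ t in Icc a b, ‖g' t‖ₑ := by
  rw [← intervalIntegral.integral_eq_sub_of_hasDerivAt (fun t _ => hg t)
    (hc.intervalIntegrable a b), intervalIntegral.integral_of_le hab]
  exact (enorm_integral_le_lintegral_enorm _).trans (lintegral_mono_set Ioc_subset_Icc_self)

/-- The first-order Taylor formula on `[0, 1]`, with the remainder bounded by the integral of the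
second derivative. -/
lemma enorm_taylor_le {g g' g'' : ℝ → ℂ} (hg : ∀ t, HasDerivAt g (g' t) t)
    (hg' : ∀ t, HasDerivAt g' (g'' t) t) (hc : Continuous g'') :
    ‖g 1 - g 0 - g' 0‖ₑ ≤ ∫⁻ t in Icc (0 : ℝ) 1, ‖g'' t‖ₑ := by
  have hc' : Continuous g' := continuous_iff_continuousAt.2 fun t => (hg' t).continuousAt
  have h := enorm_sub_le_lintegral_deriv (g := fun t => g t - (t : ℂ) * g' 0)
    (g' := fun t => g' t - g' 0) (fun t => by
      have := ((hasDerivAt_id t).ofReal_comp).mul_const (g' 0)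
      exact (hg t).fun_sub (by simpa using this)) (hc'.sub continuous_const) zero_le_one
  have e : g 1 - ((1 : ℝ) : ℂ) * g' 0 - (g 0 - ((0 : ℝ) : ℂ) * g' 0) = g 1 - g 0 - g' 0 := by
    push_cast; ring
  rw [e] at h
  refine h.trans ?_
  calc _ ≤ ∫⁻ _t in Icc (0 : ℝ) 1, ∫⁻ t in Icc (0 : ℝ) 1, ‖g'' t‖ₑ := by
        refine setLIntegral_mono' measurableSet_Icc fun t ht => ?_
        exact (enorm_sub_le_lintegral_deriv hg' hc ht.1).trans
          (lintegral_mono_set (Icc_subset_Icc_right ht.2))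
    _ = _ := by simp

/-- If `F` is bounded on `S` by the integrals of `G` over segments `[x, x + w] ⊆ T`, then the norm
of `F` in `L²(S)` is bounded by the norm of `G` in `L²(T)`. -/
lemma sqNorm_le_of_segments {S T : Set Plane} (hS : MeasurableSet S) (hT : MeasurableSet T)
    {w : Plane} (hST : ∀ x ∈ S, ∀ s ∈ Icc (0 : ℝ) 1, x + s • w ∈ T) {F G : Plane → ℂ}
    (hG : Continuous G)
    (hF : ∀ x ∈ S, ‖F x‖ₑ ≤ ∫⁻ s in Icc (0 : ℝ) 1, ‖G (x + s • w)‖ₑ) :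
    sqNorm S F ≤ sqNorm T G := by
  have hcont : Continuous fun q : Plane × ℝ => ‖G (q.1 + q.2 • w)‖ₑ ^ 2 := by
    have : Continuous fun q : Plane × ℝ => G (q.1 + q.2 • w) := hG.comp (by fun_prop)
    exact (ENNReal.continuous_pow 2).comp this.enorm
  have h1 : sqNorm S F ≤ ∫⁻ x in S, ∫⁻ s in Icc (0 : ℝ) 1, ‖G (x + s • w)‖ₑ ^ 2 := by
    refine setLIntegral_mono' hS fun x hx => (pow_le_pow_left' (hF x hx) 2).trans ?_
    have : Continuous fun s : ℝ => G (x + s • w) := hG.comp (by fun_prop)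
    refine (sq_lintegral_le this.enorm.aemeasurable).trans ?_
    simp
  refine h1.trans ?_
  rw [lintegral_lintegral_swap hcont.measurable.aemeasurable]
  calc _ ≤ ∫⁻ _s in Icc (0 : ℝ) 1, sqNorm T G := by
        refine setLIntegral_mono' measurableSet_Icc fun s hs => ?_
        rw [sqNorm, ← lintegral_indicator hS, ← lintegral_indicator hT,
          ← lintegral_add_right_eq_self (T.indicator fun x => ‖G x‖ₑ ^ 2) (s • w)]
        refine lintegral_mono fun x => ?_
        by_cases hx : x ∈ S
        · rw [indicator_of_mem hx, indicator_of_mem (hST x hx s hs)]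
        · rw [indicator_of_notMem hx]; exact zero_le
    _ = _ := by simp

lemma sqNorm_translate_le {S T : Set Plane} (hS : MeasurableSet S) (hT : MeasurableSet T)
    {w : Plane} (hST : ∀ x ∈ S, x + w ∈ T) (G : Plane → ℂ) :
    sqNorm S (fun x => G (x + w)) ≤ sqNorm T G := by
  rw [sqNorm, sqNorm, ← lintegral_indicator hS, ← lintegral_indicator hT,
    ← lintegral_add_right_eq_self (T.indicator fun x => ‖G x‖ₑ ^ 2) w]
  refine lintegral_mono fun x => ?_
  by_cases hx : x ∈ S
  · rw [indicator_of_mem hx, indicator_of_mem (hST x hx)]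
  · rw [indicator_of_notMem hx]; exact zero_le

variable {S T : Set Plane} {w : Plane} {φ : Plane → ℂ}

lemma continuous_dirDeriv (w : Plane) (hφ : ContDiff ℝ ∞ φ) : Continuous (dirDeriv w φ) :=
  (contDiff_dirDeriv w hφ).continuous

lemma sqNorm_translate_sub_le (hS : MeasurableSet S) (hT : MeasurableSet T)
    (hST : ∀ x ∈ S, ∀ s ∈ Icc (0 : ℝ) 1, x + s • w ∈ T) (hφ : ContDiff ℝ ∞ φ) :
    sqNorm S (fun x => φ (x + w) - φ x) ≤ sqNorm T (dirDeriv w φ) := by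
  refine sqNorm_le_of_segments hS hT hST (continuous_dirDeriv w hφ) fun x _ => ?_
  have := enorm_sub_le_lintegral_deriv (hasDerivAt_line hφ x w)
    ((continuous_dirDeriv w hφ).comp (by fun_prop)) zero_le_one
  simpa using this

/-- A directional derivative is controlled by the function and the second derivative in the same
direction along the segments in this direction. -/
lemma sqNorm_dirDeriv_le (hS : MeasurableSet S) (hT : MeasurableSet T)
    (hST : ∀ x ∈ S, ∀ s ∈ Icc (0 : ℝ) 1, x + s • w ∈ T) (hφ : ContDiff ℝ ∞ φ) :
    sqNorm S (dirDeriv w φ) ≤ 8 * sqNorm T φ + 2 * sqNorm T (dirDeriv w (dirDeriv w φ)) := by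
  have hsub : S ⊆ T := fun x hx => by simpa using hST x hx 0 (by simp)
  have hrem : sqNorm S (fun x => φ (x + w) - φ x - dirDeriv w φ x) ≤
      sqNorm T (dirDeriv w (dirDeriv w φ)) := by
    refine sqNorm_le_of_segments hS hT hST (continuous_dirDeriv w (contDiff_dirDeriv w hφ))
      fun x _ => ?_
    have := enorm_taylor_le (hasDerivAt_line hφ x w) (hasDerivAt_line (contDiff_dirDeriv w hφ) x w)
      ((continuous_dirDeriv w (contDiff_dirDeriv w hφ)).comp (by fun_prop))
    simpa using this
  have hc1 : Continuous fun x => φ (x + w) := hφ.continuous.comp (by fun_prop)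
  have hc2 : Continuous fun x => φ (x + w) - φ x := hc1.sub hφ.continuous
  have h1 : sqNorm S (fun x => φ (x + w) - φ x) ≤ 4 * sqNorm T φ := by
    calc _ = sqNorm S (fun x => φ (x + w) + (-φ x)) := by simp only [sub_eq_add_neg]
      _ ≤ 2 * sqNorm S (fun x => φ (x + w)) + 2 * sqNorm S (fun x => -φ x) :=
        sqNorm_add_le _ hc1.aestronglyMeasurable
      _ ≤ 2 * sqNorm T φ + 2 * sqNorm T φ := by
        gcongr
        · exact sqNorm_translate_le hS hT
            (fun x hx => by simpa using hST x hx 1 (by simp)) φ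
        · simp only [sqNorm, enorm_neg]
          exact lintegral_mono_set hsub
      _ = _ := by ring
  calc sqNorm S (dirDeriv w φ) =
        sqNorm S (fun x => (φ (x + w) - φ x) + -(φ (x + w) - φ x - dirDeriv w φ x)) := by
        congr 1; ext x; ring
    _ ≤ 2 * sqNorm S (fun x => φ (x + w) - φ x) +
        2 * sqNorm S (fun x => -(φ (x + w) - φ x - dirDeriv w φ x)) :=
        sqNorm_add_le _ hc2.aestronglyMeasurable
    _ ≤ 2 * (4 * sqNorm T φ) + 2 * sqNorm T (dirDeriv w (dirDeriv w φ)) := by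
        gcongr
        simp only [sqNorm, enorm_neg] at hrem ⊢
        exact hrem
    _ = _ := by ring

lemma dirDeriv_eq_sum (w : Plane) (φ : Plane → ℂ) :
    dirDeriv w φ = fun x => (w 0 : ℂ) * pderiv 0 φ x + (w 1 : ℂ) * pderiv 1 φ x := by
  ext x
  have hw : w = w 0 • EuclideanSpace.single 0 (1 : ℝ) + w 1 • EuclideanSpace.single 1 (1 : ℝ) := by
    ext i
    fin_cases i <;> simp
  rw [dirDeriv]
  conv_lhs => rw [hw]
  rw [map_add, map_smul, map_smul, Complex.real_smul, Complex.real_smul]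
  rfl

/-- The square of the `L²(T)`-norm of the gradient. -/
noncomputable def sqGrad (T : Set Plane) (φ : Plane → ℂ) : ℝ≥0∞ :=
  ∑ i : Fin 2, sqNorm T (pderiv i φ)

/-- The square of the `L²(T)`-norm of the Hessian. -/
noncomputable def sqHess (T : Set Plane) (φ : Plane → ℂ) : ℝ≥0∞ :=
  ∑ i : Fin 2, ∑ j : Fin 2, sqNorm T (pderiv j (pderiv i φ))

lemma enorm_ofReal_apply_le (w : Plane) (i : Fin 2) : ‖((w i : ℝ) : ℂ)‖ₑ ≤ ‖w‖ₑ := by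
  rw [← ofReal_norm, ← ofReal_norm, Complex.norm_real]
  exact ENNReal.ofReal_le_ofReal (PiLp.norm_apply_le w i)

lemma sqNorm_dirDeriv_le_grad (T : Set Plane) (w : Plane) (hφ : ContDiff ℝ ∞ φ) :
    sqNorm T (dirDeriv w φ) ≤ 2 * ‖w‖ₑ ^ 2 * sqGrad T φ := by
  rw [dirDeriv_eq_sum, sqGrad, Fin.sum_univ_two]
  refine (sqNorm_add_le (f := fun x => (w 0 : ℂ) * pderiv 0 φ x) _ (continuous_const.mul
    (continuous_pderiv 0 hφ)).aestronglyMeasurable).trans ?_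
  rw [sqNorm_const_mul, sqNorm_const_mul, mul_add, mul_assoc, mul_assoc]
  gcongr <;> exact enorm_ofReal_apply_le w _

lemma pderiv_linear (i : Fin 2) {φ ψ : Plane → ℂ} (hφ : ContDiff ℝ ∞ φ) (hψ : ContDiff ℝ ∞ ψ)
    (a b : ℂ) : pderiv i (fun x => a * φ x + b * ψ x) =
      fun x => a * pderiv i φ x + b * pderiv i ψ x := by
  have e : (fun x => a * φ x + b * ψ x) = a • φ + b • ψ := rfl
  have ha : ContDiff ℝ ∞ (a • φ) := contDiff_const.smul hφ
  have hb : ContDiff ℝ ∞ (b • ψ) := contDiff_const.smul hψ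
  rw [e, pderiv_add ha hb, pderiv_const_smul hφ,
    pderiv_const_smul hψ]
  rfl

lemma sqNorm_dirDeriv2_le_hess (T : Set Plane) (w : Plane) (hφ : ContDiff ℝ ∞ φ) :
    sqNorm T (dirDeriv w (dirDeriv w φ)) ≤ 4 * ‖w‖ₑ ^ 4 * sqHess T φ := by
  refine (sqNorm_dirDeriv_le_grad T w (contDiff_dirDeriv w hφ)).trans ?_
  have h : ∀ j, sqNorm T (pderiv j (dirDeriv w φ)) ≤
      2 * ‖w‖ₑ ^ 2 * ∑ i : Fin 2, sqNorm T (pderiv j (pderiv i φ)) := by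
    intro j
    rw [dirDeriv_eq_sum, pderiv_linear j (contDiff_pderiv 0 hφ) (contDiff_pderiv 1 hφ),
      Fin.sum_univ_two]
    refine (sqNorm_add_le (f := fun x => (w 0 : ℂ) * pderiv j (pderiv 0 φ) x) _
      (continuous_const.mul (continuous_pderiv j (contDiff_pderiv 0 hφ))).aestronglyMeasurable).trans ?_
    rw [sqNorm_const_mul, sqNorm_const_mul, mul_add, mul_assoc, mul_assoc]
    gcongr <;> exact enorm_ofReal_apply_le w _
  calc _ ≤ 2 * ‖w‖ₑ ^ 2 * ∑ j : Fin 2, (2 * ‖w‖ₑ ^ 2 * ∑ i : Fin 2,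
        sqNorm T (pderiv j (pderiv i φ))) := by
        rw [sqGrad]; gcongr; exact h _
    _ = _ := by
        rw [← Finset.mul_sum, Finset.sum_comm, sqHess]; ring

end Segments

/-! ### The cone property and interpolation of the gradient -/

section Cone

variable {Ω : TopologicalSpace.Opens Plane}

/-- The cone property of a domain with smooth boundary: near `p ∈ closure Ω`, all the segments in
directions close to a suitable `v` stay in `Ω`. -/
lemma exists_cone (hΩ : HasSmoothBoundary Ω) {p : Plane} (hp : p ∈ closure (Ω : Set Plane)) :
    ∃ r > 0, ∃ δ > 0, ∃ v : Plane, ∀ x ∈ (Ω : Set Plane) ∩ Metric.ball p r,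
      ∀ w ∈ Metric.closedBall v δ, ∀ s ∈ Icc (0 : ℝ) 1, x + s • w ∈ (Ω : Set Plane) := by
  by_cases hpΩ : p ∈ (Ω : Set Plane)
  · obtain ⟨r, hr, hball⟩ := Metric.isOpen_iff.1 Ω.isOpen p hpΩ
    refine ⟨r / 2, by positivity, r / 4, by positivity, 0, fun x hx w hw s hs => hball ?_⟩
    rw [Metric.mem_ball, dist_eq_norm]
    have h1 : ‖x - p‖ < r / 2 := by rw [← dist_eq_norm]; exact hx.2
    have h2 : ‖w‖ ≤ r / 4 := mem_closedBall_zero_iff.1 hw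
    have h3 : ‖s • w‖ ≤ r / 4 := by
      rw [norm_smul, Real.norm_of_nonneg hs.1]
      nlinarith [norm_nonneg w, hs.2]
    calc ‖x + s • w - p‖ = ‖(x - p) + s • w‖ := by congr 1; abel
      _ ≤ ‖x - p‖ + ‖s • w‖ := norm_add_le _ _
      _ < r := by linarith
  · have hpf : p ∈ frontier (Ω : Set Plane) := by
      rw [Ω.isOpen.frontier_eq]; exact ⟨hp, hpΩ⟩
    obtain ⟨ρ, hρ⟩ := hΩ p hpf
    -- the derivative of `ρ` is negative in directions close to `-∇ρ(p)` at points close to `p`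
    have hcont : Continuous fun q : Plane × Plane => fderiv ℝ ρ q.1 q.2 :=
      ((hρ.contDiff.continuous_fderiv (by simp)).comp continuous_fst).clm_apply continuous_snd
    have hneg : fderiv ℝ ρ p (-∇ ρ p) < 0 := by
      have : fderiv ℝ ρ p (∇ ρ p) = inner ℝ (∇ ρ p) (∇ ρ p) := by
        rw [gradient, InnerProductSpace.toDual_symm_apply]
      rw [map_neg, this, real_inner_self_eq_norm_sq, neg_lt_zero]
      have := norm_pos_iff.2 hρ.gradient_ne_zero
      positivity
    have hev : ∀ᶠ q in 𝓝 (p, -∇ ρ p), fderiv ℝ ρ q.1 q.2 < 0 :=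
      hcont.continuousAt.eventually (gt_mem_nhds hneg)
    obtain ⟨η, hη, hball⟩ := Metric.eventually_nhds_iff_ball.1 hev
    obtain ⟨r', hr', hmem⟩ := Metric.eventually_nhds_iff_ball.1 hρ.mem_iff
    set r := min η r' with hr
    have hr0 : 0 < r := lt_min hη hr'
    set c : ℝ := r / (2 * (‖∇ ρ p‖ + η)) with hc
    have hc0 : 0 < c := by positivity
    refine ⟨r / 2, by positivity, c * (η / 2), by positivity, c • (-∇ ρ p), ?_⟩
    intro x hx w hw s hs
    set w' : Plane := c⁻¹ • w with hw'
    have hww : w = c • w' := by rw [hw', smul_smul, mul_inv_cancel₀ hc0.ne', one_smul]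
    have hw1 : ‖w' - (-∇ ρ p)‖ < η := by
      rw [Metric.mem_closedBall, dist_eq_norm, hww, ← smul_sub, norm_smul,
        Real.norm_of_nonneg hc0.le] at hw
      have := le_of_mul_le_mul_left hw hc0
      linarith
    have hw2 : ‖w‖ < r / 2 := by
      have h1 : ‖w'‖ < ‖∇ ρ p‖ + η := by
        calc ‖w'‖ = ‖(w' - (-∇ ρ p)) + (-∇ ρ p)‖ := by rw [sub_add_cancel]
          _ ≤ ‖w' - (-∇ ρ p)‖ + ‖-∇ ρ p‖ := norm_add_le _ _
          _ < _ := by rw [norm_neg]; linarith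
      rw [hww, norm_smul, Real.norm_of_nonneg hc0.le]
      calc c * ‖w'‖ < c * (‖∇ ρ p‖ + η) := by gcongr
        _ = r / 2 := by rw [hc]; field_simp
    have hin : ∀ s ∈ Icc (0 : ℝ) 1, x + s • w ∈ Metric.ball p r := by
      intro s hs
      have h1 : ‖x - p‖ < r / 2 := by rw [← dist_eq_norm]; exact hx.2
      have h3 : ‖s • w‖ ≤ ‖w‖ := by
        rw [norm_smul, Real.norm_of_nonneg hs.1]
        nlinarith [norm_nonneg w, hs.2]
      rw [Metric.mem_ball, dist_eq_norm]
      calc ‖x + s • w - p‖ = ‖(x - p) + s • w‖ := by congr 1; abel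
        _ ≤ ‖x - p‖ + ‖s • w‖ := norm_add_le _ _
        _ < r := by linarith
    have hder : ∀ t, HasDerivAt (fun t : ℝ => ρ (x + t • w)) (fderiv ℝ ρ (x + t • w) w) t := by
      intro t
      have h2 : HasDerivAt (fun t : ℝ => x + t • w) w t := by
        simpa using ((hasDerivAt_id t).smul_const w).const_add x
      exact (hρ.contDiff.differentiable (by simp) _).hasFDerivAt.comp_hasDerivAt t h2
    have hanti : AntitoneOn (fun t : ℝ => ρ (x + t • w)) (Icc 0 1) := by
      refine antitoneOn_of_deriv_nonpos (convex_Icc 0 1)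
        (fun t _ => (hder t).continuousAt.continuousWithinAt)
        (fun t _ => (hder t).differentiableAt.differentiableWithinAt) fun t ht => ?_
      rw [(hder t).deriv, hww, map_smul, smul_eq_mul, ← hww]
      refine mul_nonpos_of_nonneg_of_nonpos hc0.le (hball (x + t • w, w') ?_).le
      rw [Metric.mem_ball, Prod.dist_eq, max_lt_iff, dist_eq_norm w']
      exact ⟨lt_of_lt_of_le (hin t (interior_subset ht)) (min_le_left _ _), hw1⟩
    have h0 : ρ x < 0 := by
      refine (hmem x ?_).1 hx.1
      exact Metric.ball_subset_ball ((by linarith : r / 2 ≤ r).trans (min_le_right _ _)) hx.2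
    refine (hmem _ (Metric.ball_subset_ball (min_le_right _ _) (hin s hs))).2 ?_
    have := hanti (left_mem_Icc.2 zero_le_one) hs hs.1
    simp only [zero_smul, add_zero] at this
    linarith

/-- Near a point of `closure Ω` the gradient is controlled by the function and its Hessian: this
holds for the derivatives in all directions of an open cone, which span. -/
lemma exists_sqGrad_le_near (hΩ : HasSmoothBoundary Ω) {p : Plane}
    (hp : p ∈ closure (Ω : Set Plane)) :
    ∃ r > 0, ∃ C : ℝ≥0∞, C ≠ ⊤ ∧ ∀ φ : Plane → ℂ, ContDiff ℝ ∞ φ →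
      sqGrad ((Ω : Set Plane) ∩ Metric.ball p r) φ ≤ C * (sqNorm Ω φ + sqHess Ω φ) := by
  obtain ⟨r, hr, δ, hδ, v, hcone⟩ := exists_cone hΩ hp
  set M : ℝ≥0∞ := 8 + 2 * (4 * (‖v‖ₑ + ENNReal.ofReal δ) ^ 4) with hM
  have hMt : M ≠ ⊤ := by finiteness
  have hS : MeasurableSet ((Ω : Set Plane) ∩ Metric.ball p r) :=
    Ω.isOpen.measurableSet.inter Metric.isOpen_ball.measurableSet
  have hw : ∀ w ∈ Metric.closedBall v δ, ∀ φ : Plane → ℂ, ContDiff ℝ ∞ φ →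
      sqNorm ((Ω : Set Plane) ∩ Metric.ball p r) (dirDeriv w φ) ≤
        M * (sqNorm Ω φ + sqHess Ω φ) := by
    intro w hw φ hφ
    have hwn : ‖w‖ₑ ≤ ‖v‖ₑ + ENNReal.ofReal δ := by
      rw [← ofReal_norm, ← ofReal_norm, ← ENNReal.ofReal_add (norm_nonneg _) hδ.le]
      refine ENNReal.ofReal_le_ofReal ?_
      rw [Metric.mem_closedBall, dist_eq_norm] at hw
      calc ‖w‖ = ‖v + (w - v)‖ := by rw [add_sub_cancel]
        _ ≤ ‖v‖ + ‖w - v‖ := norm_add_le _ _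
        _ ≤ _ := by linarith
    calc _ ≤ 8 * sqNorm Ω φ + 2 * sqNorm Ω (dirDeriv w (dirDeriv w φ)) :=
          sqNorm_dirDeriv_le hS Ω.isOpen.measurableSet (fun x hx => hcone x hx w hw) hφ
      _ ≤ 8 * sqNorm Ω φ + 2 * (4 * (‖v‖ₑ + ENNReal.ofReal δ) ^ 4 * sqHess Ω φ) := by
          gcongr
          refine (sqNorm_dirDeriv2_le_hess _ w hφ).trans ?_
          gcongr
      _ ≤ _ := by
          rw [hM, add_mul, mul_add, mul_add, ← mul_assoc 2]
          exact add_le_add le_self_add le_add_self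
  refine ⟨r, hr, 2 * (‖((δ : ℝ) : ℂ)⁻¹‖ₑ ^ 2 * (2 * M + 2 * M)), ?_, fun φ hφ => ?_⟩
  · have : ‖((δ : ℝ) : ℂ)⁻¹‖ₑ ≠ ⊤ := enorm_ne_top
    finiteness
  have hi : ∀ i : Fin 2, sqNorm ((Ω : Set Plane) ∩ Metric.ball p r) (pderiv i φ) ≤
      ‖((δ : ℝ) : ℂ)⁻¹‖ₑ ^ 2 * (2 * M + 2 * M) * (sqNorm Ω φ + sqHess Ω φ) := by
    intro i
    have e : pderiv i φ = fun x => ((δ : ℝ) : ℂ)⁻¹ *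
        (dirDeriv (v + δ • EuclideanSpace.single i 1) φ x + -dirDeriv v φ x) := by
      ext x
      have hδ' : (δ : ℂ) ≠ 0 := Complex.ofReal_ne_zero.2 hδ.ne'
      simp only [dirDeriv, map_add, map_smul, Complex.real_smul, pderiv]
      field_simp
      ring
    rw [e, sqNorm_const_mul, mul_assoc]
    gcongr
    refine (sqNorm_add_le _ (continuous_dirDeriv _ hφ).aestronglyMeasurable).trans ?_
    have e2 : sqNorm ((Ω : Set Plane) ∩ Metric.ball p r) (fun x => -dirDeriv v φ x) =
        sqNorm ((Ω : Set Plane) ∩ Metric.ball p r) (dirDeriv v φ) := by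
      simp only [sqNorm, enorm_neg]
    rw [e2, add_mul, mul_assoc 2 M]
    gcongr
    · refine hw _ ?_ φ hφ
      rw [Metric.mem_closedBall, dist_eq_norm, add_sub_cancel_left, norm_smul,
        PiLp.norm_single, norm_one, mul_one, Real.norm_of_nonneg hδ.le]
    · exact hw v (Metric.mem_closedBall_self hδ.le) φ hφ
  rw [sqGrad, Fin.sum_univ_two, mul_assoc, two_mul]
  exact add_le_add (hi 0) (hi 1)

lemma exists_sqGrad_le_of_isCompact (hΩ : HasSmoothBoundary Ω) {K : Set Plane} (hK : IsCompact K)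
    (hKΩ : K ⊆ closure (Ω : Set Plane)) :
    ∃ C : ℝ≥0∞, C ≠ ⊤ ∧ ∀ φ : Plane → ℂ, ContDiff ℝ ∞ φ →
      sqGrad ((Ω : Set Plane) ∩ K) φ ≤ C * (sqNorm Ω φ + sqHess Ω φ) := by
  refine hK.induction_on (p := fun K => ∃ C : ℝ≥0∞, C ≠ ⊤ ∧ ∀ φ : Plane → ℂ, ContDiff ℝ ∞ φ →
      sqGrad ((Ω : Set Plane) ∩ K) φ ≤ C * (sqNorm Ω φ + sqHess Ω φ)) ?_ ?_ ?_ ?_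
  · exact ⟨0, by simp, fun φ _ => by simp [sqGrad, sqNorm]⟩
  · rintro s t hst ⟨C, hC, h⟩
    refine ⟨C, hC, fun φ hφ => le_trans ?_ (h φ hφ)⟩
    exact Finset.sum_le_sum fun i _ => sqNorm_mono (inter_subset_inter_right _ hst) _
  · rintro s t ⟨C, hC, h⟩ ⟨C', hC', h'⟩
    refine ⟨C + C', by finiteness, fun φ hφ => ?_⟩
    rw [add_mul, inter_union_distrib_left]
    refine le_trans ?_ (add_le_add (h φ hφ) (h' φ hφ))
    rw [sqGrad, sqGrad, sqGrad, ← Finset.sum_add_distrib]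
    exact Finset.sum_le_sum fun i _ => sqNorm_union_le _ _ _
  · intro p hp
    obtain ⟨r, hr, C, hC, h⟩ := exists_sqGrad_le_near hΩ (hKΩ hp)
    exact ⟨_, mem_nhdsWithin_of_mem_nhds (Metric.ball_mem_nhds p hr), C, hC, h⟩

end Cone

/-! ### Poincaré inequality on the squares of a grid -/

section Poincare

/-- A Poincaré inequality on a convex set, written without the mean value. -/
lemma sqNorm_le_of_convex {Q : Set Plane} (hQm : MeasurableSet Q) (hQc : Convex ℝ Q)
    (hQb : Bornology.IsBounded Q) (hQ0 : volume Q ≠ 0) {d : ℝ} (hd : ∀ x ∈ Q, ∀ y ∈ Q, ‖y - x‖ ≤ d)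
    {φ : Plane → ℂ} (hφ : ContDiff ℝ ∞ φ) :
    sqNorm Q φ ≤ 2 * (volume Q)⁻¹ * ‖∫ x in Q, φ x‖ₑ ^ 2 +
      2 * (volume Q)⁻¹ * (volume (Metric.closedBall (0 : Plane) d) *
        (2 * ENNReal.ofReal d ^ 2 * sqGrad Q φ)) := by
  have hQt : volume Q ≠ ⊤ := hQb.measure_lt_top.ne
  set V := volume Q with hV
  have hint : IntegrableOn φ Q := by
    obtain ⟨R, hR⟩ := hQb.subset_closedBall 0
    exact (hφ.continuous.continuousOn.integrableOn_compact
      (isCompact_closedBall (0 : Plane) R)).mono_set hR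
  -- substitute `y = x + w` in the double integral
  have hdouble : ∫⁻ x in Q, ∫⁻ y in Q, ‖φ x - φ y‖ₑ ^ 2 ≤
      volume (Metric.closedBall (0 : Plane) d) * (2 * ENNReal.ofReal d ^ 2 * sqGrad Q φ) := by
    have e1 : ∀ x, ∫⁻ y in Q, ‖φ x - φ y‖ₑ ^ 2 =
        ∫⁻ w, Q.indicator (fun y => ‖φ x - φ y‖ₑ ^ 2) (x + w) := fun x => by
      rw [lintegral_add_left_eq_self, lintegral_indicator hQm]
    have hmeas : Measurable fun q : Plane × Plane =>
        Q.indicator (fun y => ‖φ q.1 - φ y‖ₑ ^ 2) (q.1 + q.2) := by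
      have hc : Continuous fun q : Plane × Plane => ‖φ q.1 - φ (q.1 + q.2)‖ₑ ^ 2 := by
        have := hφ.continuous
        exact (ENNReal.continuous_pow 2).comp (Continuous.enorm (by fun_prop))
      have hm : MeasurableSet ((fun q : Plane × Plane => q.1 + q.2) ⁻¹' Q) :=
        (measurable_fst.add measurable_snd) hQm
      exact hc.measurable.indicator hm
    simp only [e1]
    rw [lintegral_lintegral_swap hmeas.aemeasurable]
    have h2 : ∀ w : Plane, ∫⁻ x in Q, Q.indicator (fun y => ‖φ x - φ y‖ₑ ^ 2) (x + w) ≤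
        (Metric.closedBall (0 : Plane) d).indicator
          (fun _ => 2 * ENNReal.ofReal d ^ 2 * sqGrad Q φ) w := by
      intro w
      set S : Set Plane := Q ∩ (fun x => x + w) ⁻¹' Q with hS
      have hpm : MeasurableSet ((fun x => x + w) ⁻¹' Q) := (measurable_add_const w) hQm
      have hSm : MeasurableSet S := hQm.inter hpm
      have h3 : ∫⁻ x in Q, Q.indicator (fun y => ‖φ x - φ y‖ₑ ^ 2) (x + w) =
          sqNorm S (fun x => φ (x + w) - φ x) := by
        rw [sqNorm, hS, ← lintegral_indicator hSm, ← lintegral_indicator hQm]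
        refine lintegral_congr fun x => ?_
        simp only [indicator]
        by_cases h1 : x ∈ Q <;> by_cases h2 : x + w ∈ Q <;> simp [h1, h2, hS]
        rw [← enorm_neg, neg_sub]
      rw [h3]
      by_cases hw : w ∈ Metric.closedBall (0 : Plane) d
      · rw [indicator_of_mem hw]
        refine (sqNorm_translate_sub_le hSm hQm (fun x hx s hs => ?_) hφ).trans
          ((sqNorm_dirDeriv_le_grad Q w hφ).trans ?_)
        · have := hQc.add_smul_sub_mem hx.1 hx.2 hs
          simpa using this
        · gcongr
          rw [← ofReal_norm]
          exact ENNReal.ofReal_le_ofReal (mem_closedBall_zero_iff.1 hw)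
      · rw [indicator_of_notMem hw]
        have : S = ∅ := by
          refine eq_empty_of_forall_notMem fun x hx => hw ?_
          rw [mem_closedBall_zero_iff]
          have := hd x hx.1 (x + w) hx.2
          rwa [add_sub_cancel_left] at this
        rw [this, sqNorm]; simp
    calc _ ≤ _ := lintegral_mono h2
      _ = _ := by
        rw [lintegral_indicator Metric.isClosed_closedBall.measurableSet, setLIntegral_const,
          mul_comm]
  have hpt : ∀ x, V ^ 2 * ‖φ x‖ₑ ^ 2 ≤
      2 * (V * ∫⁻ y in Q, ‖φ x - φ y‖ₑ ^ 2) + 2 * ‖∫ y in Q, φ y‖ₑ ^ 2 := by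
    intro x
    have hcst : Integrable (fun _ : Plane => φ x) (volume.restrict Q) :=
      integrableOn_const hQt enorm_ne_top
    have e : (V.toReal : ℂ) * φ x = (∫ y in Q, (φ x - φ y)) + ∫ y in Q, φ y := by
      rw [integral_sub hcst hint, sub_add_cancel, setIntegral_const,
        Complex.real_smul]
      rfl
    have e2 : ‖(V.toReal : ℂ)‖ₑ = V := by
      rw [← ofReal_norm, Complex.norm_real, Real.norm_of_nonneg ENNReal.toReal_nonneg,
        ENNReal.ofReal_toReal hQt]
    have h1 : ‖∫ y in Q, (φ x - φ y)‖ₑ ^ 2 ≤ V * ∫⁻ y in Q, ‖φ x - φ y‖ₑ ^ 2 := by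
      refine (pow_le_pow_left' (enorm_integral_le_lintegral_enorm _) 2).trans ?_
      have hc : Continuous fun y => φ x - φ y := continuous_const.sub hφ.continuous
      refine (sq_lintegral_le hc.enorm.aemeasurable).trans ?_
      rw [Measure.restrict_apply_univ]
    calc V ^ 2 * ‖φ x‖ₑ ^ 2 = ‖(V.toReal : ℂ) * φ x‖ₑ ^ 2 := by rw [enorm_mul, e2, mul_pow]
      _ ≤ _ := by
        rw [e]
        refine (enorm_add_sq_le _ _).trans ?_
        gcongr
  have hsum : V ^ 2 * sqNorm Q φ ≤ 2 * (V * (volume (Metric.closedBall (0 : Plane) d) *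
        (2 * ENNReal.ofReal d ^ 2 * sqGrad Q φ))) + 2 * ‖∫ y in Q, φ y‖ₑ ^ 2 * V := by
    rw [sqNorm, ← lintegral_const_mul' _ _ (by finiteness)]
    refine (lintegral_mono hpt).trans ?_
    rw [lintegral_add_right _ measurable_const, setLIntegral_const,
      lintegral_const_mul' _ _ (by finiteness), lintegral_const_mul' _ _ hQt]
    gcongr
  have hVV : V⁻¹ * V = 1 := ENNReal.inv_mul_cancel hQ0 hQt
  calc sqNorm Q φ = (V⁻¹ * V) * (V⁻¹ * V) * sqNorm Q φ := by rw [hVV]; simp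
    _ = V⁻¹ * V⁻¹ * (V ^ 2 * sqNorm Q φ) := by ring
    _ ≤ V⁻¹ * V⁻¹ * (2 * (V * (volume (Metric.closedBall (0 : Plane) d) *
        (2 * ENNReal.ofReal d ^ 2 * sqGrad Q φ))) + 2 * ‖∫ y in Q, φ y‖ₑ ^ 2 * V) := by gcongr
    _ = (V⁻¹ * V) * (2 * V⁻¹ * ‖∫ x in Q, φ x‖ₑ ^ 2 +
      2 * V⁻¹ * (volume (Metric.closedBall (0 : Plane) d) *
        (2 * ENNReal.ofReal d ^ 2 * sqGrad Q φ))) := by ring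
    _ = _ := by rw [hVV, one_mul]

/-- The half-open squares of side `h` with vertices in `h ℤ²`. -/
def gridCell (h : ℝ) (k : Fin 2 → ℤ) : Set Plane := {x | ∀ i, ⌊x i / h⌋ = k i}

variable {h : ℝ}

lemma mem_gridCell (hh : 0 < h) {k : Fin 2 → ℤ} {x : Plane} :
    x ∈ gridCell h k ↔ ∀ i, x i ∈ Ico (k i * h) ((k i + 1) * h) := by
  refine forall_congr' fun i => ?_
  rw [Int.floor_eq_iff, le_div_iff₀ hh, div_lt_iff₀ hh, mem_Ico]

lemma gridCell_eq_preimage (hh : 0 < h) (k : Fin 2 → ℤ) :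
    gridCell h k = (WithLp.ofLp : Plane → Fin 2 → ℝ) ⁻¹'
      (univ.pi fun i => Ico (k i * h) ((k i + 1) * h)) := by
  ext x
  rw [mem_gridCell hh]
  simp

lemma measurableSet_gridCell (hh : 0 < h) (k : Fin 2 → ℤ) : MeasurableSet (gridCell h k) := by
  rw [gridCell_eq_preimage hh]
  exact (PiLp.volume_preserving_ofLp (Fin 2)).measurable
    (MeasurableSet.univ_pi fun i => measurableSet_Ico)

lemma volume_gridCell (hh : 0 < h) (k : Fin 2 → ℤ) :
    volume (gridCell h k) = ENNReal.ofReal (h ^ 2) := by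
  rw [gridCell_eq_preimage hh, (PiLp.volume_preserving_ofLp (Fin 2)).measure_preimage
    (MeasurableSet.univ_pi fun i => measurableSet_Ico).nullMeasurableSet, volume_pi_pi]
  simp only [Real.volume_Ico]
  rw [Fin.prod_univ_two, ← ENNReal.ofReal_mul (by nlinarith)]
  congr 1; ring

lemma convex_gridCell (hh : 0 < h) (k : Fin 2 → ℤ) : Convex ℝ (gridCell h k) := by
  rw [gridCell_eq_preimage hh]
  exact (convex_pi fun i _ => convex_Ico _ _).linear_preimage
    (WithLp.linearEquiv 2 ℝ (Fin 2 → ℝ)).toLinearMap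

lemma norm_sub_le_of_mem_gridCell (hh : 0 < h) {k : Fin 2 → ℤ} {x y : Plane}
    (hx : x ∈ gridCell h k) (hy : y ∈ gridCell h k) : ‖y - x‖ ≤ 2 * h := by
  rw [mem_gridCell hh] at hx hy
  rw [EuclideanSpace.norm_eq, Real.sqrt_le_iff, Fin.sum_univ_two]
  refine ⟨by positivity, ?_⟩
  have hi : ∀ i, ‖(y - x) i‖ ^ 2 ≤ h ^ 2 := by
    intro i
    rw [Real.norm_eq_abs, sq_abs, sq_le_sq, abs_of_pos hh, PiLp.sub_apply, abs_le]
    have h1 := hx i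
    have h2 := hy i
    rw [mem_Ico] at h1 h2
    constructor <;> linarith
  nlinarith [hi 0, hi 1]

lemma gridCell_disjoint {k k' : Fin 2 → ℤ} (hk : k ≠ k') :
    Disjoint (gridCell h k) (gridCell h k') := by
  rw [Set.disjoint_left]
  intro x hx hx'
  exact hk (funext fun i => (hx i).symm.trans (hx' i))

/-- The Poincaré inequality on a square of side `h`. -/
lemma sqNorm_gridCell_le (hh : 0 < h) (k : Fin 2 → ℤ) {φ : Plane → ℂ} (hφ : ContDiff ℝ ∞ φ) :
    sqNorm (gridCell h k) φ ≤
      ‖((Real.sqrt 2 / h : ℝ) : ℂ) * ∫ x in gridCell h k, φ x‖ₑ ^ 2 +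
        ENNReal.ofReal (64 * Real.pi * h ^ 2) * sqGrad (gridCell h k) φ := by
  have hb : Bornology.IsBounded (gridCell h k) := by
    rw [Metric.isBounded_iff]
    exact ⟨2 * h, fun x hx y hy => by
      rw [dist_eq_norm]; exact norm_sub_le_of_mem_gridCell hh hy hx⟩
  have hV := volume_gridCell hh k
  have h0 : volume (gridCell h k) ≠ 0 := by
    rw [hV]; exact (ENNReal.ofReal_pos.2 (by positivity)).ne'
  refine (sqNorm_le_of_convex (measurableSet_gridCell hh k) (convex_gridCell hh k) hb h0
    (fun x hx y hy => norm_sub_le_of_mem_gridCell hh hx hy) hφ).trans ?_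
  have hinv : (2 : ℝ≥0∞) * (volume (gridCell h k))⁻¹ = ENNReal.ofReal (2 / h ^ 2) := by
    rw [hV, ← ENNReal.ofReal_inv_of_pos (by positivity), div_eq_mul_inv,
      ENNReal.ofReal_mul (by norm_num)]
    simp
  have hball : volume (Metric.closedBall (0 : Plane) (2 * h)) =
      ENNReal.ofReal (Real.pi * (2 * h) ^ 2) := by
    rw [EuclideanSpace.volume_closedBall_fin_two, ← ENNReal.ofReal_pow (by positivity), mul_comm,
      ENNReal.ofReal_mul Real.pi_pos.le, ENNReal.ofReal_pow (by positivity)]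
  rw [hinv, hball, ← ENNReal.ofReal_pow (by positivity)]
  refine add_le_add (le_of_eq ?_) (le_of_eq ?_)
  · rw [enorm_mul, mul_pow, ← ofReal_norm ((_ : ℝ) : ℂ), Complex.norm_real,
      Real.norm_of_nonneg (by positivity), ← ENNReal.ofReal_pow (by positivity), div_pow,
      Real.sq_sqrt (by norm_num)]
  · rw [← mul_assoc, ← mul_assoc, ← mul_assoc]
    congr 1
    rw [show (2 : ℝ≥0∞) = ENNReal.ofReal 2 by simp, ← ENNReal.ofReal_mul (by positivity),
      ← ENNReal.ofReal_mul (by positivity), ← ENNReal.ofReal_mul (by positivity)]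
    congr 1
    field_simp
    ring

end Poincare

/-! ### Ehrling inequality on bounded parts of the domain -/

section Ehrling

variable {Ω : TopologicalSpace.Opens Plane}

/-- An Ehrling-type inequality on `S`, which expresses that the embedding of `H¹(Ω)` into `L²(S)` is
compact: the `L²(S)`-norm is small compared with the norm of the gradient up to finitely many
continuous functionals on `L²(Ω)`. -/
def EhrlingOn (Ω : TopologicalSpace.Opens Plane) (S : Set Plane) : Prop :=
  ∀ ε : ℝ, 0 < ε → ∃ L : List (L2 Ω →L[ℂ] ℂ), ∀ φ : Plane → ℂ, ContDiff ℝ ∞ φ → ∀ u : L2 Ω,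
    u =ᵐ[volume.restrict (Ω : Set Plane)] φ →
      sqNorm S φ ≤ ENNReal.ofReal ε * sqGrad Ω φ + (L.map fun l => ‖l u‖ₑ ^ 2).sum

lemma exists_pos_mul_le (A : ℝ) {ε : ℝ} (hA : 0 ≤ A) (hε : 0 < ε) :
    ∃ t : ℝ, 0 < t ∧ t ≤ 1 ∧ t * A ≤ ε := by
  refine ⟨min 1 (ε / (A + 1)), by positivity, min_le_left _ _, ?_⟩
  calc min 1 (ε / (A + 1)) * A ≤ ε / (A + 1) * (A + 1) := by
        gcongr
        · exact min_le_right _ _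
        · linarith
    _ = ε := by field_simp

/-- The functional `u ↦ c ∫_Q u` on `L²(Ω)`. -/
lemma exists_functional_integral {Q : Set Plane} (hQ : MeasurableSet Q) (hQΩ : Q ⊆ Ω)
    (hQt : volume Q ≠ ⊤) (c : ℂ) :
    ∃ l : L2 Ω →L[ℂ] ℂ, ∀ u : L2 Ω, l u = c * ∫ x in Q, u x := by
  have hQt' : volume.restrict (Ω : Set Plane) Q ≠ ⊤ :=
    (Measure.restrict_apply_le _ _).trans_lt hQt.lt_top |>.ne
  refine ⟨c • innerSL ℂ (indicatorConstLp 2 hQ hQt' (1 : ℂ)), fun u => ?_⟩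
  have := L2.inner_indicatorConstLp_one (𝕜 := ℂ) hQ hQt' u
  rw [Measure.restrict_restrict hQ, inter_eq_left.2 hQΩ] at this
  rw [← this]
  rfl

/-- Interior compactness: the mean values on the squares of a fine grid are sufficient. -/
lemma ehrlingOn_of_interior {K : Set Plane} (hK : Bornology.IsBounded K) {η : ℝ} (hη : 0 < η)
    (hKΩ : ∀ y ∈ K, Metric.ball y η ⊆ (Ω : Set Plane)) : EhrlingOn Ω K := by
  classical
  intro ε hε
  obtain ⟨t, ht0, ht1, ht⟩ := exists_pos_mul_le (64 * Real.pi) (by positivity) hε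
  -- cells have diameter at most `2 h`, so those which meet `K` are contained in `Ω`
  set h : ℝ := min t (η / 4) with hh
  have hh0 : 0 < h := lt_min ht0 (by positivity)
  have hhε : 64 * Real.pi * h ^ 2 ≤ ε := by
    have h1 : h ≤ t := min_le_left _ _
    calc 64 * Real.pi * h ^ 2 ≤ 64 * Real.pi * t := by
          gcongr
          nlinarith
      _ ≤ ε := by linarith
  have hfin : {k : Fin 2 → ℤ | (gridCell h k ∩ K).Nonempty}.Finite := by
    obtain ⟨M, hM⟩ := hK.subset_closedBall 0
    refine (Set.finite_Icc (fun _ => ⌊-M / h⌋) (fun _ => ⌊M / h⌋)).subset ?_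
    rintro k ⟨x, hx, hxK⟩
    have hxM : ∀ i, |x i| ≤ M := fun i => by
      have := PiLp.norm_apply_le x i
      rw [Real.norm_eq_abs] at this
      exact this.trans (mem_closedBall_zero_iff.1 (hM hxK))
    refine ⟨fun i => ?_, fun i => ?_⟩
    · rw [← hx i]
      exact Int.floor_le_floor (by gcongr; exact (abs_le.1 (hxM i)).1)
    · rw [← hx i]
      exact Int.floor_le_floor (by gcongr; exact (abs_le.1 (hxM i)).2)
  set I := hfin.toFinset with hI
  have hIΩ : ∀ k ∈ I, gridCell h k ⊆ (Ω : Set Plane) := by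
    intro k hk x hx
    rw [hI, Set.Finite.mem_toFinset] at hk
    obtain ⟨y, hy, hyK⟩ := hk
    refine hKΩ y hyK ?_
    rw [Metric.mem_ball, dist_eq_norm]
    have h1 := norm_sub_le_of_mem_gridCell hh0 hy hx
    have h2 : h ≤ η / 4 := min_le_right _ _
    linarith
  have hKI : K ⊆ ⋃ k ∈ I, gridCell h k := by
    intro x hx
    simp only [mem_iUnion]
    refine ⟨fun i => ⌊x i / h⌋, ?_, fun i => rfl⟩
    rw [hI, Set.Finite.mem_toFinset]
    exact ⟨x, fun i => rfl, hx⟩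
  have hVt : ∀ k, volume (gridCell h k) ≠ ⊤ := fun k => by rw [volume_gridCell hh0]; simp
  have hsum : ∀ f : Plane → ℂ, sqNorm (⋃ k ∈ I, gridCell h k) f =
      ∑ k ∈ I, sqNorm (gridCell h k) f := fun f =>
    lintegral_biUnion_finset (fun k _ k' _ hkk' => gridCell_disjoint hkk')
      (fun k _ => measurableSet_gridCell hh0 k) _
  have hgrad : ∀ φ : Plane → ℂ, ∑ k ∈ I, sqGrad (gridCell h k) φ ≤ sqGrad Ω φ := by
    intro φ
    simp only [sqGrad]
    rw [Finset.sum_comm]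
    refine Finset.sum_le_sum fun i _ => ?_
    rw [← hsum]
    exact sqNorm_mono (iUnion₂_subset hIΩ) _
  have hl : ∀ k, ∃ l : L2 Ω →L[ℂ] ℂ, k ∈ I → ∀ u : L2 Ω,
      l u = ((Real.sqrt 2 / h : ℝ) : ℂ) * ∫ x in gridCell h k, u x := by
    intro k
    by_cases hk : k ∈ I
    · obtain ⟨l, hl⟩ := exists_functional_integral (measurableSet_gridCell hh0 k) (hIΩ k hk) (hVt k)
        ((Real.sqrt 2 / h : ℝ) : ℂ)
      exact ⟨l, fun _ => hl⟩
    · exact ⟨0, fun h => absurd h hk⟩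
  choose l hl using hl
  refine ⟨I.toList.map l, fun φ hφ u hu => ?_⟩
  have e : ((I.toList.map l).map fun l => ‖l u‖ₑ ^ 2).sum = ∑ k ∈ I, ‖l k u‖ₑ ^ 2 := by
    rw [List.map_map]
    exact Finset.sum_map_toList I _
  rw [e]
  calc sqNorm K φ ≤ ∑ k ∈ I, sqNorm (gridCell h k) φ := by
        rw [← hsum]; exact sqNorm_mono hKI φ
    _ ≤ ∑ k ∈ I, (‖l k u‖ₑ ^ 2 + ENNReal.ofReal ε * sqGrad (gridCell h k) φ) := by
        refine Finset.sum_le_sum fun k hk => (sqNorm_gridCell_le hh0 k hφ).trans ?_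
        rw [hl k hk]
        have : ∫ x in gridCell h k, u x = ∫ x in gridCell h k, φ x :=
          integral_congr_ae (ae_restrict_of_ae_restrict_of_subset (hIΩ k hk) hu)
        rw [this]
        gcongr
    _ ≤ _ := by
        rw [Finset.sum_add_distrib, ← Finset.mul_sum, add_comm]
        gcongr
        exact hgrad φ

/-- Near a point of `closure Ω` one first translates a neighbourhood into the interior. -/
lemma exists_ehrlingOn_near (hΩ : HasSmoothBoundary Ω) {p : Plane}
    (hp : p ∈ closure (Ω : Set Plane)) :
    ∃ r > 0, EhrlingOn Ω ((Ω : Set Plane) ∩ Metric.ball p r) := by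
  obtain ⟨r, hr, δ, hδ, v, hcone⟩ := exists_cone hΩ hp
  refine ⟨r, hr, fun ε hε => ?_⟩
  set S := (Ω : Set Plane) ∩ Metric.ball p r with hS
  have hSm : MeasurableSet S :=
    Ω.isOpen.measurableSet.inter Metric.isOpen_ball.measurableSet
  obtain ⟨t, ht0, ht1, ht⟩ := exists_pos_mul_le (4 * ‖v‖ ^ 2) (by positivity) (half_pos hε)
  set S' : Set Plane := (fun y => y - t • v) ⁻¹' S with hS'
  have hS'm : MeasurableSet S' := (measurable_sub_const _) hSm
  have hS'b : Bornology.IsBounded S' := by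
    refine (Metric.isBounded_ball (x := p + t • v) (r := r)).subset fun y hy => ?_
    have := hy.2
    rw [Metric.mem_ball, dist_eq_norm] at this ⊢
    rwa [show y - (p + t • v) = y - t • v - p by rw [add_comm, sub_sub]]
  have hint : EhrlingOn Ω S' := by
    refine ehrlingOn_of_interior hS'b (η := t * δ) (by positivity) fun y hy z hz => ?_
    rw [Metric.mem_ball, dist_eq_norm] at hz
    have hw : v + t⁻¹ • (z - y) ∈ Metric.closedBall v δ := by
      rw [Metric.mem_closedBall, dist_eq_norm, add_sub_cancel_left, norm_smul, norm_inv,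
        Real.norm_of_nonneg ht0.le, inv_mul_le_iff₀ ht0]
      exact hz.le
    have := hcone _ hy _ hw t ⟨ht0.le, ht1⟩
    have e : y - t • v + t • (v + t⁻¹ • (z - y)) = z := by
      rw [smul_add, smul_smul, mul_inv_cancel₀ ht0.ne', one_smul]
      abel
    rwa [e] at this
  obtain ⟨L, hL⟩ := hint (ε / 4) (by positivity)
  refine ⟨L ++ L, fun φ hφ u hu => ?_⟩
  have hseg : ∀ x ∈ S, ∀ s ∈ Icc (0 : ℝ) 1, x + s • (t • v) ∈ (Ω : Set Plane) := by
    intro x hx s hs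
    rw [smul_smul]
    refine hcone x hx v (Metric.mem_closedBall_self hδ.le) _ ⟨mul_nonneg hs.1 ht0.le, ?_⟩
    nlinarith [hs.1, hs.2]
  have h1 : sqNorm S (fun x => φ (x + t • v) - φ x) ≤ ENNReal.ofReal (ε / 4) * sqGrad Ω φ := by
    refine (sqNorm_translate_sub_le hSm Ω.isOpen.measurableSet hseg hφ).trans
      ((sqNorm_dirDeriv_le_grad _ _ hφ).trans ?_)
    gcongr
    have e2 : (2 : ℝ≥0∞) = ENNReal.ofReal 2 := by simp
    rw [← ofReal_norm, ← ENNReal.ofReal_pow (norm_nonneg _)]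
    refine (congrArg (· * ENNReal.ofReal (‖t • v‖ ^ 2)) e2).le.trans ?_
    rw [← ENNReal.ofReal_mul (by norm_num)]
    refine ENNReal.ofReal_le_ofReal ?_
    rw [norm_smul, Real.norm_of_nonneg ht0.le, mul_pow]
    nlinarith [mul_nonneg ht0.le (sq_nonneg ‖v‖),
      mul_le_mul_of_nonneg_right (show t ^ 2 ≤ t by nlinarith) (sq_nonneg ‖v‖)]
  have h2 : sqNorm S (fun x => φ (x + t • v)) ≤ sqNorm S' φ :=
    sqNorm_translate_le hSm hS'm (fun x hx => by simpa [hS'] using hx) φ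
  have hc : Continuous fun x => φ (x + t • v) := hφ.continuous.comp (by fun_prop)
  calc sqNorm S φ = sqNorm S (fun x => φ (x + t • v) + -(φ (x + t • v) - φ x)) := by
        congr 1; ext x; ring
    _ ≤ 2 * sqNorm S (fun x => φ (x + t • v)) +
        2 * sqNorm S (fun x => -(φ (x + t • v) - φ x)) := sqNorm_add_le _ hc.aestronglyMeasurable
    _ ≤ 2 * (ENNReal.ofReal (ε / 4) * sqGrad Ω φ + (L.map fun l => ‖l u‖ₑ ^ 2).sum) +
        2 * (ENNReal.ofReal (ε / 4) * sqGrad Ω φ) := by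
        gcongr
        · exact h2.trans (hL φ hφ u hu)
        · simp only [sqNorm, enorm_neg] at h1 ⊢
          exact h1
    _ = _ := by
        rw [List.map_append, List.sum_append]
        have : ENNReal.ofReal ε = 4 * ENNReal.ofReal (ε / 4) := by
          rw [show (4 : ℝ≥0∞) = ENNReal.ofReal 4 by simp, ← ENNReal.ofReal_mul (by norm_num)]
          congr 1; ring
        rw [this]; ring

lemma EhrlingOn.union {S T : Set Plane} (hS : EhrlingOn Ω S) (hT : EhrlingOn Ω T) :
    EhrlingOn Ω (S ∪ T) := by
  intro ε hε
  obtain ⟨L, hL⟩ := hS (ε / 2) (half_pos hε)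
  obtain ⟨L', hL'⟩ := hT (ε / 2) (half_pos hε)
  refine ⟨L ++ L', fun φ hφ u hu => (sqNorm_union_le _ _ _).trans
    ((add_le_add (hL φ hφ u hu) (hL' φ hφ u hu)).trans (le_of_eq ?_))⟩
  rw [List.map_append, List.sum_append]
  have : ENNReal.ofReal ε = ENNReal.ofReal (ε / 2) + ENNReal.ofReal (ε / 2) := by
    rw [← ENNReal.ofReal_add (by positivity) (by positivity), add_halves]
  rw [this]; ring

lemma ehrlingOn_of_isCompact (hΩ : HasSmoothBoundary Ω) {K : Set Plane} (hK : IsCompact K)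
    (hKΩ : K ⊆ closure (Ω : Set Plane)) : EhrlingOn Ω ((Ω : Set Plane) ∩ K) := by
  refine hK.induction_on (p := fun K => EhrlingOn Ω ((Ω : Set Plane) ∩ K)) ?_ ?_ ?_ ?_
  · exact fun ε hε => ⟨[], fun φ _ u _ => by simp [sqNorm]⟩
  · intro s t hst h ε hε
    obtain ⟨L, hL⟩ := h ε hε
    exact ⟨L, fun φ hφ u hu =>
      (sqNorm_mono (inter_subset_inter_right _ hst) φ).trans (hL φ hφ u hu)⟩
  · intro s t hs ht
    rw [inter_union_distrib_left]
    exact hs.union ht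
  · intro p hp
    obtain ⟨r, hr, h⟩ := exists_ehrlingOn_near hΩ (hKΩ hp)
    exact ⟨_, mem_nhdsWithin_of_mem_nhds (Metric.ball_mem_nhds p hr), h⟩

end Ehrling

/-! ### One-dimensional inequalities on the slices of the peak -/

section Slices

variable {h : ℝ} {g g' : ℝ → ℂ}

lemma volume_Ioo_symm (h : ℝ) : volume (Ioo (-h) h) = ENNReal.ofReal (2 * h) := by
  rw [Real.volume_Ioo]; congr 1; ring

/-- Oscillation on a symmetric interval. -/
lemma enorm_sub_sq_le_slice (hg : ∀ t, HasDerivAt g (g' t) t) (hc : Continuous g') {t t' : ℝ}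
    (ht : t ∈ Icc (-h) h) (ht' : t' ∈ Icc (-h) h) :
    ‖g t - g t'‖ₑ ^ 2 ≤ ENNReal.ofReal (2 * h) * ∫⁻ τ in Ioo (-h) h, ‖g' τ‖ₑ ^ 2 := by
  wlog htt : t' ≤ t generalizing t t'
  · rw [← enorm_neg, neg_sub]
    exact this ht' ht (le_of_not_ge htt)
  rw [← volume_Ioo_symm, ← Measure.restrict_apply_univ,
    Measure.restrict_congr_set (Ioo_ae_eq_Icc (μ := volume) (a := -h) (b := h))]
  refine le_trans (pow_le_pow_left' ((enorm_sub_le_lintegral_deriv hg hc htt).trans ?_) 2)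
    (sq_lintegral_le hc.enorm.aemeasurable)
  exact lintegral_mono_set (Icc_subset_Icc ht'.1 ht.2)

/-- On a slice, a function is controlled by its value at one point and its derivative. -/
lemma lintegral_slice_le (hg : ∀ t, HasDerivAt g (g' t) t) (hc : Continuous g') {t₀ : ℝ}
    (ht₀ : t₀ ∈ Icc (-h) h) :
    ∫⁻ t in Ioo (-h) h, ‖g t‖ₑ ^ 2 ≤ ENNReal.ofReal (2 * h) * (2 * ‖g t₀‖ₑ ^ 2) +
      2 * ENNReal.ofReal (2 * h) ^ 2 * ∫⁻ t in Ioo (-h) h, ‖g' t‖ₑ ^ 2 := by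
  set A := ∫⁻ t in Ioo (-h) h, ‖g' t‖ₑ ^ 2 with hA
  calc _ ≤ ∫⁻ _t in Ioo (-h) h, (2 * ‖g t₀‖ₑ ^ 2 + 2 * (ENNReal.ofReal (2 * h) * A)) := by
        refine setLIntegral_mono' measurableSet_Ioo fun t ht => ?_
        have e : g t = g t₀ + (g t - g t₀) := by ring
        rw [e]
        refine (enorm_add_sq_le _ _).trans ?_
        gcongr
        exact enorm_sub_sq_le_slice hg hc (Ioo_subset_Icc_self ht) ht₀
    _ = _ := by
        rw [setLIntegral_const, volume_Ioo_symm]; ring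

/-- A one-dimensional trace inequality. -/
lemma enorm_sq_le_lintegral_slice (hg : ∀ t, HasDerivAt g (g' t) t) (hc : Continuous g') {t₀ : ℝ}
    (ht₀ : t₀ ∈ Icc (-h) h) :
    ENNReal.ofReal (2 * h) * ‖g t₀‖ₑ ^ 2 ≤ 2 * (∫⁻ t in Ioo (-h) h, ‖g t‖ₑ ^ 2) +
      2 * ENNReal.ofReal (2 * h) ^ 2 * ∫⁻ t in Ioo (-h) h, ‖g' t‖ₑ ^ 2 := by
  set A := ∫⁻ t in Ioo (-h) h, ‖g' t‖ₑ ^ 2 with hA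
  calc _ = ∫⁻ _t in Ioo (-h) h, ‖g t₀‖ₑ ^ 2 := by
        rw [setLIntegral_const, volume_Ioo_symm, mul_comm]
    _ ≤ ∫⁻ t in Ioo (-h) h, (2 * ‖g t‖ₑ ^ 2 + 2 * (ENNReal.ofReal (2 * h) * A)) := by
        refine setLIntegral_mono' measurableSet_Ioo fun t ht => ?_
        have e : g t₀ = g t + (g t₀ - g t) := by ring
        rw [e]
        refine (enorm_add_sq_le _ _).trans ?_
        gcongr
        exact enorm_sub_sq_le_slice hg hc ht₀ (Ioo_subset_Icc_self ht)
    _ = _ := by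
        rw [lintegral_add_right _ measurable_const, lintegral_const_mul' _ _ (by simp),
          setLIntegral_const, volume_Ioo_symm]; ring

/-- On a slice, the derivative is controlled by the values at the ends and the second
derivative, as the mean value of the derivative is the difference quotient. -/
lemma lintegral_deriv_slice_le {g'' : ℝ → ℂ} (hh : 0 < h) (hg : ∀ t, HasDerivAt g (g' t) t)
    (hg' : ∀ t, HasDerivAt g' (g'' t) t) (hc : Continuous g'') :
    ∫⁻ t in Ioo (-h) h, ‖g' t‖ₑ ^ 2 ≤
      (ENNReal.ofReal (2 * h))⁻¹ * (4 * (‖g h‖ₑ ^ 2 + ‖g (-h)‖ₑ ^ 2)) +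
      2 * ENNReal.ofReal (2 * h) ^ 2 * ∫⁻ t in Ioo (-h) h, ‖g'' t‖ₑ ^ 2 := by
  have hc' : Continuous g' := continuous_iff_continuousAt.2 fun t => (hg' t).continuousAt
  set B := ∫⁻ t in Ioo (-h) h, ‖g'' t‖ₑ ^ 2 with hB
  set d := ENNReal.ofReal (2 * h) with hd
  have hd0 : d ≠ 0 := (ENNReal.ofReal_pos.2 (by positivity)).ne'
  have hdt : d ≠ ⊤ := ENNReal.ofReal_ne_top
  have hpt : ∀ t ∈ Ioo (-h) h, d ^ 2 * ‖g' t‖ₑ ^ 2 ≤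
      4 * (‖g h‖ₑ ^ 2 + ‖g (-h)‖ₑ ^ 2) + 2 * d ^ 3 * B := by
    intro t ht
    -- the remainder `g(h) - g(-h) - 2 h g'(t)` is the increment of `g(τ) - τ g'(t)`
    have h1 := enorm_sub_sq_le_slice (h := h) (g := fun τ => g τ - (τ : ℂ) * g' t)
      (g' := fun τ => g' τ - g' t) (fun τ => by
        have := ((hasDerivAt_id τ).ofReal_comp).mul_const (g' t)
        exact (hg τ).fun_sub (by simpa using this)) (hc'.sub continuous_const)
      (right_mem_Icc.2 (by linarith)) (left_mem_Icc.2 (by linarith))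
    have h2 : ∫⁻ τ in Ioo (-h) h, ‖g' τ - g' t‖ₑ ^ 2 ≤ d * (d * B) := by
      calc _ ≤ ∫⁻ _τ in Ioo (-h) h, d * B := by
            refine setLIntegral_mono' measurableSet_Ioo fun τ hτ => ?_
            exact enorm_sub_sq_le_slice hg' hc (Ioo_subset_Icc_self hτ) (Ioo_subset_Icc_self ht)
        _ = _ := by rw [setLIntegral_const, volume_Ioo_symm]; ring
    have e : ((2 * h : ℝ) : ℂ) * g' t = (g h - g (-h)) -
        (g h - (h : ℂ) * g' t - (g (-h) - ((-h : ℝ) : ℂ) * g' t)) := by push_cast; ring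
    have e2 : ‖((2 * h : ℝ) : ℂ)‖ₑ = d := by
      rw [← ofReal_norm, Complex.norm_real, Real.norm_of_nonneg (by positivity)]
    calc d ^ 2 * ‖g' t‖ₑ ^ 2 = ‖((2 * h : ℝ) : ℂ) * g' t‖ₑ ^ 2 := by rw [enorm_mul, e2, mul_pow]
      _ ≤ 2 * ‖g h - g (-h)‖ₑ ^ 2 + 2 * (d * (d * (d * B))) := by
        rw [e]
        refine (enorm_sub_sq_le _ _).trans ?_
        gcongr
        exact h1.trans (by gcongr)
      _ ≤ 2 * (2 * ‖g h‖ₑ ^ 2 + 2 * ‖g (-h)‖ₑ ^ 2) + 2 * (d * (d * (d * B))) := by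
        gcongr
        exact enorm_sub_sq_le _ _
      _ = _ := by ring
  have hsum : d ^ 2 * ∫⁻ t in Ioo (-h) h, ‖g' t‖ₑ ^ 2 ≤
      (4 * (‖g h‖ₑ ^ 2 + ‖g (-h)‖ₑ ^ 2) + 2 * d ^ 3 * B) * d := by
    rw [← lintegral_const_mul' _ _ (by finiteness)]
    refine (setLIntegral_mono' measurableSet_Ioo hpt).trans ?_
    rw [setLIntegral_const, volume_Ioo_symm]
  have hdd : d⁻¹ * d = 1 := ENNReal.inv_mul_cancel hd0 hdt
  calc ∫⁻ t in Ioo (-h) h, ‖g' t‖ₑ ^ 2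
      = (d⁻¹ * d) * (d⁻¹ * d) * ∫⁻ t in Ioo (-h) h, ‖g' t‖ₑ ^ 2 := by rw [hdd]; simp
    _ = d⁻¹ * d⁻¹ * (d ^ 2 * ∫⁻ t in Ioo (-h) h, ‖g' t‖ₑ ^ 2) := by ring
    _ ≤ d⁻¹ * d⁻¹ * ((4 * (‖g h‖ₑ ^ 2 + ‖g (-h)‖ₑ ^ 2) + 2 * d ^ 3 * B) * d) := by gcongr
    _ = (d⁻¹ * d) * (d⁻¹ * (4 * (‖g h‖ₑ ^ 2 + ‖g (-h)‖ₑ ^ 2)) +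
        2 * (d⁻¹ * d) * d ^ 2 * B) := by ring
    _ = _ := by rw [hdd, one_mul, mul_one]

end Slices

/-! ### Friedrichs-type inequalities in the peak -/

section Peak

variable {Ω : TopologicalSpace.Opens Plane} {H : ℝ → ℝ} {R : ℝ}

/-- The part of the plane between two vertical lines. -/
def strip (a b : ℝ) : Set Plane := {x | x 0 ∈ Ioo a b}

lemma isOpen_strip (a b : ℝ) : IsOpen (strip a b) :=
  isOpen_Ioo.preimage (PiLp.continuous_apply 2 _ 0)

lemma measurableSet_inter_strip (a b : ℝ) : MeasurableSet ((Ω : Set Plane) ∩ strip a b) :=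
  (Ω.isOpen.inter (isOpen_strip a b)).measurableSet

lemma mem_inter_strip_iff (hΩ : IsPeakDomain Ω H R) {a b : ℝ} (ha : R ≤ a) (x : Plane) :
    x ∈ (Ω : Set Plane) ∩ strip a b ↔ x 0 ∈ Ioo a b ∧ x 1 ∈ Ioo (-H (x 0)) (H (x 0)) := by
  constructor
  · rintro ⟨h1, h2⟩
    have h3 : x ∈ (Ω : Set Plane) ∩ {x | R < x 0} := ⟨h1, ha.trans_lt h2.1⟩
    rw [hΩ.inter_halfPlane] at h3
    exact ⟨h2, h3.2⟩
  · rintro ⟨h1, h2⟩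
    have h3 : x ∈ peak H R := ⟨ha.trans_lt h1.1, h2⟩
    rw [← hΩ.inter_halfPlane] at h3
    exact ⟨h3.1, h1⟩

lemma measurePreserving_pair :
    MeasurePreserving (fun q : ℝ × ℝ => (!₂[q.1, q.2] : Plane)) volume volume :=
  (PiLp.volume_preserving_toLp (Fin 2)).comp (volume_preserving_finTwoArrow ℝ).symm

lemma lintegral_plane {f : Plane → ℝ≥0∞} (hf : Measurable f) :
    ∫⁻ x, f x = ∫⁻ s, ∫⁻ t, f !₂[s, t] := by
  rw [← measurePreserving_pair.lintegral_comp hf, Measure.volume_eq_prod, lintegral_prod]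
  exact (hf.comp measurePreserving_pair.measurable).aemeasurable

lemma lintegral_inter_strip (hΩ : IsPeakDomain Ω H R) {a b : ℝ} (ha : R ≤ a) {f : Plane → ℝ≥0∞}
    (hf : Measurable f) : ∫⁻ x in (Ω : Set Plane) ∩ strip a b, f x =
      ∫⁻ s in Ioo a b, ∫⁻ t in Ioo (-H s) (H s), f !₂[s, t] := by
  rw [← lintegral_indicator (measurableSet_inter_strip a b),
    lintegral_plane (hf.indicator (measurableSet_inter_strip a b)),
    ← lintegral_indicator measurableSet_Ioo]
  refine lintegral_congr fun s => ?_
  by_cases hs : s ∈ Ioo a b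
  · rw [indicator_of_mem hs, ← lintegral_indicator measurableSet_Ioo]
    refine lintegral_congr fun t => ?_
    by_cases ht : t ∈ Ioo (-H s) (H s)
    · rw [indicator_of_mem ht, indicator_of_mem]
      rw [mem_inter_strip_iff hΩ ha]
      exact ⟨hs, ht⟩
    · rw [indicator_of_notMem ht, indicator_of_notMem]
      rw [mem_inter_strip_iff hΩ ha]
      exact fun h => ht h.2
  · rw [indicator_of_notMem hs, ← lintegral_zero (α := ℝ) (μ := volume)]
    refine lintegral_congr fun t => indicator_of_notMem (fun h => hs ?_) _
    rw [mem_inter_strip_iff hΩ ha] at h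
    exact h.1

/-- Integration of an inequality on the vertical slices of the peak. -/
lemma sqNorm_le_of_slices (hΩ : IsPeakDomain Ω H R) {a b : ℝ} (ha : R ≤ a) {F : Plane → ℂ}
    (hF : Continuous F) {B : ℝ → ℝ≥0∞} (hB : AEMeasurable B (volume.restrict (Ioo a b)))
    {G : Plane → ℝ≥0∞} (hG : Measurable G)
    (h : ∀ s ∈ Ioo a b, ∫⁻ t in Ioo (-H s) (H s), ‖F !₂[s, t]‖ₑ ^ 2 ≤
      B s + ∫⁻ t in Ioo (-H s) (H s), G !₂[s, t]) :
    sqNorm ((Ω : Set Plane) ∩ strip a b) F ≤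
      (∫⁻ s in Ioo a b, B s) + ∫⁻ x in (Ω : Set Plane) ∩ strip a b, G x := by
  have hF' : Measurable fun x => ‖F x‖ₑ ^ 2 :=
    ((ENNReal.continuous_pow 2).comp hF.enorm).measurable
  rw [sqNorm, lintegral_inter_strip hΩ ha hF', lintegral_inter_strip hΩ ha hG,
    ← lintegral_add_left' hB]
  exact setLIntegral_mono' measurableSet_Ioo h

/-- Restriction to a vertical line. -/
lemma hasDerivAt_vertical {φ : Plane → ℂ} (hφ : ContDiff ℝ ∞ φ) (s t : ℝ) :
    HasDerivAt (fun t : ℝ => φ !₂[s, t]) (pderiv 1 φ !₂[s, t]) t := by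
  have e : ∀ t : ℝ, (!₂[s, t] : Plane) = !₂[s, 0] + t • EuclideanSpace.single 1 (1 : ℝ) := by
    intro t; ext i; fin_cases i <;> simp
  have := hasDerivAt_line hφ !₂[s, 0] (EuclideanSpace.single 1 (1 : ℝ)) t
  simp only [← e] at this
  exact this

lemma continuous_pair : Continuous fun q : ℝ × ℝ => (!₂[q.1, q.2] : Plane) := by
  refine (PiLp.continuous_toLp 2 _).comp (continuous_pi fun i => ?_)
  fin_cases i
  · exact continuous_fst
  · exact continuous_snd

lemma continuous_vertical {f : Plane → ℂ} (hf : Continuous f) (s : ℝ) :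
    Continuous fun t : ℝ => f !₂[s, t] :=
  hf.comp (continuous_pair.comp (continuous_const.prodMk continuous_id))

/-- The parametrization of the upper (`σ = 1`) and the lower (`σ = -1`) side of the peak. -/
def sideCurve (H : ℝ → ℝ) (σ s : ℝ) : Plane := !₂[s, σ * H s]

lemma continuousOn_sideCurve (hH : IsPeakProfile H R) (σ : ℝ) :
    ContinuousOn (sideCurve H σ) (Ioi R) :=
  continuous_pair.comp_continuousOn
    (continuousOn_id.prodMk (continuousOn_const.mul hH.contDiffOn.continuousOn))

lemma aemeasurable_sideCurve (hH : IsPeakProfile H R) (σ : ℝ) {a : ℝ} (b : ℝ) (ha : R ≤ a) :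
    AEMeasurable (sideCurve H σ) (volume.restrict (Ioo a b)) :=
  ((continuousOn_sideCurve hH σ).mono fun _ hs => ha.trans_lt hs.1).aemeasurable measurableSet_Ioo

lemma IsPeakProfile.differentiableAt (hH : IsPeakProfile H R) {s : ℝ} (hs : R < s) :
    DifferentiableAt ℝ H s :=
  (hH.contDiffOn.contDiffAt (Ioi_mem_nhds hs)).differentiableAt (by simp)

lemma IsPeakProfile.continuousOn_deriv (hH : IsPeakProfile H R) :
    ContinuousOn (deriv H) (Ioi R) :=
  hH.contDiffOn.continuousOn_deriv_of_isOpen isOpen_Ioi (by simp)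

lemma ofReal_two_mul_le (hH : IsPeakProfile H R) {a b s : ℝ} (ha : R < a) (hs : s ∈ Ioo a b) :
    ENNReal.ofReal (2 * H s) ≤ ENNReal.ofReal (2 * H a) := by
  refine ENNReal.ofReal_le_ofReal ?_
  have := hH.antitoneOn (mem_Ioi.2 ha) (mem_Ioi.2 (ha.trans hs.1)) hs.1.le
  linarith

lemma mem_Icc_of_sign (hH : IsPeakProfile H R) {σ s : ℝ} (hσ : σ = 1 ∨ σ = -1) (hs : R < s) :
    σ * H s ∈ Icc (-H s) (H s) := by
  have := hH.pos s hs
  rcases hσ with rfl | rfl <;> constructor <;> linarith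

/-- The squared `L²`-norm with respect to `x₁` of a function on a side of the peak. -/
noncomputable def sqSide (H : ℝ → ℝ) (σ a b : ℝ) (f : Plane → ℂ) : ℝ≥0∞ :=
  ∫⁻ s in Ioo a b, ‖f (sideCurve H σ s)‖ₑ ^ 2

lemma aemeasurable_side (hH : IsPeakProfile H R) (σ : ℝ) {a : ℝ} (b : ℝ) (ha : R ≤ a)
    {f : Plane → ℂ} (hf : Continuous f) :
    AEMeasurable (fun s => ‖f (sideCurve H σ s)‖ₑ ^ 2) (volume.restrict (Ioo a b)) :=
  ((ENNReal.continuous_pow 2).comp hf.enorm).measurable.comp_aemeasurable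
    (aemeasurable_sideCurve hH σ b ha)

lemma measurable_enorm_sq {f : Plane → ℂ} (hf : Continuous f) : Measurable fun x => ‖f x‖ₑ ^ 2 :=
  ((ENNReal.continuous_pow 2).comp hf.enorm).measurable

/-- The Friedrichs inequality in the peak. -/
lemma sqNorm_peak_le (hH : IsPeakProfile H R) (hΩ : IsPeakDomain Ω H R) {σ : ℝ}
    (hσ : σ = 1 ∨ σ = -1) {a b : ℝ} (ha : R < a) {φ : Plane → ℂ} (hφ : ContDiff ℝ ∞ φ) :
    sqNorm ((Ω : Set Plane) ∩ strip a b) φ ≤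
      ENNReal.ofReal (2 * H a) * 2 * sqSide H σ a b φ +
        2 * ENNReal.ofReal (2 * H a) ^ 2 *
          sqNorm ((Ω : Set Plane) ∩ strip a b) (pderiv 1 φ) := by
  have hc1 := continuous_pderiv 1 hφ
  have key := sqNorm_le_of_slices hΩ ha.le (b := b) hφ.continuous
    (B := fun s => ENNReal.ofReal (2 * H a) * 2 * ‖φ (sideCurve H σ s)‖ₑ ^ 2)
    ((aemeasurable_side hH σ b ha.le hφ.continuous).const_mul _)
    (G := fun x => 2 * ENNReal.ofReal (2 * H a) ^ 2 * ‖pderiv 1 φ x‖ₑ ^ 2)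
    ((measurable_enorm_sq hc1).const_mul _) (fun s hs => by
      refine (lintegral_slice_le (hasDerivAt_vertical hφ s) (continuous_vertical hc1 s)
        (mem_Icc_of_sign hH hσ (ha.trans hs.1))).trans ?_
      rw [lintegral_const_mul' _ _ (by finiteness), ← mul_assoc]
      have := ofReal_two_mul_le hH ha hs
      gcongr
      exact le_rfl)
  rwa [lintegral_const_mul' _ _ (by finiteness), lintegral_const_mul' _ _ (by finiteness)] at key

/-- If a function vanishes on both sides of the peak, its transverse derivative has mean value
zero on the slices. -/
lemma sqNorm_pderiv_peak_le_of_ends (hH : IsPeakProfile H R) (hΩ : IsPeakDomain Ω H R)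
    {a b : ℝ} (ha : R < a) {φ : Plane → ℂ} (hφ : ContDiff ℝ ∞ φ) :
    sqNorm ((Ω : Set Plane) ∩ strip a b) (pderiv 1 φ) ≤
      (ENNReal.ofReal (2 * H b))⁻¹ * 4 * (sqSide H 1 a b φ + sqSide H (-1) a b φ) +
        2 * ENNReal.ofReal (2 * H a) ^ 2 *
          sqNorm ((Ω : Set Plane) ∩ strip a b) (pderiv 1 (pderiv 1 φ)) := by
  rcases le_or_gt b a with hba | hab
  · rw [sqNorm]
    have : strip a b = ∅ := by
      refine eq_empty_of_forall_notMem fun x hx => ?_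
      have := hx.1.trans hx.2
      linarith
    rw [this]; simp
  have hd1 := contDiff_pderiv 1 hφ
  have hc2 := continuous_pderiv 1 hd1
  have hHb : 0 < H b := hH.pos b (ha.trans hab)
  have hbt : (ENNReal.ofReal (2 * H b))⁻¹ ≠ ⊤ :=
    ENNReal.inv_ne_top.2 (ENNReal.ofReal_pos.2 (by positivity)).ne'
  have key := sqNorm_le_of_slices hΩ ha.le (b := b) hd1.continuous
    (B := fun s => (ENNReal.ofReal (2 * H b))⁻¹ * 4 *
      (‖φ (sideCurve H 1 s)‖ₑ ^ 2 + ‖φ (sideCurve H (-1) s)‖ₑ ^ 2))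
    (((aemeasurable_side hH 1 b ha.le hφ.continuous).add
      (aemeasurable_side hH (-1) b ha.le hφ.continuous)).const_mul _)
    (G := fun x => 2 * ENNReal.ofReal (2 * H a) ^ 2 * ‖pderiv 1 (pderiv 1 φ) x‖ₑ ^ 2)
    ((measurable_enorm_sq hc2).const_mul _) (fun s hs => by
      have hsR := ha.trans hs.1
      refine (lintegral_deriv_slice_le (hH.pos s hsR) (hasDerivAt_vertical hφ s)
        (hasDerivAt_vertical hd1 s) (continuous_vertical hc2 s)).trans ?_
      rw [lintegral_const_mul' _ _ (by finiteness), ← mul_assoc]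
      have h1 := ofReal_two_mul_le hH ha hs
      have h2 : ENNReal.ofReal (2 * H b) ≤ ENNReal.ofReal (2 * H s) := by
        refine ENNReal.ofReal_le_ofReal ?_
        have := hH.antitoneOn (mem_Ioi.2 hsR) (mem_Ioi.2 (ha.trans hab)) hs.2.le
        linarith
      simp only [sideCurve, one_mul, neg_mul]
      gcongr)
  rwa [lintegral_const_mul' _ _ (by finiteness), lintegral_const_mul' _ _ (by finiteness),
    lintegral_add_left' (aemeasurable_side hH 1 b ha.le hφ.continuous)] at key

/-- If the normal derivative vanishes on one side of the peak, the transverse derivative there is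
`σ H'` times the longitudinal one, which is controlled by the one-dimensional trace inequality. -/
lemma sqNorm_pderiv_peak_le_of_normal (hH : IsPeakProfile H R) (hΩ : IsPeakDomain Ω H R) {σ : ℝ}
    (hσ : σ = 1 ∨ σ = -1) {a b : ℝ} (ha : R < a) (hH' : ∀ s ∈ Ioo a b, |deriv H s| ≤ 1)
    {φ : Plane → ℂ} (hφ : ContDiff ℝ ∞ φ) :
    sqNorm ((Ω : Set Plane) ∩ strip a b) (pderiv 1 φ) ≤
      ENNReal.ofReal (2 * H a) * 4 * (∫⁻ s in Ioo a b, ‖pderiv 1 φ (sideCurve H σ s) -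
          ((σ * deriv H s : ℝ) : ℂ) * pderiv 0 φ (sideCurve H σ s)‖ₑ ^ 2) +
        (8 * sqNorm ((Ω : Set Plane) ∩ strip a b) (pderiv 0 φ) +
          (8 * ENNReal.ofReal (2 * H a) ^ 2 *
            sqNorm ((Ω : Set Plane) ∩ strip a b) (pderiv 1 (pderiv 0 φ)) +
          2 * ENNReal.ofReal (2 * H a) ^ 2 *
            sqNorm ((Ω : Set Plane) ∩ strip a b) (pderiv 1 (pderiv 1 φ)))) := by
  have hd0 := contDiff_pderiv 0 hφ
  have hd1 := contDiff_pderiv 1 hφ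
  have hc01 := continuous_pderiv 1 hd0
  have hc11 := continuous_pderiv 1 hd1
  set D := ENNReal.ofReal (2 * H a) with hD
  have hmeas : AEMeasurable (fun s => ‖pderiv 1 φ (sideCurve H σ s) -
      ((σ * deriv H s : ℝ) : ℂ) * pderiv 0 φ (sideCurve H σ s)‖ₑ ^ 2)
      (volume.restrict (Ioo a b)) := by
    have hsub : Ioo a b ⊆ Ioi R := fun s hs => ha.trans hs.1
    have hcs := (continuousOn_sideCurve hH σ).mono hsub
    have h1 := hd1.continuous.comp_continuousOn hcs
    have h0 := hd0.continuous.comp_continuousOn hcs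
    have h2 : ContinuousOn (fun s => ((σ * deriv H s : ℝ) : ℂ)) (Ioo a b) :=
      Complex.continuous_ofReal.comp_continuousOn
        (continuousOn_const.mul (hH.continuousOn_deriv.mono hsub))
    have h3 := (h1.sub (h2.mul h0)).aemeasurable (μ := volume) measurableSet_Ioo
    exact h3.enorm.pow_const 2
  have key := sqNorm_le_of_slices hΩ ha.le (b := b) hd1.continuous
    (B := fun s => D * 4 * ‖pderiv 1 φ (sideCurve H σ s) -
      ((σ * deriv H s : ℝ) : ℂ) * pderiv 0 φ (sideCurve H σ s)‖ₑ ^ 2)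
    (hmeas.const_mul _)
    (G := fun x => 8 * ‖pderiv 0 φ x‖ₑ ^ 2 + (8 * D ^ 2 * ‖pderiv 1 (pderiv 0 φ) x‖ₑ ^ 2 +
      2 * D ^ 2 * ‖pderiv 1 (pderiv 1 φ) x‖ₑ ^ 2))
    (((measurable_enorm_sq hd0.continuous).const_mul _).add
      (((measurable_enorm_sq hc01).const_mul _).add ((measurable_enorm_sq hc11).const_mul _)))
    (fun s hs => by
      have hsR := ha.trans hs.1
      have hDs := ofReal_two_mul_le hH ha hs
      set d := ENNReal.ofReal (2 * H s) with hd
      set p : Plane := sideCurve H σ s with hp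
      have hmem := mem_Icc_of_sign hH hσ hsR
      have h1 := lintegral_slice_le (hasDerivAt_vertical hd1 s) (continuous_vertical hc11 s) hmem
      have h2 := enorm_sq_le_lintegral_slice (hasDerivAt_vertical hd0 s)
        (continuous_vertical hc01 s) hmem
      change _ ≤ d * (2 * ‖pderiv 1 φ p‖ₑ ^ 2) + _ at h1
      change d * ‖pderiv 0 φ p‖ₑ ^ 2 ≤ _ at h2
      have h3 : ‖pderiv 1 φ p‖ₑ ^ 2 ≤ 2 * ‖pderiv 1 φ p -
          ((σ * deriv H s : ℝ) : ℂ) * pderiv 0 φ p‖ₑ ^ 2 + 2 * ‖pderiv 0 φ p‖ₑ ^ 2 := by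
        have e : pderiv 1 φ p = (pderiv 1 φ p - ((σ * deriv H s : ℝ) : ℂ) * pderiv 0 φ p) +
          ((σ * deriv H s : ℝ) : ℂ) * pderiv 0 φ p := by ring
        conv_lhs => rw [e]
        refine (enorm_add_sq_le _ _).trans ?_
        gcongr 2 * _ + 2 * ?_ ^ 2
        rw [enorm_mul]
        have : ‖((σ * deriv H s : ℝ) : ℂ)‖ₑ ≤ 1 := by
          rw [← ofReal_norm, Complex.norm_real, ← ENNReal.ofReal_one]
          refine ENNReal.ofReal_le_ofReal ?_
          rw [Real.norm_eq_abs, abs_mul]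
          have := hH' s hs
          rcases hσ with rfl | rfl <;> simpa using this
        calc _ ≤ 1 * ‖pderiv 0 φ p‖ₑ := by gcongr
          _ = _ := one_mul _
      have hm0 : Measurable fun t : ℝ => ‖pderiv 0 φ !₂[s, t]‖ₑ ^ 2 :=
        ((ENNReal.continuous_pow 2).comp (continuous_vertical hd0.continuous s).enorm).measurable
      have hm1 : Measurable fun t : ℝ => ‖pderiv 1 (pderiv 0 φ) !₂[s, t]‖ₑ ^ 2 :=
        ((ENNReal.continuous_pow 2).comp (continuous_vertical hc01 s).enorm).measurable
      rw [lintegral_add_left (hm0.const_mul _), lintegral_add_left (hm1.const_mul _),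
        lintegral_const_mul' _ _ (by finiteness), lintegral_const_mul' _ _ (by finiteness),
        lintegral_const_mul' _ _ (by finiteness)]
      calc _ ≤ _ := h1
        _ ≤ d * (2 * (2 * ‖pderiv 1 φ p - ((σ * deriv H s : ℝ) : ℂ) * pderiv 0 φ p‖ₑ ^ 2 +
              2 * ‖pderiv 0 φ p‖ₑ ^ 2)) + 2 * d ^ 2 *
              ∫⁻ t in Ioo (-H s) (H s), ‖pderiv 1 (pderiv 1 φ) !₂[s, t]‖ₑ ^ 2 := by gcongr
        _ = d * 4 * ‖pderiv 1 φ p - ((σ * deriv H s : ℝ) : ℂ) * pderiv 0 φ p‖ₑ ^ 2 +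
              (4 * (d * ‖pderiv 0 φ p‖ₑ ^ 2) + 2 * d ^ 2 *
              ∫⁻ t in Ioo (-H s) (H s), ‖pderiv 1 (pderiv 1 φ) !₂[s, t]‖ₑ ^ 2) := by ring
        _ ≤ d * 4 * ‖pderiv 1 φ p - ((σ * deriv H s : ℝ) : ℂ) * pderiv 0 φ p‖ₑ ^ 2 +
              (4 * (2 * (∫⁻ t in Ioo (-H s) (H s), ‖pderiv 0 φ !₂[s, t]‖ₑ ^ 2) +
              2 * d ^ 2 * ∫⁻ t in Ioo (-H s) (H s), ‖pderiv 1 (pderiv 0 φ) !₂[s, t]‖ₑ ^ 2) +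
              2 * d ^ 2 *
              ∫⁻ t in Ioo (-H s) (H s), ‖pderiv 1 (pderiv 1 φ) !₂[s, t]‖ₑ ^ 2) := by gcongr
        _ = d * 4 * ‖pderiv 1 φ p - ((σ * deriv H s : ℝ) : ℂ) * pderiv 0 φ p‖ₑ ^ 2 +
              (8 * (∫⁻ t in Ioo (-H s) (H s), ‖pderiv 0 φ !₂[s, t]‖ₑ ^ 2) +
              (8 * d ^ 2 * (∫⁻ t in Ioo (-H s) (H s), ‖pderiv 1 (pderiv 0 φ) !₂[s, t]‖ₑ ^ 2) +
              2 * d ^ 2 *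
              ∫⁻ t in Ioo (-H s) (H s), ‖pderiv 1 (pderiv 1 φ) !₂[s, t]‖ₑ ^ 2)) := by ring
        _ ≤ _ := by gcongr)
  rwa [lintegral_const_mul' _ _ (by finiteness),
    lintegral_add_left ((measurable_enorm_sq hd0.continuous).const_mul _),
    lintegral_add_left ((measurable_enorm_sq hc01).const_mul _),
    lintegral_const_mul' _ _ (by finiteness), lintegral_const_mul' _ _ (by finiteness),
    lintegral_const_mul' _ _ (by finiteness)] at key

/-- In the peak one can move by one unit in the direction of decreasing `x₁`, so that the
longitudinal derivative is controlled without boundary conditions. -/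
lemma sqNorm_pderiv_zero_peak_le (hH : IsPeakProfile H R) (hΩ : IsPeakDomain Ω H R) {a : ℝ}
    (ha : R + 1 < a) (b : ℝ) {φ : Plane → ℂ} (hφ : ContDiff ℝ ∞ φ) :
    sqNorm ((Ω : Set Plane) ∩ strip a b) (pderiv 0 φ) ≤
      8 * sqNorm Ω φ + 2 * sqNorm Ω (pderiv 0 (pderiv 0 φ)) := by
  set w : Plane := -EuclideanSpace.single 0 (1 : ℝ) with hw
  have hneg : ∀ ψ : Plane → ℂ, dirDeriv w ψ = fun x => -pderiv 0 ψ x := fun ψ => by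
    ext x; simp [dirDeriv, pderiv, hw]
  have h := sqNorm_dirDeriv_le (w := w) (measurableSet_inter_strip (Ω := Ω) a b)
    Ω.isOpen.measurableSet (fun x hx s hs => ?_) hφ
  · have e : dirDeriv w (dirDeriv w φ) = pderiv 0 (pderiv 0 φ) := by
      rw [hneg, hneg]
      ext x
      simp only [pderiv]
      rw [fderiv_fun_neg, neg_apply, neg_neg]
      rfl
    rw [e, hneg] at h
    simpa only [sqNorm, enorm_neg] using h
  · rw [mem_inter_strip_iff hΩ (by linarith)] at hx
    have h0 : (x + s • w) 0 = x 0 - s := by simp [hw]; ring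
    have h1 : (x + s • w) 1 = x 1 := by simp [hw]
    have hx0 := hx.1.1
    have hmem : x + s • w ∈ (Ω : Set Plane) ∩ {x | R < x 0} := by
      rw [hΩ.inter_halfPlane]
      have hR : R < x 0 - s := by linarith [hs.2]
      have hanti : H (x 0) ≤ H (x 0 - s) :=
        hH.antitoneOn (mem_Ioi.2 hR) (mem_Ioi.2 (by linarith [hs.1])) (by linarith [hs.1])
      refine ⟨by rw [h0]; exact hR, ?_, ?_⟩
      · rw [h0, h1]; linarith [hx.2.1]
      · rw [h0, h1]; linarith [hx.2.2]
    exact hmem.1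

end Peak

/-! ### Arc length and normal derivative on the sides of the peak -/

section Traces

variable {Ω : TopologicalSpace.Opens Plane} {H : ℝ → ℝ} {R : ℝ}

/-- The side of the peak given by the sign `σ`. -/
def peakSide (H : ℝ → ℝ) (R σ : ℝ) : Set Plane := {x | R < x 0 ∧ x 1 = σ * H (x 0)}

/-- The projection to the `x₁`-axis does not increase the length, so that integrals with respect to
`x₁` over a side of the peak are bounded by integrals with respect to arc length. -/
lemma exists_lintegral_sideCurve_le (hH : IsPeakProfile H R) {σ : ℝ} (hσ : σ = 1 ∨ σ = -1)
    {a : ℝ} (b : ℝ) (ha : R < a) {Γ : Set Plane} (hΓ : μH[1] (peakSide H R σ \ Γ) = 0) :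
    ∃ r : ℝ, ∀ g : Plane → ℝ≥0∞, Measurable g →
      ∫⁻ s in Ioo a b, g (sideCurve H σ s) ≤ ∫⁻ x in Γ ∩ Metric.ball 0 r, g x ∂μH[1] := by
  set r : ℝ := |a| + |b| + H a + 1 with hr
  refine ⟨r, fun g hg => ?_⟩
  have hball : ∀ s ∈ Ioo a b, sideCurve H σ s ∈ Metric.ball (0 : Plane) r := by
    intro s hs
    have hsR : R < s := ha.trans hs.1
    have h1 : |s| ≤ |a| + |b| := by
      rw [abs_le]
      constructor
      · linarith [neg_abs_le a, abs_nonneg b, hs.1]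
      · linarith [le_abs_self b, abs_nonneg a, hs.2]
    have h2 : |σ * H s| ≤ H a := by
      have hp := hH.pos s hsR
      have := hH.antitoneOn (mem_Ioi.2 ha) (mem_Ioi.2 hsR) hs.1.le
      rw [abs_mul, abs_of_pos hp]
      rcases hσ with rfl | rfl <;> simpa using this
    have hA := hH.pos a ha
    rw [mem_ball_zero_iff, EuclideanSpace.norm_eq, Fin.sum_univ_two]
    have e0 : sideCurve H σ s 0 = s := rfl
    have e1 : sideCurve H σ s 1 = σ * H s := rfl
    rw [e0, e1, Real.norm_eq_abs, Real.norm_eq_abs, Real.sqrt_lt' (by positivity)]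
    nlinarith [abs_nonneg s, abs_nonneg (σ * H s), abs_nonneg a, abs_nonneg b]
  have hae := aemeasurable_sideCurve hH σ b ha.le
  rw [← lintegral_map' hg.aemeasurable hae]
  refine lintegral_mono' (Measure.le_iff.2 fun B hB => ?_) le_rfl
  rw [Measure.map_apply_of_aemeasurable hae hB, Measure.restrict_apply hB,
    Measure.restrict_apply' measurableSet_Ioo]
  have hlip : LipschitzWith 1 (fun x : Plane => x 0) :=
    LipschitzWith.of_dist_le_mul fun x y => by
      rw [NNReal.coe_one, one_mul, dist_eq_norm, dist_eq_norm, ← PiLp.sub_apply]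
      exact PiLp.norm_apply_le _ 0
  have hsub : sideCurve H σ ⁻¹' B ∩ Ioo a b ⊆
      (fun x : Plane => x 0) '' (B ∩ (peakSide H R σ ∩ Metric.ball 0 r)) := by
    rintro s ⟨hsB, hs⟩
    exact ⟨sideCurve H σ s, ⟨hsB, ⟨ha.trans hs.1, rfl⟩, hball s hs⟩, rfl⟩
  calc volume (sideCurve H σ ⁻¹' B ∩ Ioo a b)
      ≤ volume ((fun x : Plane => x 0) '' (B ∩ (peakSide H R σ ∩ Metric.ball 0 r))) :=
        measure_mono hsub
    _ = μH[1] ((fun x : Plane => x 0) '' (B ∩ (peakSide H R σ ∩ Metric.ball 0 r))) := by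
        rw [hausdorffMeasure_real]
    _ ≤ μH[1] (B ∩ (peakSide H R σ ∩ Metric.ball 0 r)) := by
        have := hlip.hausdorffMeasure_image_le zero_le_one
          (B ∩ (peakSide H R σ ∩ Metric.ball 0 r))
        simpa using this
    _ ≤ μH[1] (B ∩ (Γ ∩ Metric.ball 0 r) ∪ peakSide H R σ \ Γ) := by
        refine measure_mono ?_
        rintro x ⟨hxB, hxs, hxb⟩
        by_cases hx : x ∈ Γ
        · exact Or.inl ⟨hxB, hx, hxb⟩
        · exact Or.inr ⟨hxs, hx⟩
    _ ≤ μH[1] (B ∩ (Γ ∩ Metric.ball 0 r)) + μH[1] (peakSide H R σ \ Γ) := measure_union_le _ _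
    _ = _ := by rw [hΓ, add_zero]

lemma sideCurve_mem_frontier (hH : IsPeakProfile H R) (hΩ : IsPeakDomain Ω H R) {σ : ℝ}
    (hσ : σ = 1 ∨ σ = -1) {s : ℝ} (hs : R < s) :
    sideCurve H σ s ∈ frontier (Ω : Set Plane) := by
  have hp := hH.pos s hs
  rw [Ω.isOpen.frontier_eq]
  refine ⟨?_, fun hmem => ?_⟩
  · -- approximation by the points `(s, σ t H(s))` with `t < 1`
    have hc : Continuous fun t : ℝ => (!₂[s, t * (σ * H s)] : Plane) :=
      continuous_pair.comp (continuous_const.prodMk (by fun_prop))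
    have hlim : Tendsto (fun t : ℝ => (!₂[s, t * (σ * H s)] : Plane)) (𝓝[Ioo 0 1] 1)
        (𝓝 (sideCurve H σ s)) := by
      have := hc.tendsto 1
      rw [one_mul] at this
      exact this.mono_left nhdsWithin_le_nhds
    have hne : (𝓝[Ioo (0 : ℝ) 1] 1).NeBot := by
      rw [← mem_closure_iff_nhdsWithin_neBot, closure_Ioo zero_ne_one]
      exact right_mem_Icc.2 zero_le_one
    refine mem_closure_of_tendsto hlim ?_
    filter_upwards [self_mem_nhdsWithin] with t ht
    have h3 : (!₂[s, t * (σ * H s)] : Plane) ∈ peak H R := by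
      have h1 : t * H s < H s := by nlinarith [ht.2]
      have h2 : 0 < t * H s := mul_pos ht.1 hp
      refine ⟨hs, ?_, ?_⟩
      · change -H s < t * (σ * H s)
        rcases hσ with rfl | rfl <;> nlinarith
      · change t * (σ * H s) < H s
        rcases hσ with rfl | rfl <;> nlinarith
    rw [← hΩ.inter_halfPlane] at h3
    exact h3.1
  · have h3 : sideCurve H σ s ∈ (Ω : Set Plane) ∩ {x | R < x 0} := ⟨hmem, hs⟩
    rw [hΩ.inter_halfPlane] at h3
    have h4 : -H s < σ * H s ∧ σ * H s < H s := h3.2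
    rcases hσ with rfl | rfl <;> linarith [h4.1, h4.2]

/-- The normal to a side of the peak is a unit vector orthogonal to the tangent
`(1, σ H'(s))`. -/
lemma outwardNormal_sideCurve (hH : IsPeakProfile H R) (hΩ : IsPeakDomain Ω H R) {σ : ℝ}
    (hσ : σ = 1 ∨ σ = -1) {s : ℝ} (hs : R < s) :
    outwardNormal Ω (sideCurve H σ s) 0 =
        -(σ * deriv H s) * outwardNormal Ω (sideCurve H σ s) 1 ∧
      outwardNormal Ω (sideCurve H σ s) 0 ^ 2 + outwardNormal Ω (sideCurve H σ s) 1 ^ 2 = 1 := by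
  set p := sideCurve H σ s with hp
  obtain ⟨ρ, hρ⟩ := hΩ.smoothBoundary p (sideCurve_mem_frontier hH hΩ hσ hs)
  have hn : ‖∇ ρ p‖ ≠ 0 := norm_ne_zero_iff.2 hρ.gradient_ne_zero
  rw [hρ.outwardNormal_eq]
  -- a defining function vanishes along the curve
  have hzero : (fun t => ρ (sideCurve H σ t)) =ᶠ[𝓝 s] fun _ => 0 := by
    have hcont : ContinuousAt (sideCurve H σ) s :=
      (continuousOn_sideCurve hH σ).continuousAt (Ioi_mem_nhds hs)
    filter_upwards [hcont.eventually hρ.eventually, Ioi_mem_nhds hs] with t ht htR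
    exact (ht (sideCurve_mem_frontier hH hΩ hσ htR)).val_eq_zero
  have hcurve : HasDerivAt (sideCurve H σ) !₂[1, σ * deriv H s] s := by
    have h1 : HasDerivAt (fun t => ![t, σ * H t]) ![1, σ * deriv H s] s := by
      rw [hasDerivAt_pi]
      intro i
      fin_cases i
      · exact hasDerivAt_id s
      · exact ((hH.differentiableAt hs).hasDerivAt).const_mul σ
    exact (PiLp.continuousLinearEquiv 2 ℝ (fun _ : Fin 2 => ℝ)).symm.hasFDerivAt.comp_hasDerivAt
      s h1
  have hgrad : HasGradientAt ρ (∇ ρ p) p := (hρ.contDiff.differentiable (by simp) p).hasGradientAt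
  have hder := hgrad.hasFDerivAt.comp_hasDerivAt s hcurve
  rw [InnerProductSpace.toDual_apply_apply] at hder
  have hin : inner ℝ (∇ ρ p) (!₂[1, σ * deriv H s] : Plane) = 0 :=
    hder.unique ((hasDerivAt_const s (0 : ℝ)).congr_of_eventuallyEq hzero)
  rw [PiLp.inner_apply, Fin.sum_univ_two] at hin
  simp only [RCLike.inner_apply, conj_trivial] at hin
  have hin' : 1 * (∇ ρ p) 0 + (σ * deriv H s) * (∇ ρ p) 1 = 0 := hin
  constructor
  · simp only [PiLp.smul_apply, smul_eq_mul]
    linear_combination ‖∇ ρ p‖⁻¹ * hin'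
  · have h1 : ‖∇ ρ p‖ ^ 2 = (∇ ρ p) 0 ^ 2 + (∇ ρ p) 1 ^ 2 := by
      rw [EuclideanSpace.norm_sq_eq, Fin.sum_univ_two, Real.norm_eq_abs, Real.norm_eq_abs, sq_abs,
        sq_abs]
    simp only [PiLp.smul_apply, smul_eq_mul]
    field_simp
    linarith

/-- The normal derivative on a side is `n₂ (∂₂φ - σ H' ∂₁φ)`, where `2 n₂² ≥ 1` if `|H'| ≤ 1`. -/
lemma enorm_sq_le_normalDeriv (hH : IsPeakProfile H R) (hΩ : IsPeakDomain Ω H R) {σ : ℝ}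
    (hσ : σ = 1 ∨ σ = -1) {s : ℝ} (hs : R < s) (hs' : |deriv H s| ≤ 1) (φ : Plane → ℂ) :
    ‖pderiv 1 φ (sideCurve H σ s) -
      ((σ * deriv H s : ℝ) : ℂ) * pderiv 0 φ (sideCurve H σ s)‖ₑ ^ 2 ≤
        2 * ‖normalDeriv Ω φ (sideCurve H σ s)‖ₑ ^ 2 := by
  obtain ⟨h1, h2⟩ := outwardNormal_sideCurve hH hΩ hσ hs
  set p := sideCurve H σ s
  set n := outwardNormal Ω p
  set X := pderiv 1 φ p - ((σ * deriv H s : ℝ) : ℂ) * pderiv 0 φ p with hX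
  have e : normalDeriv Ω φ p = ((n 1 : ℝ) : ℂ) * X := by
    have := congrFun (dirDeriv_eq_sum n φ) p
    change fderiv ℝ φ p n = _
    rw [dirDeriv] at this
    rw [this, h1, hX]
    push_cast
    ring
  have hn : 1 ≤ 2 * (n 1) ^ 2 := by
    rw [h1] at h2
    have h3 : (σ * deriv H s) ^ 2 ≤ 1 := by
      have : σ ^ 2 = 1 := by rcases hσ with rfl | rfl <;> norm_num
      rw [mul_pow, this, one_mul, ← sq_abs]
      nlinarith [abs_nonneg (deriv H s)]
    nlinarith [mul_le_mul_of_nonneg_right h3 (sq_nonneg (n 1))]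
  rw [e, enorm_mul, mul_pow, ← mul_assoc]
  have h4 : (1 : ℝ≥0∞) ≤ 2 * ‖((n 1 : ℝ) : ℂ)‖ₑ ^ 2 := by
    rw [← ofReal_norm, Complex.norm_real, ← ENNReal.ofReal_pow (norm_nonneg _), Real.norm_eq_abs,
      sq_abs]
    calc (1 : ℝ≥0∞) = ENNReal.ofReal 1 := by simp
      _ ≤ ENNReal.ofReal (2 * n 1 ^ 2) := ENNReal.ofReal_le_ofReal hn
      _ = _ := by rw [ENNReal.ofReal_mul (by norm_num)]; simp
  calc ‖X‖ₑ ^ 2 = 1 * ‖X‖ₑ ^ 2 := (one_mul _).symm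
    _ ≤ _ := by gcongr

end Traces

/-! ### The bounded part of the domain and the tail -/

section Bounded

variable {Ω : TopologicalSpace.Opens Plane} {H : ℝ → ℝ} {R : ℝ}

/-- The bound on `H''` excludes that `H` is unbounded near `R`. -/
lemma IsPeakProfile.exists_bound (hH : IsPeakProfile H R) : ∃ M, ∀ y ∈ Ioi R, H y ≤ M := by
  obtain ⟨C, hC⟩ := hH.deriv2_bounded
  set c := R + 1 with hc
  have hcR : R < c := by linarith
  have hC0 : 0 ≤ C := (abs_nonneg _).trans (hC c hcR)
  have hd : ∀ y ∈ Ioc R c, DifferentiableAt ℝ (deriv H) y := fun y hy => by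
    have h1 : ContDiffOn ℝ ∞ (deriv H) (Ioi R) :=
      hH.contDiffOn.deriv_of_isOpen isOpen_Ioi (by simp)
    exact (h1.contDiffAt (Ioi_mem_nhds hy.1)).differentiableAt (by simp)
  have h1 : ∀ y ∈ Ioc R c, |deriv H y| ≤ |deriv H c| + C := by
    intro y hy
    have := (convex_Ioc R c).norm_image_sub_le_of_norm_deriv_le hd
      (fun x hx => hC x hx.1) (right_mem_Ioc.2 hcR) hy
    rw [Real.norm_eq_abs, Real.norm_eq_abs] at this
    have h2 : |y - c| ≤ 1 := by rw [abs_le]; constructor <;> linarith [hy.1, hy.2]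
    have h3 : |deriv H y| ≤ |deriv H c| + |deriv H y - deriv H c| := by
      calc |deriv H y| = |deriv H c + (deriv H y - deriv H c)| := by rw [add_sub_cancel]
        _ ≤ _ := abs_add_le _ _
    nlinarith
  set C' := |deriv H c| + C with hC'
  have hC'0 : 0 ≤ C' := by positivity
  refine ⟨H c + C', fun y hy => ?_⟩
  rcases le_or_gt y c with hyc | hyc
  · have := (convex_Ioc R c).norm_image_sub_le_of_norm_deriv_le
      (fun x hx => hH.differentiableAt hx.1) h1 (right_mem_Ioc.2 hcR) ⟨hy, hyc⟩
    rw [Real.norm_eq_abs, Real.norm_eq_abs] at this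
    have hy' : R < y := hy
    have h2 : |y - c| ≤ 1 := by rw [abs_le]; constructor <;> linarith
    have h3 := le_abs_self (H y - H c)
    nlinarith
  · have := hH.antitoneOn (mem_Ioi.2 hcR) hy hyc.le
    linarith

lemma isCompact_closure_inter_le (hH : IsPeakProfile H R) (hΩ : IsPeakDomain Ω H R) (a : ℝ) :
    IsCompact (closure ((Ω : Set Plane) ∩ {x | x 0 ≤ a})) := by
  obtain ⟨M, hM⟩ := hH.exists_bound
  refine Bornology.IsBounded.isCompact_closure ?_
  have h1 : Bornology.IsBounded (peak H R ∩ {x | x 0 ≤ a}) := by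
    refine (Metric.isBounded_closedBall (x := (0 : Plane)) (r := |R| + |a| + |M|)).subset ?_
    rintro x ⟨⟨h0, h2, h3⟩, h4⟩
    have h4 : x 0 ≤ a := h4
    have h5 := hM (x 0) h0
    have h6 : |x 0| ≤ |R| + |a| := by
      rw [abs_le]
      constructor
      · linarith [neg_abs_le R, abs_nonneg a]
      · linarith [le_abs_self a, abs_nonneg R]
    have h7 : |x 1| ≤ |M| := by
      rw [abs_le]
      constructor <;> linarith [le_abs_self M]
    rw [mem_closedBall_zero_iff, EuclideanSpace.norm_eq, Fin.sum_univ_two, Real.norm_eq_abs,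
      Real.norm_eq_abs, Real.sqrt_le_left (by positivity)]
    nlinarith [abs_nonneg (x 0), abs_nonneg (x 1), abs_nonneg R, abs_nonneg a, abs_nonneg M]
  refine (hΩ.isBounded.union h1).subset ?_
  rintro x ⟨hx, hxa⟩
  rcases le_or_gt (x 0) R with h | h
  · exact Or.inl ⟨hx, h⟩
  · refine Or.inr ⟨?_, hxa⟩
    rw [← hΩ.inter_halfPlane]
    exact ⟨hx, h⟩

/-- A bound on all the bounded pieces of the tail gives a bound on the whole domain. -/
lemma sqNorm_le_of_tail {a : ℝ} {f : Plane → ℂ} {A B : ℝ≥0∞}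
    (hA : sqNorm ((Ω : Set Plane) ∩ closure ((Ω : Set Plane) ∩ {x | x 0 ≤ a})) f ≤ A)
    (hB : ∀ b, sqNorm ((Ω : Set Plane) ∩ strip a b) f ≤ B) : sqNorm Ω f ≤ A + B := by
  have hcover : (Ω : Set Plane) ⊆ ((Ω : Set Plane) ∩ closure ((Ω : Set Plane) ∩ {x | x 0 ≤ a})) ∪
      ⋃ n : ℕ, ((Ω : Set Plane) ∩ strip a n) := by
    intro x hx
    rcases le_or_gt (x 0) a with h | h
    · exact Or.inl ⟨hx, subset_closure ⟨hx, h⟩⟩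
    · obtain ⟨n, hn⟩ := exists_nat_gt (x 0)
      exact Or.inr (mem_iUnion.2 ⟨n, hx, h, hn⟩)
  refine (sqNorm_mono hcover f).trans ((sqNorm_union_le _ _ _).trans (add_le_add hA ?_))
  have hmono : Monotone fun n : ℕ => (Ω : Set Plane) ∩ strip a n := by
    rintro m n hmn x ⟨hx, h1, h2⟩
    exact ⟨hx, h1, h2.trans_le (Nat.cast_le.2 hmn)⟩
  rw [sqNorm, setLIntegral_iUnion_of_directed _ hmono.directed_le]
  exact iSup_le fun n => hB n

end Bounded

/-! ### Approximation by smooth functions -/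

section Approximation

variable {Ω : TopologicalSpace.Opens Plane}

lemma le_of_forall_le_add_mul {X Y K : ℝ≥0∞} (hK : K ≠ ⊤)
    (h : ∀ ε : ℝ≥0∞, ε ≠ 0 → ε ≠ ⊤ → X ≤ Y + K * ε) : X ≤ Y := by
  have hlim : Tendsto (fun ε : ℝ≥0∞ => Y + K * ε) (𝓝[≠] 0) (𝓝 (Y + K * 0)) :=
    ((ENNReal.Tendsto.const_mul tendsto_id (Or.inr hK)).const_add Y).mono_left nhdsWithin_le_nhds
  rw [mul_zero, add_zero] at hlim
  refine ge_of_tendsto hlim ?_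
  filter_upwards [self_mem_nhdsWithin,
    mem_nhdsWithin_of_mem_nhds (gt_mem_nhds ENNReal.zero_lt_top)] with ε h1 h2
  exact h ε h1 h2.ne

lemma eLpNorm_two_sq {α : Type*} [MeasurableSpace α] {μ : Measure α} (f : α → ℂ) :
    eLpNorm f 2 μ ^ 2 = ∫⁻ x, ‖f x‖ₑ ^ 2 ∂μ := by
  have := eLpNorm_nnreal_pow_eq_lintegral (f := f) (μ := μ) (p := 2) (by norm_num)
  simpa using this

/-- The smooth function `φ` is `ε`-close to `u` in `H²(Ω)`, with respect to the squares of the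
norms. -/
structure IsCloseH2 (φ : Plane → ℂ) (u : L2 Ω) (ε : ℝ≥0∞) : Prop where
  contDiff : ContDiff ℝ ∞ φ
  hasCompactSupport : HasCompactSupport φ
  fn : sqNorm Ω (fun x => φ x - u x) ≤ ε
  grad : ∀ i, sqNorm Ω (fun x => pderiv i φ x - weakDeriv i u x) ≤ ε
  hess : ∀ i j, sqNorm Ω (fun x => pderiv j (pderiv i φ) x - weakDeriv j (weakDeriv i u) x) ≤ ε

/-- Functions with a vanishing trace have smooth approximations with a small trace on any bounded
part of the boundary. -/
lemma TraceEqZero.exists_isCloseH2 {B : (Plane → ℂ) → Plane → ℂ} {Γ : Set Plane} {u : L2 Ω}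
    (h : TraceEqZero B Γ u) {ε : ℝ≥0∞} (hε : ε ≠ 0) (r : ℝ) :
    ∃ φ, IsCloseH2 φ u ε ∧ ∫⁻ x in Γ ∩ Metric.ball 0 r, ‖B φ x‖ₑ ^ 2 ∂μH[1] ≤ ε := by
  obtain ⟨φ, h1, h2, h3, h4⟩ := h (min ε 1) (lt_min (pos_iff_ne_zero.2 hε) one_pos) r
  have key : ∀ {a : ℝ≥0∞}, a ≤ min ε 1 → a ^ 2 ≤ ε := by
    intro a ha
    calc a ^ 2 = a * a := sq a
      _ ≤ ε * 1 := by
        gcongr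
        · exact ha.trans (min_le_left _ _)
        · exact ha.trans (min_le_right _ _)
      _ = ε := mul_one ε
  unfold distH2 at h3
  refine ⟨φ, ⟨h1, h2, ?_, fun i => ?_, fun i j => ?_⟩, ?_⟩
  · rw [sqNorm, ← eLpNorm_two_sq]
    exact key (le_trans (by rw [add_assoc]; exact le_self_add) h3.le)
  · rw [sqNorm, ← eLpNorm_two_sq]
    refine key (le_trans ?_ h3.le)
    refine le_trans ?_ (le_self_add : _ ≤ _ + _)
    refine le_trans ?_ (le_add_self : _ ≤ _ + _)
    exact Finset.single_le_sum (f := fun i => eLpNorm (fun x => pderiv i φ x - weakDeriv i u x) 2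
      (volume.restrict (Ω : Set Plane))) (fun _ _ => zero_le) (Finset.mem_univ i)
  · rw [sqNorm, ← eLpNorm_two_sq]
    refine key (le_trans ?_ h3.le)
    refine le_trans ?_ (le_add_self : _ ≤ _ + _)
    refine le_trans ?_ (Finset.single_le_sum (f := fun i => ∑ j : Fin 2,
      eLpNorm (fun x => pderiv j (pderiv i φ) x - weakDeriv j (weakDeriv i u) x) 2
        (volume.restrict (Ω : Set Plane))) (fun _ _ => zero_le) (Finset.mem_univ i))
    exact Finset.single_le_sum (f := fun j =>
      eLpNorm (fun x => pderiv j (pderiv i φ) x - weakDeriv j (weakDeriv i u) x) 2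
        (volume.restrict (Ω : Set Plane))) (fun _ _ => zero_le) (Finset.mem_univ j)
  · rw [← eLpNorm_two_sq]
    exact key h4.le

lemma sqNorm_le_of_close {f : Plane → ℂ} (hf : Continuous f) (w : L2 Ω) {S : Set Plane}
    (hS : S ⊆ Ω) {ε : ℝ≥0∞} (h : sqNorm Ω (fun x => f x - w x) ≤ ε) :
    sqNorm S f ≤ 2 * sqNorm S w + 2 * ε ∧ sqNorm S w ≤ 2 * sqNorm S f + 2 * ε := by
  have hm : AEStronglyMeasurable w (volume.restrict S) :=
    (Lp.aestronglyMeasurable w).mono_measure (Measure.restrict_mono hS le_rfl)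
  have h' := (sqNorm_mono hS _).trans h
  constructor
  · calc sqNorm S f = sqNorm S (fun x => w x + (f x - w x)) := by congr 1; ext x; ring
      _ ≤ _ := sqNorm_add_le _ hm
      _ ≤ _ := by gcongr
  · calc sqNorm S w = sqNorm S (fun x => f x + -(f x - w x)) := by congr 1; ext x; ring
      _ ≤ 2 * sqNorm S f + 2 * sqNorm S (fun x => -(f x - w x)) :=
        sqNorm_add_le _ hf.aestronglyMeasurable
      _ ≤ _ := by
        simp only [sqNorm, enorm_neg] at h' ⊢
        gcongr

/-- The square of the norm of `u` in `L²(Ω)` plus the square of the norm of its Hessian. -/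
noncomputable def sqEnergy (u : L2 Ω) : ℝ≥0∞ :=
  sqNorm Ω u + ∑ i : Fin 2, ∑ j : Fin 2, sqNorm Ω (weakDeriv j (weakDeriv i u))

variable {φ : Plane → ℂ} {u : L2 Ω} {ε : ℝ≥0∞} {S : Set Plane}

lemma IsCloseH2.le_fn (h : IsCloseH2 φ u ε) (hS : S ⊆ Ω) :
    sqNorm S u ≤ 2 * sqNorm S φ + 2 * ε :=
  (sqNorm_le_of_close h.contDiff.continuous u hS h.fn).2

lemma IsCloseH2.le_grad (h : IsCloseH2 φ u ε) (hS : S ⊆ Ω) (i : Fin 2) :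
    sqNorm S (weakDeriv i u) ≤ 2 * sqNorm S (pderiv i φ) + 2 * ε :=
  (sqNorm_le_of_close (continuous_pderiv i h.contDiff) _ hS (h.grad i)).2

lemma IsCloseH2.grad_le (h : IsCloseH2 φ u ε) (hS : S ⊆ Ω) (i : Fin 2) :
    sqNorm S (pderiv i φ) ≤ 2 * sqNorm S (weakDeriv i u) + 2 * ε :=
  (sqNorm_le_of_close (continuous_pderiv i h.contDiff) _ hS (h.grad i)).1

lemma IsCloseH2.energy_le (h : IsCloseH2 φ u ε) :
    sqNorm Ω φ + sqHess Ω φ ≤ 2 * sqEnergy u + 10 * ε := by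
  have h0 := (sqNorm_le_of_close h.contDiff.continuous u subset_rfl h.fn).1
  have h2 : ∀ i j, sqNorm Ω (pderiv j (pderiv i φ)) ≤
      2 * sqNorm Ω (weakDeriv j (weakDeriv i u)) + 2 * ε := fun i j =>
    (sqNorm_le_of_close (continuous_pderiv j (contDiff_pderiv i h.contDiff)) _ subset_rfl
      (h.hess i j)).1
  calc _ ≤ (2 * sqNorm Ω u + 2 * ε) + ∑ i : Fin 2, ∑ j : Fin 2,
        (2 * sqNorm Ω (weakDeriv j (weakDeriv i u)) + 2 * ε) :=
        add_le_add h0 (Finset.sum_le_sum fun i _ => Finset.sum_le_sum fun j _ => h2 i j)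
    _ = _ := by
        simp only [sqEnergy, Fin.sum_univ_two]; ring

lemma IsCloseH2.sqGrad_le (h : IsCloseH2 φ u ε) :
    sqGrad Ω φ ≤ 2 * (∑ i : Fin 2, sqNorm Ω (weakDeriv i u)) + 4 * ε := by
  calc _ ≤ ∑ i : Fin 2, (2 * sqNorm Ω (weakDeriv i u) + 2 * ε) :=
        Finset.sum_le_sum fun i _ => h.grad_le subset_rfl i
    _ = _ := by simp only [Fin.sum_univ_two]; ring

lemma sqNorm_le_sqHess (S : Set Plane) (i j : Fin 2) :
    sqNorm S (pderiv j (pderiv i φ)) ≤ sqHess S φ :=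
  (Finset.single_le_sum (f := fun j => sqNorm S (pderiv j (pderiv i φ)))
    (fun _ _ => zero_le) (Finset.mem_univ j)).trans
  (Finset.single_le_sum (f := fun i => ∑ j : Fin 2, sqNorm S (pderiv j (pderiv i φ)))
    (fun _ _ => zero_le) (Finset.mem_univ i))

lemma sqNorm_hess_le (hS : S ⊆ Ω) (i j : Fin 2) :
    sqNorm S (pderiv j (pderiv i φ)) ≤ sqNorm Ω φ + sqHess Ω φ :=
  ((sqNorm_mono hS _).trans (sqNorm_le_sqHess _ i j)).trans le_add_self

end Approximation

/-! ### Gradient bound and Ehrling inequality in the energy space -/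

section Estimates

variable {Ω : TopologicalSpace.Opens Plane} {H : ℝ → ℝ} {R : ℝ} {ΓD ΓM : Set Plane}

/-- The boundary conditions on the sides of the peak: `u = 0` on both sides, or `u = ∂ₙu = 0` on one
of them. -/
def IsClampedPeak (H : ℝ → ℝ) (R : ℝ) (ΓD ΓM : Set Plane) : Prop :=
  (∀ σ : ℝ, σ = 1 ∨ σ = -1 → μH[1] (peakSide H R σ \ (ΓD ∪ ΓM)) = 0) ∨
    ∃ σ : ℝ, (σ = 1 ∨ σ = -1) ∧ μH[1] (peakSide H R σ \ ΓD) = 0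

lemma IsClampedPeak.exists_side (h : IsClampedPeak H R ΓD ΓM) :
    ∃ σ : ℝ, (σ = 1 ∨ σ = -1) ∧ μH[1] (peakSide H R σ \ (ΓD ∪ ΓM)) = 0 := by
  rcases h with h | ⟨σ, hσ, h⟩
  · exact ⟨1, Or.inl rfl, h 1 (Or.inl rfl)⟩
  · exact ⟨σ, hσ, measure_mono_null (sdiff_subset_sdiff_right subset_union_left) h⟩

/-- The Friedrichs inequality in the tail of the peak. -/
lemma sqNorm_tail_le (hH : IsPeakProfile H R) (hΩ : IsPeakDomain Ω H R)
    (hbc : IsClampedPeak H R ΓD ΓM) {a : ℝ} (ha : R < a) (b : ℝ) {u : L2 Ω}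
    (hu : MemEnergySpace ΓD ΓM u) :
    sqNorm ((Ω : Set Plane) ∩ strip a b) u ≤
      8 * ENNReal.ofReal (2 * H a) ^ 2 * sqNorm Ω (weakDeriv 1 u) := by
  obtain ⟨σ, hσ, hnull⟩ := hbc.exists_side
  obtain ⟨r, hr⟩ := exists_lintegral_sideCurve_le hH hσ b ha hnull
  set D := ENNReal.ofReal (2 * H a) with hD
  have hDt : D ≠ ⊤ := ENNReal.ofReal_ne_top
  refine le_of_forall_le_add_mul (K := 4 * D + 8 * D ^ 2 + 2) (by finiteness) fun ε hε _ => ?_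
  obtain ⟨φ, hφ, htr⟩ := hu.trace_eq_zero.exists_isCloseH2 hε r
  have hside : sqSide H σ a b φ ≤ ε :=
    (hr _ (measurable_enorm_sq hφ.contDiff.continuous)).trans htr
  calc _ ≤ 2 * sqNorm ((Ω : Set Plane) ∩ strip a b) φ + 2 * ε := hφ.le_fn inter_subset_left
    _ ≤ 2 * (D * 2 * ε + 2 * D ^ 2 * (2 * sqNorm Ω (weakDeriv 1 u) + 2 * ε)) + 2 * ε := by
        gcongr
        refine (sqNorm_peak_le hH hΩ hσ ha hφ.contDiff).trans ?_
        gcongr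
        exact (sqNorm_mono inter_subset_left _).trans (hφ.grad_le subset_rfl 1)
    _ = _ := by ring

/-- The longitudinal derivative in the tail needs no boundary condition. -/
lemma sqNorm_weakDeriv_zero_tail_le (hH : IsPeakProfile H R) (hΩ : IsPeakDomain Ω H R)
    {a : ℝ} (ha : R + 1 < a) (b : ℝ) {u : L2 Ω} (hu : MemEnergySpace ΓD ΓM u) :
    sqNorm ((Ω : Set Plane) ∩ strip a b) (weakDeriv 0 u) ≤ 40 * sqEnergy u := by
  refine le_of_forall_le_add_mul (K := 202) (by finiteness) fun ε hε _ => ?_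
  obtain ⟨φ, hφ, -⟩ := hu.trace_eq_zero.exists_isCloseH2 hε 0
  calc _ ≤ 2 * sqNorm ((Ω : Set Plane) ∩ strip a b) (pderiv 0 φ) + 2 * ε :=
        hφ.le_grad inter_subset_left 0
    _ ≤ 2 * (8 * (sqNorm Ω φ + sqHess Ω φ) + 2 * (sqNorm Ω φ + sqHess Ω φ)) + 2 * ε := by
        gcongr
        refine (sqNorm_pderiv_zero_peak_le hH hΩ ha b hφ.contDiff).trans ?_
        gcongr
        · exact le_self_add
        · exact sqNorm_hess_le subset_rfl 0 0
    _ = 20 * (sqNorm Ω φ + sqHess Ω φ) + 2 * ε := by ring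
    _ ≤ 20 * (2 * sqEnergy u + 10 * ε) + 2 * ε := by
        gcongr 20 * ?_ + _
        exact hφ.energy_le
    _ = _ := by ring

/-- The transverse derivative in the tail. The factor `(H b)⁻¹` in the case of two supported sides
multiplies only the trace of the approximating function, so that it is harmless for fixed `b`. -/
lemma sqNorm_weakDeriv_one_tail_le (hH : IsPeakProfile H R) (hΩ : IsPeakDomain Ω H R)
    (hbc : IsClampedPeak H R ΓD ΓM) {a : ℝ} (ha : R + 1 < a)
    (hH' : ∀ s, a < s → |deriv H s| ≤ 1) (b : ℝ) {u : L2 Ω} (hu : MemEnergySpace ΓD ΓM u) :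
    sqNorm ((Ω : Set Plane) ∩ strip a b) (weakDeriv 1 u) ≤
      4 * (80 + 10 * ENNReal.ofReal (2 * H a) ^ 2) * sqEnergy u := by
  have haR : R < a := by linarith
  set D := ENNReal.ofReal (2 * H a) with hD
  have hDt : D ≠ ⊤ := ENNReal.ofReal_ne_top
  set P := (Ω : Set Plane) ∩ strip a b with hP
  have hPΩ : P ⊆ Ω := inter_subset_left
  rcases le_or_gt b a with hba | hab
  · have : P = ∅ := by
      refine eq_empty_of_forall_notMem fun x hx => ?_
      have := hx.2.1.trans hx.2.2
      linarith
    rw [this, sqNorm]; simp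
  rcases hbc with hbc | ⟨σ, hσ, hnull⟩
  · obtain ⟨r, hr⟩ := exists_lintegral_sideCurve_le hH (Or.inl rfl) b haR (hbc 1 (Or.inl rfl))
    obtain ⟨r', hr'⟩ := exists_lintegral_sideCurve_le hH (Or.inr rfl) b haR (hbc (-1) (Or.inr rfl))
    set D' := (ENNReal.ofReal (2 * H b))⁻¹ with hD'
    have hD't : D' ≠ ⊤ := by
      have := hH.pos b (haR.trans hab)
      exact ENNReal.inv_ne_top.2 (ENNReal.ofReal_pos.2 (by positivity)).ne'
    refine le_of_forall_le_add_mul (K := 16 * D' + 40 * D ^ 2 + 2) (by finiteness)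
      fun ε hε _ => ?_
    obtain ⟨φ, hφ, htr⟩ := hu.trace_eq_zero.exists_isCloseH2 hε (max r r')
    have hball : ∀ ρ ≤ max r r', ∀ σ, (∀ g : Plane → ℝ≥0∞, Measurable g →
        ∫⁻ s in Ioo a b, g (sideCurve H σ s) ≤
          ∫⁻ x in (ΓD ∪ ΓM) ∩ Metric.ball 0 ρ, g x ∂μH[1]) → sqSide H σ a b φ ≤ ε := by
      intro ρ hρ σ h
      refine (h _ (measurable_enorm_sq hφ.contDiff.continuous)).trans (le_trans ?_ htr)
      exact lintegral_mono_set (inter_subset_inter_right _ (Metric.ball_subset_ball hρ))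
    have h1 := hball r (le_max_left _ _) 1 hr
    have h2 := hball r' (le_max_right _ _) (-1) hr'
    calc _ ≤ 2 * sqNorm P (pderiv 1 φ) + 2 * ε := hφ.le_grad hPΩ 1
      _ ≤ 2 * (D' * 4 * (ε + ε) + 2 * D ^ 2 * (2 * sqEnergy u + 10 * ε)) + 2 * ε := by
          gcongr
          refine (sqNorm_pderiv_peak_le_of_ends hH hΩ haR hφ.contDiff).trans ?_
          gcongr
          exact (sqNorm_hess_le hPΩ 1 1).trans hφ.energy_le
      _ = 8 * D ^ 2 * sqEnergy u + (16 * D' + 40 * D ^ 2 + 2) * ε := by ring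
      _ ≤ _ := by
          gcongr ?_ * sqEnergy u + _
          calc 8 * D ^ 2 ≤ 8 * D ^ 2 + (32 * D ^ 2 + 320) := le_self_add
            _ = _ := by ring
  · obtain ⟨r, hr⟩ := exists_lintegral_sideCurve_le hH hσ b haR hnull
    refine le_of_forall_le_add_mul (K := 16 * D + 20 * (80 + 10 * D ^ 2) + 2) (by finiteness)
      fun ε hε _ => ?_
    obtain ⟨φ, hφ, htr⟩ := hu.normal_eq_zero.exists_isCloseH2 hε r
    have hside : ∫⁻ s in Ioo a b, ‖pderiv 1 φ (sideCurve H σ s) -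
        ((σ * deriv H s : ℝ) : ℂ) * pderiv 0 φ (sideCurve H σ s)‖ₑ ^ 2 ≤ 2 * ε := by
      calc _ ≤ ∫⁻ s in Ioo a b, 2 * ‖normalDeriv Ω φ (sideCurve H σ s)‖ₑ ^ 2 :=
            setLIntegral_mono' measurableSet_Ioo fun s hs =>
              enorm_sq_le_normalDeriv hH hΩ hσ (haR.trans hs.1) (hH' s hs.1) φ
        _ = 2 * ∫⁻ s in Ioo a b, ‖normalDeriv Ω φ (sideCurve H σ s)‖ₑ ^ 2 :=
            lintegral_const_mul' _ _ (by simp)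
        _ ≤ _ := by
            gcongr
            exact (hr (fun x => ‖normalDeriv Ω φ x‖ₑ ^ 2)
              ((measurable_normalDeriv hφ.contDiff).enorm.pow_const 2)).trans htr
    set E := sqNorm Ω φ + sqHess Ω φ with hE
    have h0 : sqNorm P (pderiv 0 φ) ≤ 10 * E := by
      refine (sqNorm_pderiv_zero_peak_le hH hΩ ha b hφ.contDiff).trans ?_
      calc _ ≤ 8 * E + 2 * E := by
            gcongr
            · exact le_self_add
            · exact sqNorm_hess_le subset_rfl 0 0
        _ = _ := by ring
    calc _ ≤ 2 * sqNorm P (pderiv 1 φ) + 2 * ε := hφ.le_grad hPΩ 1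
      _ ≤ 2 * (D * 4 * (2 * ε) + (8 * (10 * E) + (8 * D ^ 2 * E + 2 * D ^ 2 * E))) + 2 * ε := by
          gcongr
          refine (sqNorm_pderiv_peak_le_of_normal hH hΩ hσ haR (fun s hs => hH' s hs.1)
            hφ.contDiff).trans ?_
          gcongr
          · exact sqNorm_hess_le hPΩ 0 1
          · exact sqNorm_hess_le hPΩ 1 1
      _ = 2 * (80 + 10 * D ^ 2) * E + (16 * D + 2) * ε := by ring
      _ ≤ 2 * (80 + 10 * D ^ 2) * (2 * sqEnergy u + 10 * ε) + (16 * D + 2) * ε := by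
          gcongr
          exact hφ.energy_le
      _ = _ := by ring

/-- The gradient of a function in the energy space is controlled by the function and its
Hessian. -/
theorem exists_sqNorm_weakDeriv_le (hH : IsPeakProfile H R) (hΩ : IsPeakDomain Ω H R)
    (hbc : IsClampedPeak H R ΓD ΓM) :
    ∃ C : ℝ≥0∞, C ≠ ⊤ ∧ ∀ u : L2 Ω, MemEnergySpace ΓD ΓM u → ∀ i,
      sqNorm Ω (weakDeriv i u) ≤ C * sqEnergy u := by
  have hev : ∀ᶠ s in atTop, |deriv H s| < 1 := by
    have := hH.tendsto_deriv.abs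
    rw [abs_zero] at this
    exact this.eventually (gt_mem_nhds one_pos)
  obtain ⟨a₀, ha₀⟩ := eventually_atTop.1 hev
  set a := max a₀ (R + 2) with ha
  have haR : R + 1 < a := lt_of_lt_of_le (by linarith) (le_max_right _ _)
  have hH' : ∀ s, a < s → |deriv H s| ≤ 1 := fun s hs =>
    (ha₀ s ((le_max_left _ _).trans hs.le)).le
  set K := closure ((Ω : Set Plane) ∩ {x | x 0 ≤ a}) with hK
  obtain ⟨C, hC, hgrad⟩ := exists_sqGrad_le_of_isCompact hΩ.smoothBoundary
    (isCompact_closure_inter_le hH hΩ a) (closure_mono inter_subset_left)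
  set D := ENNReal.ofReal (2 * H a) with hD
  have hDt : D ≠ ⊤ := ENNReal.ofReal_ne_top
  refine ⟨4 * C + (40 + 4 * (80 + 10 * D ^ 2)), by finiteness, fun u hu i => ?_⟩
  have hbdd : sqNorm ((Ω : Set Plane) ∩ K) (weakDeriv i u) ≤ 4 * C * sqEnergy u := by
    refine le_of_forall_le_add_mul (K := 20 * C + 2) (by finiteness) fun ε hε _ => ?_
    obtain ⟨φ, hφ, -⟩ := hu.trace_eq_zero.exists_isCloseH2 hε 0
    calc _ ≤ 2 * sqNorm ((Ω : Set Plane) ∩ K) (pderiv i φ) + 2 * ε :=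
          hφ.le_grad inter_subset_left i
      _ ≤ 2 * (C * (2 * sqEnergy u + 10 * ε)) + 2 * ε := by
          gcongr
          refine le_trans ?_ ((hgrad φ hφ.contDiff).trans
            (mul_le_mul_of_nonneg_left hφ.energy_le zero_le))
          exact Finset.single_le_sum (f := fun i => sqNorm ((Ω : Set Plane) ∩ K) (pderiv i φ))
            (fun _ _ => zero_le) (Finset.mem_univ i)
      _ = _ := by ring
  have htail : ∀ b, sqNorm ((Ω : Set Plane) ∩ strip a b) (weakDeriv i u) ≤
      (40 + 4 * (80 + 10 * D ^ 2)) * sqEnergy u := by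
    intro b
    rw [add_mul]
    fin_cases i
    · exact (sqNorm_weakDeriv_zero_tail_le hH hΩ haR b hu).trans le_self_add
    · exact (sqNorm_weakDeriv_one_tail_le hH hΩ hbc haR hH' b hu).trans le_add_self
  rw [add_mul]
  exact sqNorm_le_of_tail hbdd htail

/-- The Ehrling inequality in the energy space, i.e. the compactness of the embedding into
`L²(Ω)`. -/
theorem exists_ehrling (hH : IsPeakProfile H R) (hΩ : IsPeakDomain Ω H R)
    (hbc : IsClampedPeak H R ΓD ΓM) (hdecay : Tendsto H atTop (𝓝 0)) {ε : ℝ} (hε : 0 < ε) :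
    ∃ L : List (L2 Ω →L[ℂ] ℂ), ∀ u : L2 Ω, MemEnergySpace ΓD ΓM u →
      sqNorm Ω u ≤ ENNReal.ofReal ε * sqEnergy u + 4 * (L.map fun l => ‖l u‖ₑ ^ 2).sum := by
  obtain ⟨C, hC, hgrad⟩ := exists_sqNorm_weakDeriv_le hH hΩ hbc
  obtain ⟨η, hη0, -, hη⟩ := exists_pos_mul_le (16 * C.toReal) (by positivity) hε
  have hηC : 16 * ENNReal.ofReal η * C ≤ ENNReal.ofReal ε := by
    calc 16 * ENNReal.ofReal η * C = ENNReal.ofReal (η * (16 * C.toReal)) := by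
          rw [ENNReal.ofReal_mul hη0.le, ENNReal.ofReal_mul (by norm_num), ENNReal.ofReal_toReal hC]
          simp only [ENNReal.ofReal_ofNat]
          ring
      _ ≤ _ := ENNReal.ofReal_le_ofReal hη
  -- far out in the peak, the constant in the Friedrichs inequality is small
  have hev : ∀ᶠ s in atTop, (2 * H s) ^ 2 < η := by
    have := (hdecay.const_mul 2).pow 2
    rw [mul_zero, zero_pow two_ne_zero] at this
    exact this.eventually (gt_mem_nhds hη0)
  obtain ⟨a, haR, haη⟩ := ((eventually_gt_atTop R).and hev).exists
  set K := closure ((Ω : Set Plane) ∩ {x | x 0 ≤ a}) with hK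
  obtain ⟨L, hL⟩ := ehrlingOn_of_isCompact hΩ.smoothBoundary (isCompact_closure_inter_le hH hΩ a)
    (closure_mono inter_subset_left) η hη0
  refine ⟨L, fun u hu => ?_⟩
  set D := ENNReal.ofReal (2 * H a) with hD
  have hDη : D ^ 2 ≤ ENNReal.ofReal η := by
    have := hH.pos a haR
    rw [hD, ← ENNReal.ofReal_pow (by positivity)]
    exact ENNReal.ofReal_le_ofReal haη.le
  set G := ∑ i : Fin 2, sqNorm Ω (weakDeriv i u) with hG
  have hGC : G ≤ 2 * (C * sqEnergy u) := by
    rw [hG, Fin.sum_univ_two, two_mul]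
    exact add_le_add (hgrad u hu 0) (hgrad u hu 1)
  have htail : ∀ b, sqNorm ((Ω : Set Plane) ∩ strip a b) u ≤
      8 * ENNReal.ofReal η * (C * sqEnergy u) := by
    intro b
    refine (sqNorm_tail_le hH hΩ hbc haR b hu).trans ?_
    gcongr
    exact hgrad u hu 1
  have hfin : (L.map fun l => ‖l‖ₑ ^ 2).sum ≠ ⊤ := by
    clear hL
    induction L with
    | nil => simp
    | cons l L ih =>
      rw [List.map_cons, List.sum_cons]
      have : ‖l‖ₑ ≠ ⊤ := enorm_ne_top
      finiteness
  have hbdd : sqNorm ((Ω : Set Plane) ∩ K) u ≤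
      4 * ENNReal.ofReal η * G + 4 * (L.map fun l => ‖l u‖ₑ ^ 2).sum := by
    refine le_of_forall_le_add_mul
      (K := 8 * ENNReal.ofReal η + 4 * (L.map fun l => ‖l‖ₑ ^ 2).sum + 2) (by finiteness)
      fun δ hδ hδt => ?_
    obtain ⟨φ, hφ, -⟩ := hu.trace_eq_zero.exists_isCloseH2 hδ 0
    have hφm : MemLp φ 2 (volume.restrict (Ω : Set Plane)) :=
      (hφ.contDiff.continuous.memLp_of_hasCompactSupport hφ.hasCompactSupport).restrict _
    set w : L2 Ω := hφm.toLp φ with hw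
    have hwφ : w =ᵐ[volume.restrict (Ω : Set Plane)] φ := hφm.coeFn_toLp
    have hclose : ‖w - u‖ₑ ^ 2 ≤ δ := by
      rw [Lp.enorm_def, eLpNorm_two_sq]
      refine le_trans (le_of_eq (lintegral_congr_ae ?_)) hφ.fn
      filter_upwards [Lp.coeFn_sub w u, hwφ] with x h1 h2
      rw [h1, Pi.sub_apply, h2]
    have hsum : (L.map fun l => ‖l w‖ₑ ^ 2).sum ≤ 2 * (L.map fun l => ‖l u‖ₑ ^ 2).sum +
        2 * (L.map fun l => ‖l‖ₑ ^ 2).sum * δ := by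
      clear hL hfin
      induction L with
      | nil => simp
      | cons l L ih =>
        simp only [List.map_cons, List.sum_cons]
        have h1 : ‖l w‖ₑ ^ 2 ≤ 2 * ‖l u‖ₑ ^ 2 + 2 * (‖l‖ₑ ^ 2 * δ) := by
          have e : l w = l u + l (w - u) := by rw [map_sub]; ring
          rw [e]
          refine (enorm_add_sq_le _ _).trans ?_
          gcongr
          calc ‖l (w - u)‖ₑ ^ 2 ≤ (‖l‖ₑ * ‖w - u‖ₑ) ^ 2 := by
                gcongr; exact l.le_opENorm _
            _ = ‖l‖ₑ ^ 2 * ‖w - u‖ₑ ^ 2 := mul_pow _ _ _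
            _ ≤ _ := by gcongr
        refine (add_le_add h1 ih).trans (le_of_eq ?_)
        ring
    calc _ ≤ 2 * sqNorm ((Ω : Set Plane) ∩ K) φ + 2 * δ := hφ.le_fn inter_subset_left
      _ ≤ 2 * (ENNReal.ofReal η * (2 * G + 4 * δ) + (2 * (L.map fun l => ‖l u‖ₑ ^ 2).sum +
            2 * (L.map fun l => ‖l‖ₑ ^ 2).sum * δ)) + 2 * δ := by
          gcongr
          refine (hL φ hφ.contDiff w hwφ).trans ?_
          gcongr
          exact hφ.sqGrad_le
      _ = _ := by ring
  calc sqNorm Ω u ≤ (4 * ENNReal.ofReal η * G + 4 * (L.map fun l => ‖l u‖ₑ ^ 2).sum) +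
        8 * ENNReal.ofReal η * (C * sqEnergy u) := sqNorm_le_of_tail hbdd htail
    _ ≤ (4 * ENNReal.ofReal η * (2 * (C * sqEnergy u)) +
        4 * (L.map fun l => ‖l u‖ₑ ^ 2).sum) + 8 * ENNReal.ofReal η * (C * sqEnergy u) := by gcongr
    _ = 16 * ENNReal.ofReal η * C * sqEnergy u + 4 * (L.map fun l => ‖l u‖ₑ ^ 2).sum := by ring
    _ ≤ _ := by gcongr

end Estimates

/-! ### Closedness of weak derivatives and traces, density of test functions -/

section WeakDerivatives

variable {Ω : TopologicalSpace.Opens Plane}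

lemma sqNorm_L2 (w : L2 Ω) : sqNorm Ω w = ‖w‖ₑ ^ 2 := by
  rw [Lp.enorm_def, eLpNorm_two_sq]; rfl

/-- Integration against a test function is a continuous functional on `L²(Ω)`. -/
lemma exists_functional_smul {φ : Plane → ℝ} (hφ : Continuous φ) (hc : HasCompactSupport φ) :
    ∃ l : L2 Ω →L[ℂ] ℂ, ∀ u : L2 Ω, l u = ∫ x in (Ω : Set Plane), φ x • u x := by
  have hm : MemLp (fun x => (φ x : ℂ)) 2 (volume.restrict (Ω : Set Plane)) :=
    ((Complex.continuous_ofReal.comp hφ).memLp_of_hasCompactSupport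
      (hc.comp_left Complex.ofReal_zero)).restrict _
  refine ⟨innerSL ℂ (hm.toLp _), fun u => ?_⟩
  rw [innerSL_apply_apply, L2.inner_def]
  refine integral_congr_ae ?_
  filter_upwards [hm.coeFn_toLp] with x hx
  rw [hx, RCLike.inner_apply, Complex.conj_ofReal, mul_comm, Complex.real_smul]

/-- The weak derivative is a closed operator. -/
lemma HasWeakDeriv.of_tendsto {i : Fin 2} {u w : ℕ → L2 Ω} {u' w' : L2 Ω}
    (h : ∀ n, HasWeakDeriv i (u n) (w n)) (hu : Tendsto u atTop (𝓝 u'))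
    (hw : Tendsto w atTop (𝓝 w')) : HasWeakDeriv i u' w' := by
  intro φ hφ hc hs
  obtain ⟨l, hl⟩ := exists_functional_smul (Ω := Ω) (continuous_pderiv i hφ)
    (hasCompactSupport_pderiv i hc)
  obtain ⟨l', hl'⟩ := exists_functional_smul (Ω := Ω) hφ.continuous hc
  rw [← hl, ← hl']
  refine tendsto_nhds_unique ((l.continuous.tendsto u').comp hu) ?_
  refine (((l'.continuous.tendsto w').comp hw).neg).congr fun n => ?_
  simp only [Function.comp_apply]
  rw [hl, hl', h n φ hφ hc hs]

lemma tsupport_pderiv_subset {F : Type*} [NormedAddCommGroup F] [NormedSpace ℝ F] (i : Fin 2)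
    (φ : Plane → F) : tsupport (pderiv i φ) ⊆ tsupport φ :=
  tsupport_fderiv_apply_subset ℝ _

lemma pderiv_comm {F : Type*} [NormedAddCommGroup F] [NormedSpace ℝ F] (i j : Fin 2)
    {φ : Plane → F} (hφ : ContDiff ℝ ∞ φ) :
    pderiv i (pderiv j φ) = pderiv j (pderiv i φ) := by
  ext x
  have hd : DifferentiableAt ℝ (fderiv ℝ φ) x :=
    (hφ.fderiv_right (m := ∞) (by simp)).differentiable (by simp) x
  have e : ∀ k l : Fin 2, pderiv k (pderiv l φ) x =
      fderiv ℝ (fderiv ℝ φ) x (EuclideanSpace.single k 1) (EuclideanSpace.single l 1) := by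
    intro k l
    have hl : pderiv l φ = fun y => fderiv ℝ φ y (EuclideanSpace.single l 1) := rfl
    rw [pderiv, hl, fderiv_clm_apply hd (differentiableAt_const _)]
    simp
  rw [e, e]
  exact (hφ.contDiffAt.isSymmSndFDerivAt
    (by
      rw [minSmoothness_of_isRCLikeNormedField]
      exact WithTop.coe_le_coe.2 (le_top : (2 : ℕ∞) ≤ ⊤))).eq _ _

lemma MemH2.weakDeriv_comm {u : L2 Ω} (hu : MemH2 u) (i j : Fin 2) :
    weakDeriv j (weakDeriv i u) = weakDeriv i (weakDeriv j u) := by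
  refine HasWeakDeriv.unique (i := i) (u := weakDeriv j u) ?_ (hasWeakDeriv_weakDeriv ((hu j).2 i))
  intro φ hφ hc hs
  have h1 := hasWeakDeriv_weakDeriv (hu j).1 (pderiv i φ) (contDiff_pderiv i hφ)
    (hasCompactSupport_pderiv i hc) ((tsupport_pderiv_subset i φ).trans hs)
  have h2 := hasWeakDeriv_weakDeriv (hu i).1 (pderiv j φ) (contDiff_pderiv j hφ)
    (hasCompactSupport_pderiv j hc) ((tsupport_pderiv_subset j φ).trans hs)
  have h3 := hasWeakDeriv_weakDeriv ((hu i).2 j) φ hφ hc hs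
  rw [pderiv_comm i j hφ] at h2
  rw [← neg_eq_iff_eq_neg.2 h1, h2, neg_neg, h3]

variable {ΓD ΓM : Set Plane}

lemma distH2_zero_eq (w : L2 Ω) : distH2 0 w = ‖w‖ₑ + ∑ i : Fin 2, ‖weakDeriv i w‖ₑ +
    ∑ i : Fin 2, ∑ j : Fin 2, ‖weakDeriv j (weakDeriv i w)‖ₑ := by
  have e : ∀ v : L2 Ω, eLpNorm (fun x => (0 : ℂ) - v x) 2 (volume.restrict (Ω : Set Plane)) =
      ‖v‖ₑ := fun v => by
    simp only [zero_sub]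
    rw [Lp.enorm_def]
    exact eLpNorm_neg v 2 _
  have h0 : ∀ i : Fin 2, pderiv i (0 : Plane → ℂ) = 0 := fun i => by
    ext x; simp [pderiv]
  simp only [distH2, h0, Pi.zero_apply, e]

/-- Vanishing of a trace is preserved under limits in `H²(Ω)`. -/
lemma TraceEqZero.of_approx {B : (Plane → ℂ) → Plane → ℂ} {Γ : Set Plane} {u : L2 Ω}
    (h : ∀ ε : ℝ≥0∞, 0 < ε → ∃ v : L2 Ω, MemH2 v ∧ MemH2 (u - v) ∧ TraceEqZero B Γ v ∧
      distH2 0 (u - v) < ε) : TraceEqZero B Γ u := by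
  intro ε hε r
  have hε2 : 0 < ε / 2 := ENNReal.half_pos hε.ne'
  obtain ⟨v, hv, huv, htr, hd⟩ := h (ε / 2) hε2
  obtain ⟨φ, h1, h2, h3, h4⟩ := htr (ε / 2) hε2 r
  refine ⟨φ, h1, h2, ?_, h4.trans_le ENNReal.half_le_self⟩
  have := distH2_add_le h1 (contDiff_const (c := (0 : ℂ))) hv huv
  change distH2 (φ + 0) _ ≤ _ + distH2 0 (u - v) at this
  rw [add_zero, add_sub_cancel] at this
  calc _ ≤ _ := this
    _ < ε / 2 + ε / 2 := ENNReal.add_lt_add h3 hd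
    _ = ε := ENNReal.add_halves ε

lemma hasWeakDeriv_toLp (i : Fin 2) {φ : Plane → ℂ} (hφ : ContDiff ℝ ∞ φ)
    (hm : MemLp φ 2 (volume.restrict (Ω : Set Plane)))
    (hm' : MemLp (pderiv i φ) 2 (volume.restrict (Ω : Set Plane))) :
    HasWeakDeriv i (hm.toLp φ : L2 Ω) (hm'.toLp _) := by
  intro ψ hψ hc hs
  have e : ∀ (η : Plane → ℝ) (f : Plane → ℂ) (hf : MemLp f 2 (volume.restrict (Ω : Set Plane))),
      tsupport η ⊆ (Ω : Set Plane) →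
      ∫ x in (Ω : Set Plane), η x • (hf.toLp f : L2 Ω) x = ∫ x, η x • f x := by
    intro η f hf hη
    have h1 : ∫ x in (Ω : Set Plane), η x • (hf.toLp f : L2 Ω) x =
        ∫ x in (Ω : Set Plane), η x • f x := by
      refine integral_congr_ae ?_
      filter_upwards [hf.coeFn_toLp] with x hx
      rw [hx]
    rw [h1]
    refine setIntegral_eq_integral_of_forall_compl_eq_zero fun x hx => ?_
    rw [image_eq_zero_of_notMem_tsupport fun hx' => hx (hη hx'), zero_smul]
  rw [e _ _ hm ((tsupport_pderiv_subset i ψ).trans hs), e _ _ hm' hs]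
  have hint : ∀ (η : Plane → ℝ) (f : Plane → ℂ), Continuous η → HasCompactSupport η →
      Continuous f → Integrable (fun x => η x • f x) := fun η f h1 h2 h3 =>
    (h1.smul h3).integrable_of_hasCompactSupport h2.smul_right
  have key := integral_bilinear_fderiv_right_eq_neg_left_of_integrable (μ := volume)
    (f := ψ) (g := φ) (v := EuclideanSpace.single i (1 : ℝ))
    (B := ContinuousLinearMap.lsmul ℝ ℝ)
    (hint _ _ (continuous_pderiv i hψ) (hasCompactSupport_pderiv i hc) hφ.continuous)
    (hint _ _ hψ.continuous hc (continuous_pderiv i hφ)) (hint _ _ hψ.continuous hc hφ.continuous)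
    (fun x _ => hψ.differentiable (by simp) x) (fun x _ => hφ.differentiable (by simp) x)
  exact (neg_eq_iff_eq_neg.2 key).symm

lemma memLp_of_test {φ : Plane → ℂ} (hφ : Continuous φ) (hc : HasCompactSupport φ) :
    MemLp φ 2 (volume.restrict (Ω : Set Plane)) :=
  (hφ.memLp_of_hasCompactSupport hc).restrict _

/-- Test functions belong to the energy space. -/
lemma memEnergySpace_toLp (hΓ : ΓD ∪ ΓM ⊆ frontier (Ω : Set Plane)) {φ : Plane → ℂ}
    (hφ : ContDiff ℝ ∞ φ) (hc : HasCompactSupport φ) (hs : tsupport φ ⊆ (Ω : Set Plane)) :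
    MemEnergySpace ΓD ΓM ((memLp_of_test hφ.continuous hc).toLp φ : L2 Ω) := by
  have hm1 := fun i => memLp_of_test (Ω := Ω) (continuous_pderiv i hφ)
    (hasCompactSupport_pderiv i hc)
  have hm2 := fun i j => memLp_of_test (Ω := Ω) (continuous_pderiv j (contDiff_pderiv i hφ))
    (hasCompactSupport_pderiv j (hasCompactSupport_pderiv i hc))
  have h1 : ∀ i, HasWeakDeriv i ((memLp_of_test hφ.continuous hc).toLp φ : L2 Ω)
      ((hm1 i).toLp _) := fun i => hasWeakDeriv_toLp i hφ _ _
  have h2 : ∀ i j, HasWeakDeriv j ((hm1 i).toLp _ : L2 Ω) ((hm2 i j).toLp _) := fun i j =>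
    hasWeakDeriv_toLp j (contDiff_pderiv i hφ) _ _
  have e1 := fun i => (h1 i).weakDeriv_eq
  have e2 := fun i j => (h2 i j).weakDeriv_eq
  have hdist : distH2 φ ((memLp_of_test hφ.continuous hc).toLp φ : L2 Ω) = 0 := by
    have e : ∀ (f : Plane → ℂ) (hf : MemLp f 2 (volume.restrict (Ω : Set Plane))),
        eLpNorm (fun x => f x - (hf.toLp f : L2 Ω) x) 2 (volume.restrict (Ω : Set Plane)) = 0 := by
      intro f hf
      rw [← eLpNorm_zero (ε := ℂ) (p := 2) (μ := volume.restrict (Ω : Set Plane))]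
      refine eLpNorm_congr_ae ?_
      filter_upwards [hf.coeFn_toLp] with x hx
      rw [hx, sub_self]; rfl
    simp only [distH2, e1, e2, e, Finset.sum_const_zero, add_zero]
  have htr : ∀ (B : (Plane → ℂ) → Plane → ℂ) (Γ : Set Plane), Γ ⊆ frontier (Ω : Set Plane) →
      (∀ x ∈ frontier (Ω : Set Plane), B φ x = 0) →
      TraceEqZero B Γ ((memLp_of_test hφ.continuous hc).toLp φ : L2 Ω) := by
    intro B Γ hΓ hB ε hε r
    refine ⟨φ, hφ, hc, by rwa [hdist], lt_of_eq_of_lt ?_ hε⟩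
    rw [← nonpos_iff_eq_zero]
    calc _ ≤ eLpNorm (B φ) 2 (μH[1].restrict (frontier (Ω : Set Plane))) :=
          eLpNorm_mono_measure _ (Measure.restrict_mono (inter_subset_left.trans hΓ) le_rfl)
      _ = eLpNorm (0 : Plane → ℂ) 2 (μH[1].restrict (frontier (Ω : Set Plane))) :=
          eLpNorm_congr_ae ((ae_restrict_iff' isClosed_frontier.measurableSet).2
            (Eventually.of_forall hB))
      _ ≤ 0 := by rw [eLpNorm_zero]
  have hout : ∀ x ∈ frontier (Ω : Set Plane), x ∉ tsupport φ := by
    intro x hx hx'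
    rw [Ω.isOpen.frontier_eq] at hx
    exact hx.2 (hs hx')
  refine ⟨fun i => ⟨⟨(hm1 i).toLp _, h1 i⟩, fun j => ⟨(hm2 i j).toLp _, ?_⟩⟩, htr _ _ hΓ fun x hx =>
    image_eq_zero_of_notMem_tsupport (hout x hx),
    htr _ _ (subset_union_left.trans hΓ) fun x hx => ?_⟩
  · rw [e1]; exact h2 i j
  · rw [normalDeriv, fderiv_of_notMem_tsupport ℝ (hout x hx)]
    rfl

/-- The energy space is dense in `L²(Ω)`. -/
lemma eq_zero_of_inner_energySpace (hΓ : ΓD ∪ ΓM ⊆ frontier (Ω : Set Plane)) {f : L2 Ω}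
    (h : ∀ v : L2 Ω, MemEnergySpace ΓD ΓM v → inner ℂ v f = 0) : f = 0 := by
  have key : ∀ᵐ x ∂(volume : Measure Plane), x ∈ (Ω : Set Plane) → f x = 0 := by
    refine Ω.isOpen.ae_eq_zero_of_integral_contDiff_smul_eq_zero (locallyIntegrableOn_L2 _) ?_
    intro g hg hgc hgs
    set φ : Plane → ℂ := fun x => (g x : ℂ) with hφ
    have hφs : ContDiff ℝ ∞ φ := Complex.ofRealCLM.contDiff.comp hg
    have hφc : HasCompactSupport φ := hgc.comp_left Complex.ofReal_zero
    have hts : tsupport φ ⊆ tsupport g :=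
      closure_mono fun x hx => by
        rw [Function.mem_support] at hx ⊢
        exact fun h0 => hx (by simp [hφ, h0])
    have h1 := h _ (memEnergySpace_toLp hΓ hφs hφc (hts.trans hgs))
    rw [L2.inner_def] at h1
    rw [← h1]
    have e1 : ∫ x, g x • f x = ∫ x in (Ω : Set Plane), g x • f x := by
      refine (setIntegral_eq_integral_of_forall_compl_eq_zero fun x hx => ?_).symm
      rw [image_eq_zero_of_notMem_tsupport fun hx' => hx (hgs hx'), zero_smul]
    rw [e1]
    refine integral_congr_ae ?_
    filter_upwards [(memLp_of_test (Ω := Ω) hφs.continuous hφc).coeFn_toLp] with x hx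
    rw [hx, RCLike.inner_apply, hφ, Complex.conj_ofReal, mul_comm, Complex.real_smul]
  rw [Lp.ext_iff]
  refine EventuallyEq.trans ?_ (Lp.coeFn_zero ℂ 2 _).symm
  exact (ae_restrict_iff' Ω.isOpen.measurableSet).2 key

end WeakDerivatives

/-! ### The energy space as a complete form domain -/

section FormDomain

variable {Ω : TopologicalSpace.Opens Plane} {ΓD ΓM : Set Plane} {ν : ℝ}

/-- The map `u ↦ (u, √(1-ν) ∂₁²u, √(1-ν) ∂₂²u, √ν Δu, √(2(1-ν)) ∂₁∂₂u)` into `L²(Ω)⁵`. The inner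
product of the images of `u` and `v` is `a(u, v) + (u, v)`. -/
noncomputable def energyMap (Ω : TopologicalSpace.Opens Plane) (ΓD ΓM : Set Plane) (ν : ℝ) :
    energySpace Ω ΓD ΓM →ₗ[ℂ] PiLp 2 (fun _ : Fin 5 => L2 Ω) where
  toFun u := WithLp.toLp 2 ![(u : L2 Ω),
    ((√(1 - ν) : ℝ) : ℂ) • weakDeriv 0 (weakDeriv 0 (u : L2 Ω)),
    ((√(1 - ν) : ℝ) : ℂ) • weakDeriv 1 (weakDeriv 1 (u : L2 Ω)),
    ((√ν : ℝ) : ℂ) • (weakDeriv 0 (weakDeriv 0 (u : L2 Ω)) + weakDeriv 1 (weakDeriv 1 (u : L2 Ω))),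
    ((√(2 * (1 - ν)) : ℝ) : ℂ) • weakDeriv 1 (weakDeriv 0 (u : L2 Ω))]
  map_add' u v := by
    have hu : MemH2 (u : L2 Ω) := u.2.memH2
    have hv : MemH2 (v : L2 Ω) := v.2.memH2
    refine PiLp.ext fun k => ?_
    fin_cases k
    · rfl
    all_goals
      simp [hu.weakDeriv2_add hv, smul_add]
      try abel
  map_smul' c u := by
    have hu : MemH2 (u : L2 Ω) := u.2.memH2
    refine PiLp.ext fun k => ?_
    fin_cases k
    · rfl
    all_goals
      simp [hu.weakDeriv2_smul, ← smul_add]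
      exact smul_comm _ _ _

lemma inner_energyMap (hν₀ : 0 ≤ ν) (hν₁ : ν < 1 / 2) (u v : energySpace Ω ΓD ΓM) :
    inner ℂ (energyMap Ω ΓD ΓM ν v) (energyMap Ω ΓD ΓM ν u) =
      plateForm ν (u : L2 Ω) v + inner ℂ (v : L2 Ω) u := by
  have h1 : ((√(1 - ν) : ℝ) : ℂ) * ((√(1 - ν) : ℝ) : ℂ) = 1 - ν := by
    rw [← Complex.ofReal_mul, Real.mul_self_sqrt (by linarith)]; push_cast; ring
  have h2 : ((√ν : ℝ) : ℂ) * ((√ν : ℝ) : ℂ) = ν := by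
    rw [← Complex.ofReal_mul, Real.mul_self_sqrt hν₀]
  have h3 : ((√(2 * (1 - ν)) : ℝ) : ℂ) * ((√(2 * (1 - ν)) : ℝ) : ℂ) = 2 * (1 - ν) := by
    rw [← Complex.ofReal_mul, Real.mul_self_sqrt (by linarith)]; push_cast; ring
  have hs : ∀ (c : ℝ) (x y : L2 Ω), inner ℂ ((c : ℂ) • x) ((c : ℂ) • y) =
      ((c : ℂ) * (c : ℂ)) * inner ℂ x y := fun c x y => by
    rw [inner_smul_left, inner_smul_right, Complex.conj_ofReal, mul_assoc]
  rw [PiLp.inner_apply, Fin.sum_univ_five]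
  change inner ℂ (v : L2 Ω) (u : L2 Ω) + inner ℂ (_ • _) (_ • _) + inner ℂ (_ • _) (_ • _) +
    inner ℂ (_ • _) (_ • _) + inner ℂ (_ • _) (_ • _) = _
  rw [hs, hs, hs, hs, h1, h2, h3, plateForm]
  simp only [inner_add_left, inner_add_right]
  ring

lemma norm_energyMap_sq (hν₀ : 0 ≤ ν) (hν₁ : ν < 1 / 2) (u : energySpace Ω ΓD ΓM) :
    ‖energyMap Ω ΓD ΓM ν u‖ ^ 2 = ‖(u : L2 Ω)‖ ^ 2 +
      (1 - ν) * ‖weakDeriv 0 (weakDeriv 0 (u : L2 Ω))‖ ^ 2 +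
      (1 - ν) * ‖weakDeriv 1 (weakDeriv 1 (u : L2 Ω))‖ ^ 2 +
      ν * ‖weakDeriv 0 (weakDeriv 0 (u : L2 Ω)) + weakDeriv 1 (weakDeriv 1 (u : L2 Ω))‖ ^ 2 +
      2 * (1 - ν) * ‖weakDeriv 1 (weakDeriv 0 (u : L2 Ω))‖ ^ 2 := by
  have hs : ∀ (c : ℝ) (x : L2 Ω), 0 ≤ c → ‖((√c : ℝ) : ℂ) • x‖ ^ 2 = c * ‖x‖ ^ 2 :=
    fun c x hc => by
      rw [norm_smul, Complex.norm_real, Real.norm_of_nonneg (Real.sqrt_nonneg c), mul_pow,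
        Real.sq_sqrt hc]
  rw [PiLp.norm_sq_eq_of_L2, Fin.sum_univ_five]
  change ‖(u : L2 Ω)‖ ^ 2 + ‖_ • _‖ ^ 2 + ‖_ • _‖ ^ 2 + ‖_ • _‖ ^ 2 + ‖_ • _‖ ^ 2 = _
  rw [hs _ _ (by linarith), hs _ _ (by linarith), hs _ _ hν₀, hs _ _ (by linarith)]

/-- The form controls the `L²`-norm of the function and of its Hessian. -/
lemma sqEnergy_le_norm_energyMap (hν₀ : 0 ≤ ν) (hν₁ : ν < 1 / 2) (u : energySpace Ω ΓD ΓM) :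
    sqEnergy (u : L2 Ω) ≤ ENNReal.ofReal (2 * ‖energyMap Ω ΓD ΓM ν u‖ ^ 2) := by
  have hcomm := u.2.memH2.weakDeriv_comm 0 1
  have e : ∀ w : L2 Ω, ‖w‖ₑ ^ 2 = ENNReal.ofReal (‖w‖ ^ 2) := fun w => by
    rw [← ofReal_norm, ENNReal.ofReal_pow (norm_nonneg _)]
  rw [sqEnergy, Fin.sum_univ_two, Fin.sum_univ_two, Fin.sum_univ_two]
  simp only [sqNorm_L2, e]
  rw [← hcomm, ← ENNReal.ofReal_add (by positivity) (by positivity),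
    ← ENNReal.ofReal_add (by positivity) (by positivity),
    ← ENNReal.ofReal_add (by positivity) (by positivity),
    ← ENNReal.ofReal_add (by positivity) (by positivity), norm_energyMap_sq hν₀ hν₁]
  refine ENNReal.ofReal_le_ofReal ?_
  have h3 := mul_nonneg hν₀ (sq_nonneg
    ‖weakDeriv 0 (weakDeriv 0 (u : L2 Ω)) + weakDeriv 1 (weakDeriv 1 (u : L2 Ω))‖)
  have h4 : ∀ x : ℝ, x ^ 2 ≤ 2 * ((1 - ν) * x ^ 2) := fun x => by nlinarith [sq_nonneg x]
  have h5 := h4 ‖weakDeriv 0 (weakDeriv 0 (u : L2 Ω))‖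
  have h6 := h4 ‖weakDeriv 1 (weakDeriv 1 (u : L2 Ω))‖
  have h7 := h4 ‖weakDeriv 1 (weakDeriv 0 (u : L2 Ω))‖
  have h8 := sq_nonneg ‖(u : L2 Ω)‖
  linarith

lemma norm_le_of_enorm_sq_le {E F : Type*} [NormedAddCommGroup E] [NormedAddCommGroup F] {x : E}
    {y : F} {C : ℝ≥0∞} (hC : C ≠ ⊤) (h : ‖x‖ₑ ^ 2 ≤ C * ENNReal.ofReal (2 * ‖y‖ ^ 2)) :
    ‖x‖ ≤ √(2 * C.toReal) * ‖y‖ := by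
  rw [← ENNReal.ofReal_toReal hC, ← ENNReal.ofReal_mul ENNReal.toReal_nonneg, ← ofReal_norm,
    ← ENNReal.ofReal_pow (norm_nonneg _), ENNReal.ofReal_le_ofReal_iff (by positivity)] at h
  refine abs_le_of_sq_le_sq' ?_ (by positivity) |>.2
  rw [mul_pow, Real.sq_sqrt (by positivity)]
  linarith

/-- A sequence which is Cauchy for the seminorm `‖T ·‖` is Cauchy for each seminorm that it
controls. -/
lemma cauchySeq_of_norm_le {V E F : Type*} [AddCommGroup V] [Module ℂ V] [NormedAddCommGroup E]
    [NormedSpace ℂ E] [NormedAddCommGroup F] [NormedSpace ℂ F] (A : V →ₗ[ℂ] E) (T : V →ₗ[ℂ] F)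
    {K : ℝ} (h : ∀ v, ‖A v‖ ≤ K * ‖T v‖) {u : ℕ → V} (hu : CauchySeq fun n => T (u n)) :
    CauchySeq fun n => A (u n) := by
  rw [Metric.cauchySeq_iff] at hu ⊢
  intro ε hε
  obtain ⟨N, hN⟩ := hu (ε / (|K| + 1)) (by positivity)
  refine ⟨N, fun m hm n hn => ?_⟩
  have h1 := hN m hm n hn
  rw [dist_eq_norm, ← map_sub, lt_div_iff₀ (by positivity)] at h1
  rw [dist_eq_norm, ← map_sub]
  calc _ ≤ K * ‖T (u m - u n)‖ := h _
    _ ≤ ‖T (u m - u n)‖ * (|K| + 1) := by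
      nlinarith [norm_nonneg (T (u m - u n)), le_abs_self K]
    _ < ε := h1

/-- The weak derivative as a linear map on the energy space. -/
noncomputable def weakDerivₗ (Ω : TopologicalSpace.Opens Plane) (ΓD ΓM : Set Plane) (i : Fin 2) :
    energySpace Ω ΓD ΓM →ₗ[ℂ] L2 Ω where
  toFun u := weakDeriv i (u : L2 Ω)
  map_add' u v := MemH2.weakDeriv_add u.2.memH2 v.2.memH2 i
  map_smul' c u := MemH2.weakDeriv_smul u.2.memH2 c i

/-- The second weak derivative as a linear map on the energy space. -/
noncomputable def weakDeriv2ₗ (Ω : TopologicalSpace.Opens Plane) (ΓD ΓM : Set Plane)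
    (i j : Fin 2) : energySpace Ω ΓD ΓM →ₗ[ℂ] L2 Ω where
  toFun u := weakDeriv j (weakDeriv i (u : L2 Ω))
  map_add' u v := MemH2.weakDeriv2_add u.2.memH2 v.2.memH2 i j
  map_smul' c u := MemH2.weakDeriv2_smul u.2.memH2 c i j

/-- The form `a` is closed: `ℍ` is complete in the form norm, as the latter controls the norm of
`H²(Ω)`. -/
theorem isClosed_range_energyMap (hν₀ : 0 ≤ ν) (hν₁ : ν < 1 / 2)
    (hgrad : ∃ C : ℝ≥0∞, C ≠ ⊤ ∧ ∀ u : L2 Ω, MemEnergySpace ΓD ΓM u → ∀ i,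
      sqNorm Ω (weakDeriv i u) ≤ C * sqEnergy u) :
    IsClosed (LinearMap.range (energyMap Ω ΓD ΓM ν) : Set (PiLp 2 (fun _ : Fin 5 => L2 Ω))) := by
  obtain ⟨C, hC, hgrad⟩ := hgrad
  have hE := sqEnergy_le_norm_energyMap (Ω := Ω) (ΓD := ΓD) (ΓM := ΓM) hν₀ hν₁
  refine IsSeqClosed.isClosed fun w g hw hg => ?_
  choose u hu using hw
  have hcau : CauchySeq fun n => energyMap Ω ΓD ΓM ν (u n) := by
    simp only [hu]; exact hg.cauchySeq
  have c0 : CauchySeq fun n => (u n : L2 Ω) := by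
    refine cauchySeq_of_norm_le (energySpace Ω ΓD ΓM).subtype (energyMap Ω ΓD ΓM ν)
      (fun v => norm_le_of_enorm_sq_le ENNReal.one_ne_top ?_) hcau
    rw [one_mul, ← sqNorm_L2]
    exact le_self_add.trans (hE v)
  have c1 : ∀ i, CauchySeq fun n => weakDeriv i (u n : L2 Ω) := fun i => by
    refine cauchySeq_of_norm_le (weakDerivₗ Ω ΓD ΓM i) (energyMap Ω ΓD ΓM ν)
      (fun v => norm_le_of_enorm_sq_le hC ?_) hcau
    rw [← sqNorm_L2]
    exact (hgrad v v.2 i).trans (by gcongr; exact hE v)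
  have c2 : ∀ i j, CauchySeq fun n => weakDeriv j (weakDeriv i (u n : L2 Ω)) := fun i j => by
    refine cauchySeq_of_norm_le (weakDeriv2ₗ Ω ΓD ΓM i j) (energyMap Ω ΓD ΓM ν)
      (fun v => norm_le_of_enorm_sq_le ENNReal.one_ne_top ?_) hcau
    rw [one_mul, ← sqNorm_L2]
    refine le_trans ?_ (hE v)
    refine le_trans ?_ (le_add_self : _ ≤ _ + _)
    exact (Finset.single_le_sum (f := fun j => sqNorm Ω (weakDeriv j (weakDeriv i (v : L2 Ω))))
      (fun _ _ => zero_le) (Finset.mem_univ j)).trans (Finset.single_le_sum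
      (f := fun i => ∑ j : Fin 2, sqNorm Ω (weakDeriv j (weakDeriv i (v : L2 Ω))))
      (fun _ _ => zero_le) (Finset.mem_univ i))
  obtain ⟨u', hu'⟩ := cauchySeq_tendsto_of_complete c0
  choose d hd using fun i => cauchySeq_tendsto_of_complete (c1 i)
  choose d2 hd2 using fun i j => cauchySeq_tendsto_of_complete (c2 i j)
  have hm : ∀ n, MemH2 (u n : L2 Ω) := fun n => (u n).2.memH2
  have k1 : ∀ i, HasWeakDeriv i u' (d i) := fun i =>
    HasWeakDeriv.of_tendsto (fun n => hasWeakDeriv_weakDeriv (hm n i).1) hu' (hd i)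
  have k2 : ∀ i j, HasWeakDeriv j (d i) (d2 i j) := fun i j =>
    HasWeakDeriv.of_tendsto (fun n => hasWeakDeriv_weakDeriv ((hm n i).2 j)) (hd i) (hd2 i j)
  have e1 := fun i => (k1 i).weakDeriv_eq
  have e2 := fun i j => (k2 i j).weakDeriv_eq
  have hu'm : MemH2 u' := fun i => ⟨⟨_, k1 i⟩, fun j => by rw [e1]; exact ⟨_, k2 i j⟩⟩
  have hsub : ∀ v : L2 Ω, MemH2 v → MemH2 (u' - v) ∧
      (∀ i, weakDeriv i (u' - v) = d i - weakDeriv i v) ∧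
      ∀ i j, weakDeriv j (weakDeriv i (u' - v)) = d2 i j - weakDeriv j (weakDeriv i v) := by
    intro v hv
    have e : u' - v = u' + (-1 : ℂ) • v := by rw [neg_one_smul, sub_eq_add_neg]
    have hv' := hv.smul (-1)
    refine ⟨e ▸ hu'm.add hv', fun i => ?_, fun i j => ?_⟩
    · rw [e, hu'm.weakDeriv_add hv', hv.weakDeriv_smul, e1, neg_one_smul, sub_eq_add_neg]
    · rw [e, hu'm.weakDeriv2_add hv', hv.weakDeriv2_smul, e1, e2, neg_one_smul, sub_eq_add_neg]
  have hlim : Tendsto (fun n => distH2 0 (u' - (u n : L2 Ω))) atTop (𝓝 0) := by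
    have hz : ∀ {x : ℕ → L2 Ω} {y : L2 Ω}, Tendsto x atTop (𝓝 y) →
        Tendsto (fun n => ‖y - x n‖ₑ) atTop (𝓝 0) := by
      intro x y h
      have := (tendsto_const_nhds (x := y)).sub h
      rw [sub_self] at this
      have h2 := this.enorm
      rwa [enorm_zero] at h2
    have e : ∀ n, distH2 0 (u' - (u n : L2 Ω)) = ‖u' - (u n : L2 Ω)‖ₑ +
        ∑ i : Fin 2, ‖d i - weakDeriv i (u n : L2 Ω)‖ₑ +
        ∑ i : Fin 2, ∑ j : Fin 2, ‖d2 i j - weakDeriv j (weakDeriv i (u n : L2 Ω))‖ₑ := by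
      intro n
      rw [distH2_zero_eq]
      simp only [(hsub _ (hm n)).2.2]
      simp only [(hsub _ (hm n)).2.1]
    simp only [e]
    have := ((hz hu').add (tendsto_finsetSum Finset.univ fun i _ => hz (hd i))).add
      (tendsto_finsetSum Finset.univ fun i _ =>
        tendsto_finsetSum Finset.univ fun j _ => hz (hd2 i j))
    simpa using this
  have htrace : ∀ (B : (Plane → ℂ) → Plane → ℂ) (Γ : Set Plane),
      (∀ n, TraceEqZero B Γ (u n : L2 Ω)) → TraceEqZero B Γ u' := by
    intro B Γ h
    refine TraceEqZero.of_approx fun ε hε => ?_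
    obtain ⟨n, hn⟩ := (hlim.eventually (gt_mem_nhds hε)).exists
    exact ⟨u n, hm n, (hsub _ (hm n)).1, h n, hn⟩
  have hmem : MemEnergySpace ΓD ΓM u' :=
    ⟨hu'm, htrace _ _ fun n => (u n).2.trace_eq_zero, htrace _ _ fun n => (u n).2.normal_eq_zero⟩
  refine ⟨⟨u', hmem⟩, ?_⟩
  refine tendsto_nhds_unique ?_ (hg.congr fun n => (hu n).symm)
  refine ((PiLp.continuous_toLp 2 _).tendsto _).comp (tendsto_pi_nhds.2 fun k => ?_)
  fin_cases k
  · exact hu'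
  · have h := (hd2 0 0).const_smul ((√(1 - ν) : ℝ) : ℂ)
    rw [← e2 0 0, ← e1 0] at h
    exact h
  · have h := (hd2 1 1).const_smul ((√(1 - ν) : ℝ) : ℂ)
    rw [← e2 1 1, ← e1 1] at h
    exact h
  · have h := ((hd2 0 0).add (hd2 1 1)).const_smul ((√(ν) : ℝ) : ℂ)
    rw [← e2 0 0, ← e2 1 1, ← e1 0, ← e1 1] at h
    exact h
  · have h := (hd2 0 1).const_smul ((√(2 * (1 - ν)) : ℝ) : ℂ)
    rw [← e2 0 1, ← e1 0] at h
    exact h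

end FormDomain

lemma upperSide_eq (H : ℝ → ℝ) (R : ℝ) : upperSide H R = peakSide H R 1 := by
  ext x; simp [upperSide, peakSide]

lemma lowerSide_eq (H : ℝ → ℝ) (R : ℝ) : lowerSide H R = peakSide H R (-1) := by
  ext x; simp [lowerSide, peakSide]

end KirchhoffPlate

open KirchhoffPlate
theorem theorem1 (Ω : TopologicalSpace.Opens Plane) (H : ℝ → ℝ) (R ν : ℝ) (ΓD ΓN ΓM : Set Plane)
    (hH : IsPeakProfile H R) (hΩ : IsPeakDomain Ω H R)
    (hΓ : IsBoundaryDecomposition Ω ΓD ΓN ΓM) (hν₀ : 0 ≤ ν) (hν₁ : ν < 1 / 2)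
    (hdecay : Filter.Tendsto H Filter.atTop (nhds 0))
    (hbc :
      -- `u = 0` on both sides of the peak
      μH[1] ((upperSide H R ∪ lowerSide H R) \ (ΓD ∪ ΓM)) = 0 ∨
      -- `u = ∂ₙu = 0` on one of the sides
      μH[1] (upperSide H R \ ΓD) = 0 ∨ μH[1] (lowerSide H R \ ΓD) = 0) :
    IsSelfAdjoint (plateOperator Ω ν ΓD ΓM) ∧
      HasDiscreteSpectrum (plateOperator Ω ν ΓD ΓM) := by
  have hbc' : IsClampedPeak H R ΓD ΓM := by
    rw [upperSide_eq, lowerSide_eq] at hbc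
    rcases hbc with h | h | h
    · refine Or.inl fun σ hσ => measure_mono_null (sdiff_subset_sdiff_left ?_) h
      rcases hσ with rfl | rfl
      · exact subset_union_left
      · exact subset_union_right
    · exact Or.inr ⟨1, Or.inl rfl, h⟩
    · exact Or.inr ⟨-1, Or.inr rfl, h⟩
  have hfr : ΓD ∪ ΓM ⊆ frontier (Ω : Set Plane) := by
    rw [← hΓ.closure_union]
    exact union_subset (subset_closure.trans (subset_union_left.trans subset_union_left))
      (subset_closure.trans subset_union_right)
  set F := energyMap Ω ΓD ΓM ν with hF
  have hclosed := isClosed_range_energyMap (ΓD := ΓD) (ΓM := ΓM) hν₀ hν₁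
    (exists_sqNorm_weakDeriv_le hH hΩ hbc')
  have : CompleteSpace (LinearMap.range F) := hclosed.completeSpace_coe
  -- the embedding of the form domain into `L²(Ω)`
  set J : LinearMap.range F →L[ℂ] L2 Ω :=
    (PiLp.proj 2 (fun _ : Fin 5 => L2 Ω) 0 : _ →L[ℂ] L2 Ω) ∘L (LinearMap.range F).subtypeL with hJ
  have hJF : ∀ u, J ⟨F u, LinearMap.mem_range_self F u⟩ = (u : L2 Ω) := fun u => rfl
  have hcompact : IsCompactOperator J := by
    refine isCompactOperator_of_ehrling J fun ε hε => ?_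
    obtain ⟨L, hL⟩ := exists_ehrling hH hΩ hbc' hdecay (half_pos hε)
    refine ⟨L.length, fun k => (2 : ℂ) • (L.get k) ∘L J, ?_⟩
    rintro ⟨_, u, rfl⟩
    have h1 := (hL u u.2).trans (add_le_add_left
      (mul_le_mul_of_nonneg_left (sqEnergy_le_norm_energyMap hν₀ hν₁ u) zero_le) _)
    have e : (L.map fun l => ‖l (u : L2 Ω)‖ₑ ^ 2).sum =
        ENNReal.ofReal (∑ k, ‖L.get k (u : L2 Ω)‖ ^ 2) := by
      rw [ENNReal.ofReal_sum_of_nonneg fun _ _ => by positivity, ← Fin.sum_univ_fun_getElem]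
      refine Finset.sum_congr rfl fun k _ => ?_
      rw [ENNReal.ofReal_pow (norm_nonneg _), ofReal_norm]
      rfl
    have e4 : (4 : ℝ≥0∞) = ENNReal.ofReal 4 := by simp
    rw [e, sqNorm_L2, ← ofReal_norm, ← ENNReal.ofReal_pow (norm_nonneg _),
      ← ENNReal.ofReal_mul (by positivity), e4,
      ← ENNReal.ofReal_mul (by positivity), ← ENNReal.ofReal_add (by positivity) (by positivity),
      ENNReal.ofReal_le_ofReal_iff (by positivity)] at h1
    have e2 : ∑ k, ‖((2 : ℂ) • (L.get k) ∘L J) ⟨F u, LinearMap.mem_range_self F u⟩‖ ^ 2 =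
        4 * ∑ k, ‖L.get k (u : L2 Ω)‖ ^ 2 := by
      rw [Finset.mul_sum]
      refine Finset.sum_congr rfl fun k _ => ?_
      have : ((2 : ℂ) • (L.get k) ∘L J) ⟨F u, LinearMap.mem_range_self F u⟩ =
        2 * L.get k (u : L2 Ω) := rfl
      rw [this, norm_mul, mul_pow]
      norm_num
    rw [e2, hJF]
    refine h1.trans (le_of_eq ?_)
    change _ = ε * ‖F u‖ ^ 2 + _
    ring
  refine isSelfAdjoint_and_discrete_of_form J hcompact (fun f hf => ?_) fun p => ?_
  · exact eq_zero_of_inner_energySpace hfr fun v hv =>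
      hf ⟨F ⟨v, hv⟩, LinearMap.mem_range_self F _⟩
  · constructor
    · rintro ⟨hp, h⟩
      refine ⟨⟨F ⟨p.1, hp⟩, LinearMap.mem_range_self F _⟩, rfl, ?_⟩
      rintro ⟨_, v, rfl⟩
      rw [hJF, inner_add_right, ← h v v.2]
      exact inner_energyMap hν₀ hν₁ _ v
    · rintro ⟨⟨_, u, rfl⟩, hu, h⟩
      rw [hJF] at hu
      refine ⟨hu ▸ u.2, fun v hv => ?_⟩
      have h1 := h ⟨F ⟨v, hv⟩, LinearMap.mem_range_self F _⟩
      rw [hJF, inner_add_right] at h1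
      have h2 := inner_energyMap hν₀ hν₁ u ⟨v, hv⟩
      rw [← hu] at h1 ⊢
      exact add_right_cancel (h2.symm.trans h1)
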